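/- Let $\mathbf C$ be a small simplicially enriched category, let $\widehat{\mathbf C}$ be the category of simplicial functors $\mathbf C^{op}\to\mathbf{sSet}$ with simplicial natural transformations, and call a map of $\widehat{\mathbf C}$ a weak equivalence (resp. fibration) if it is objectwise a weak homotopy equivalence (resp. Kan fibration) of simplicial sets; cofibrations are the maps with the left lifting property against fibrations that are weak equivalences. For a small category $\mathbf J$, weak equivalences and fibrations of $\mathbf J$-diagrams in $\widehat{\mathbf C}$ are defined objectwise, and cofibrations again by the left lifting property. Two objects are equivalent if a finite zigzag of weak equivalences joins them. Let $F\in\widehat{\mathbf C}$ be any object and $X$ a simplicial set, also regarded as a constant object of $\widehat{\mathbf C}$. * $\mathbf{Ext}_{\mathbf C}(F,X)$ is the category whose objects are the maps $E\to X$ in $\widehat{\mathbf C}$ such that, for every vertex $*\to X$, the homotopy pullback of $*\to X\leftarrow E$ is equivalent to $F$; morphisms are the weak equivalences $E\to E'$ over $X$. * $\mathbf X_{\downarrow\Delta}$ is the category of simplices $\Delta^n\to X$ of the simplicial set $X$, and $U_X:\mathbf X_{\downarrow\Delta}\to\widehat{\mathbf C}$ sends $\Delta^n\to X$ to the constant object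 $\Delta^n$. * $\widehat{\mathbf C}^{we}_F$ is the category of objects of $\widehat{\mathbf C}$ equivalent to $F$, with weak equivalences as morphisms. $[\mathbf X_{\downarrow\Delta},\widehat{\mathbf C}^{we}_F]_{\downarrow U_X}$ is the category of functors $K:\mathbf X_{\downarrow\Delta}\to\widehat{\mathbf C}^{we}_F$ equipped with a natural transformation $K\to U_X$ of $\widehat{\mathbf C}$-valued functors; morphisms are the natural transformations over $U_X$ all of whose components are weak equivalences. There exist a functorial factorisation $E\to \mathrm R E\to B$ of the maps $E\to B$ of $\widehat{\mathbf C}$ into a cofibration that is a weak equivalence followed by a fibration, and a functorial cofibrant replacement $\mathrm QK\to K$ in $[\mathbf X_{\downarrow\Delta},\widehat{\mathbf C}]$ (with $\mathrm QK$ cofibrant and $\mathrm QK\to K$ an objectwise weak equivalence). For every choice of such $\mathrm R$ and $\mathrm Q$: 1. The assignment sending $E\to X$ to the diagram $(\Delta^n\to X)\mapsto \Delta^n\times_X \mathrm RE$, with its projection to $U_X$, defines a functor $$\mathrm{RLoc}:\mathbf{Ext}_{\mathbf C}(F,X)\to[\mathbf X_{\downarrow\Delta},\widehat{\mathbf C}^{we}_F]_{\downarrow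 U_X},$$ and the assignment sending $K\to U_X$ to the map $\operatorname{colim}\mathrm QK\to X$ induced by the composites $\mathrm QK(\Delta^n\to X)\to K(\Delta^n\to X)\to\Delta^n\to X$ defines a functor $$\mathrm{LGlob}:[\mathbf X_{\downarrow\Delta},\widehat{\mathbf C}^{we}_F]_{\downarrow U_X}\to\mathbf{Ext}_{\mathbf C}(F,X).$$ 2. The map of nerves $\mathrm N_\bullet\mathrm{RLoc}$ is a weak homotopy equivalence of simplicial sets. 3. $\mathrm N_\bullet\mathrm{LGlob}$ is a weak homotopy inverse of $\mathrm N_\bullet\mathrm{RLoc}$: the two maps become mutually inverse in the localisation of simplicial sets at the weak homotopy equivalences. -/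

import Mathlib

open CategoryTheory Limits MonoidalCategory Opposite HomotopicalAlgebra
open scoped Simplicial

universe u

noncomputable section

namespace ModFib

/-! ### Weak equivalences of simplicial sets -/

/-- Weak homotopy equivalences of simplicial sets: `f : A ⟶ B` such that, for every Kan complex
`K`, precomposition with `f` induces a bijection `π₀ Map(B, K) → π₀ Map(A, K)`. -/
def sWeq : MorphismProperty SSet.{u} := fun _ _ f =>
  ∀ (K : SSet.{u}) [SSet.KanComplex K],
    Function.Bijective (SSet.mapπ₀ ((MonoidalClosed.pre f).app K))

instance : sWeq.{u}.IsMultiplicative where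
  id_mem A K _ := by
    have : SSet.mapπ₀ ((MonoidalClosed.pre (𝟙 A)).app K) = id := by
      funext x
      rw [MonoidalClosed.pre_id]
      exact SSet.mapπ₀_id_apply x
    rw [this]
    exact Function.bijective_id
  comp_mem f g hf hg K _ := by
    have : SSet.mapπ₀ ((MonoidalClosed.pre (f ≫ g)).app K) =
        SSet.mapπ₀ ((MonoidalClosed.pre f).app K) ∘
          SSet.mapπ₀ ((MonoidalClosed.pre g).app K) := by
      funext x
      rw [MonoidalClosed.pre_map]
      exact SSet.mapπ₀_comp_apply _ _ x
    rw [this]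
    exact (hf K).comp (hg K)

/-! ### Diagrams of pullbacks -/

section PullbackDiagram

universe v₁ v₂ u₁ u₂

variable {D : Type u₂} [Category.{v₂} D] [HasPullbacks D] {B : D}

/-- Functoriality of the pullback of `V → B ← E` in `V` and `E`. -/
def pbMap {V V' E E' : D} {t : V ⟶ B} {t' : V' ⟶ B} {p : E ⟶ B} {p' : E' ⟶ B}
    (v : V ⟶ V') (f : E ⟶ E') (hv : v ≫ t' = t) (hf : f ≫ p' = p) :
    pullback t p ⟶ pullback t' p' :=
  pullback.lift (pullback.fst t p ≫ v) (pullback.snd t p ≫ f)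
    (by rw [Category.assoc, Category.assoc, hv, hf, pullback.condition])

lemma pbMap_fst {V V' E E' : D} {t : V ⟶ B} {t' : V' ⟶ B} {p : E ⟶ B} {p' : E' ⟶ B}
    (v : V ⟶ V') (f : E ⟶ E') (hv : v ≫ t' = t) (hf : f ≫ p' = p) :
    pbMap v f hv hf ≫ pullback.fst t' p' = pullback.fst t p ≫ v :=
  pullback.lift_fst _ _ _

lemma pbMap_snd {V V' E E' : D} {t : V ⟶ B} {t' : V' ⟶ B} {p : E ⟶ B} {p' : E' ⟶ B}
    (v : V ⟶ V') (f : E ⟶ E') (hv : v ≫ t' = t) (hf : f ≫ p' = p) :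
    pbMap v f hv hf ≫ pullback.snd t' p' = pullback.snd t p ≫ f :=
  pullback.lift_snd _ _ _

lemma pbMap_id {V E : D} {t : V ⟶ B} {p : E ⟶ B} {v : V ⟶ V} {f : E ⟶ E} (hv : v ≫ t = t)
    (hf : f ≫ p = p) (hv' : v = 𝟙 V) (hf' : f = 𝟙 E) : pbMap v f hv hf = 𝟙 (pullback t p) := by
  subst hv' hf'
  apply pullback.hom_ext
  · rw [pbMap_fst, Category.comp_id, Category.id_comp]
  · rw [pbMap_snd, Category.comp_id, Category.id_comp]

lemma pbMap_comp {V V' V'' E E' E'' : D} {t : V ⟶ B} {t' : V' ⟶ B} {t'' : V'' ⟶ B}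
    {p : E ⟶ B} {p' : E' ⟶ B} {p'' : E'' ⟶ B}
    {v : V ⟶ V'} {f : E ⟶ E'} (hv : v ≫ t' = t) (hf : f ≫ p' = p)
    {v' : V' ⟶ V''} {f' : E' ⟶ E''} (hv' : v' ≫ t'' = t') (hf' : f' ≫ p'' = p')
    {v'' : V ⟶ V''} {f'' : E ⟶ E''} (hv'' : v'' ≫ t'' = t) (hf'' : f'' ≫ p'' = p)
    (h : v'' = v ≫ v') (h' : f'' = f ≫ f') :
    pbMap v'' f'' hv'' hf'' = pbMap v f hv hf ≫ pbMap v' f' hv' hf' := by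
  subst h h'
  apply pullback.hom_ext
  · rw [pbMap_fst, Category.assoc, pbMap_fst, reassoc_of% (pbMap_fst v f hv hf)]
  · rw [pbMap_snd, Category.assoc, pbMap_snd, reassoc_of% (pbMap_snd v f hv hf)]

variable {J : Type u₁} [Category.{v₁} J] {V : J ⥤ D} (t : ∀ j, V.obj j ⟶ B)
  (ht : ∀ ⦃i j : J⦄ (φ : i ⟶ j), V.map φ ≫ t j = t i)

/-- The diagram of pullbacks of `V j → B ← E`. -/
def pullbackObj {E : D} (p : E ⟶ B) : J ⥤ D where
  obj j := pullback (t j) p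
  map φ := pbMap (V.map φ) (𝟙 E) (ht φ) (Category.id_comp p)
  map_id j := pbMap_id (ht _) (Category.id_comp p) (V.map_id j) rfl
  map_comp φ ψ := pbMap_comp (ht φ) (Category.id_comp p) (ht ψ) (Category.id_comp p) (ht _)
    (Category.id_comp p) (V.map_comp φ ψ) (Category.id_comp _).symm

/-- The projection from the diagram of pullbacks of `V j → B ← E` to `V`. -/
def pullbackFst {E : D} (p : E ⟶ B) : pullbackObj t ht p ⟶ V where
  app j := pullback.fst (t j) p
  naturality _ _ φ := pbMap_fst (V.map φ) (𝟙 E) (ht φ) (Category.id_comp p)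

/-- The map of diagrams of pullbacks induced by a map over `B`. -/
def pullbackMap {E E' : D} {p : E ⟶ B} {p' : E' ⟶ B} (f : E ⟶ E') (w : f ≫ p' = p) :
    pullbackObj t ht p ⟶ pullbackObj t ht p' where
  app j := pbMap (𝟙 (V.obj j)) f (Category.id_comp _) w
  naturality i j φ :=
    (pbMap_comp (ht φ) (Category.id_comp p) (Category.id_comp (t j)) w (ht φ) w
      (Category.comp_id _).symm (Category.id_comp _).symm).symm.trans
    (pbMap_comp (Category.id_comp (t i)) w (ht φ) (Category.id_comp p') (ht φ) w
      (Category.id_comp _).symm (Category.comp_id _).symm)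

/-- Given a diagram `V` with compatible maps `V j ⟶ B`, the functor sending `E ⟶ B` to the diagram
of pullbacks of `V j → B ← E`, with its projection to `V`. -/
def pullbackDiagram : Over B ⥤ Over V where
  obj E := Over.mk (pullbackFst t ht E.hom)
  map {E E'} f := Over.homMk (pullbackMap t ht f.left (Over.w f)) (by
    ext j : 2
    exact (pbMap_fst (𝟙 (V.obj j)) f.left (Category.id_comp (t j)) (Over.w f)).trans
      (Category.comp_id _))
  map_id E := by
    ext j : 3
    exact pbMap_id (Category.id_comp (t j)) (Category.id_comp E.hom) rfl rfl
  map_comp f g := by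
    ext j : 3
    exact pbMap_comp (Category.id_comp (t j)) (Over.w f) (Category.id_comp (t j)) (Over.w g)
      (Category.id_comp (t j)) (Over.w (f ≫ g)) (Category.comp_id _).symm rfl

end PullbackDiagram

/-! ### Simplicial presheaves on a simplicial category -/

section Presheaves

variable (C : Type u) [EnrichedCategory SSet.{u} C]

/-- A simplicial functor `Cᵒᵖ → sSet` on a small simplicially enriched category `C`, given by
unital and associative action maps `C(c, d) × F d → F c`. -/
structure SPsh where
  /-- the value at an object -/
  obj : C → SSet.{u}
  /-- the action maps -/
  act (c d : C) : ((c ⟶[SSet.{u}] d) ⊗ obj d) ⟶ obj c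
  act_id (c : C) : (λ_ (obj c)).inv ≫ eId SSet.{u} c ▷ obj c ≫ act c c = 𝟙 (obj c)
  act_comp (b c d : C) :
    eComp SSet.{u} b c d ▷ obj d ≫ act b d =
      (α_ _ _ _).hom ≫ (b ⟶[SSet.{u}] c) ◁ act c d ≫ act b c

variable {C}

namespace SPsh

/-- Morphisms of simplicial presheaves: families of simplicial maps compatible with the whole
simplicial action (not only with its `0`-simplices). -/
@[ext]
structure Hom (F G : SPsh C) where
  /-- the components -/
  app (c : C) : F.obj c ⟶ G.obj c
  naturality (c d : C) : F.act c d ≫ app c = (c ⟶[SSet.{u}] d) ◁ app d ≫ G.act c d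

instance : Category.{u} (SPsh C) where
  Hom := Hom
  id F := ⟨fun c => 𝟙 (F.obj c), fun c d => by simp⟩
  comp f g := ⟨fun c => f.app c ≫ g.app c, fun c d => by
    rw [← Category.assoc, f.naturality, Category.assoc, g.naturality]
    simp⟩

@[ext]
lemma hom_ext {F G : SPsh C} {f g : F ⟶ G} (h : ∀ c, f.app c = g.app c) : f = g :=
  Hom.ext (funext h)

@[simp] lemma id_app (F : SPsh C) (c : C) : Hom.app (𝟙 F) c = 𝟙 (F.obj c) := rfl

@[simp] lemma comp_app {F G H : SPsh C} (f : F ⟶ G) (g : G ⟶ H) (c : C) :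
    Hom.app (f ≫ g) c = f.app c ≫ g.app c := rfl

variable (C) in
/-- The trivial (constant) simplicial presheaf on a simplicial set. -/
@[simps]
def const : SSet.{u} ⥤ SPsh C where
  obj A :=
    { obj := fun _ => A
      act := fun _ _ => SemiCartesianMonoidalCategory.snd _ _
      act_id := fun _ => by ext; rfl
      act_comp := fun _ _ _ => by ext; rfl }
  map f := { app := fun _ => f, naturality := fun _ _ => by ext; rfl }

/-! Limits and colimits of simplicial presheaves are computed objectwise. -/

section Limits

universe w w'

variable {J : Type w} [Category.{w'} J] (K : J ⥤ SPsh C)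

/-- The diagram of values at an object. -/
abbrev diag (c : C) : J ⥤ SSet.{u} where
  obj j := (K.obj j).obj c
  map f := (K.map f).app c
  map_id j := by rw [K.map_id]; rfl
  map_comp f g := by rw [K.map_comp]; rfl

section

variable [HasLimitsOfShape J SSet.{u}]

/-- The projections of the objectwise limit. -/
def limπ (c : C) (j : J) : limit (diag K c) ⟶ (K.obj j).obj c := limit.π (diag K c) j

lemma limπ_w (c : C) {i j : J} (f : i ⟶ j) :
    limπ K c i ≫ (K.map f).app c = limπ K c j := limit.w (diag K c) f

variable {K} in
lemma lim_hom_ext {c : C} {A : SSet.{u}} {f g : A ⟶ limit (diag K c)}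
    (h : ∀ j, f ≫ limπ K c j = g ≫ limπ K c j) : f = g := limit.hom_ext h

/-- Maps into the objectwise limit. -/
def limLift {c : C} {A : SSet.{u}} (f : ∀ j, A ⟶ (K.obj j).obj c)
    (hf : ∀ ⦃i j⦄ (φ : i ⟶ j), f i ≫ (K.map φ).app c = f j) : A ⟶ limit (diag K c) :=
  limit.lift (diag K c)
    { pt := A, π := { app := f, naturality := fun _ _ φ => (Category.id_comp _).trans (hf φ).symm } }

lemma limLift_π {c : C} {A : SSet.{u}} (f : ∀ j, A ⟶ (K.obj j).obj c)
    (hf : ∀ ⦃i j⦄ (φ : i ⟶ j), f i ≫ (K.map φ).app c = f j) (j : J) :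
    limLift K f hf ≫ limπ K c j = f j := limit.lift_π _ _

/-- The objectwise action on the limit of a diagram. -/
def limAct (c d : C) :
    ((c ⟶[SSet.{u}] d) ⊗ limit (diag K d)) ⟶ limit (diag K c) :=
  limLift K (fun j => (c ⟶[SSet.{u}] d) ◁ limπ K d j ≫ (K.obj j).act c d) (fun i j f => by
    rw [Category.assoc, (K.map f).naturality c d, ← limπ_w K d f,
      MonoidalCategory.whiskerLeft_comp, Category.assoc])

lemma limAct_π (c d : C) (j : J) :
    limAct K c d ≫ limπ K c j = (c ⟶[SSet.{u}] d) ◁ limπ K d j ≫ (K.obj j).act c d :=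
  limLift_π _ _ _ _

/-- The objectwise limit. -/
def limitObj : SPsh C where
  obj c := limit (diag K c)
  act := limAct K
  act_id c := lim_hom_ext fun j => by
    rw [Category.assoc, Category.assoc, limAct_π, ← whisker_exchange_assoc,
      ← leftUnitor_inv_naturality_assoc, (K.obj j).act_id c, Category.id_comp, Category.comp_id]
  act_comp b c d := lim_hom_ext fun j => by
    rw [Category.assoc, Category.assoc, Category.assoc, limAct_π, limAct_π,
      ← whisker_exchange_assoc, ← MonoidalCategory.whiskerLeft_comp_assoc, limAct_π,
      (K.obj j).act_comp b c d, MonoidalCategory.whiskerLeft_comp, Category.assoc,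
      tensor_whiskerLeft_assoc, Iso.inv_hom_id_assoc]

/-- The limit cone. -/
def limitCone : Cone K where
  pt := limitObj K
  π :=
    { app := fun j => { app := fun c => limπ K c j, naturality := fun c d => limAct_π K c d j }
      naturality := fun i j f => by
        ext c : 1
        exact (Category.id_comp _).trans (limπ_w K c f).symm }

lemma limLift_naturality (s : Cone K) (c d : C) :
    s.pt.act c d ≫ limLift K (fun j => (s.π.app j).app c)
        (fun _ _ φ => congrArg (fun f : s.pt ⟶ K.obj _ => f.app c) (s.w φ)) =
      (c ⟶[SSet.{u}] d) ◁ limLift K (fun j => (s.π.app j).app d)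
        (fun _ _ φ => congrArg (fun f : s.pt ⟶ K.obj _ => f.app d) (s.w φ)) ≫ limAct K c d :=
  lim_hom_ext fun j => by
    rw [Category.assoc, Category.assoc, limAct_π, limLift_π,
      ← MonoidalCategory.whiskerLeft_comp_assoc, limLift_π]
    exact (s.π.app j).naturality c d

/-- The limit cone is a limit cone. -/
def limitConeIsLimit : IsLimit (limitCone K) where
  lift s := { app := fun c => _, naturality := limLift_naturality K s }
  fac s j := hom_ext fun c => limLift_π K _
    (fun _ _ φ => congrArg (fun f : s.pt ⟶ K.obj _ => f.app c) (s.w φ)) j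
  uniq s m hm := hom_ext fun c => lim_hom_ext fun j => by
    exact (congrArg (fun f : s.pt ⟶ K.obj j => f.app c) (hm j)).trans (limLift_π K _
      (fun _ _ φ => congrArg (fun f : s.pt ⟶ K.obj _ => f.app c) (s.w φ)) j).symm

instance : HasLimitsOfShape J (SPsh C) where
  has_limit K := ⟨⟨⟨limitCone K, limitConeIsLimit K⟩⟩⟩

end

section

variable [HasColimitsOfShape J SSet.{u}]

/-- The inclusions of the objectwise colimit. -/
def colimι (c : C) (j : J) : (K.obj j).obj c ⟶ colimit (diag K c) := colimit.ι (diag K c) j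

lemma colimι_w (c : C) {i j : J} (f : i ⟶ j) :
    (K.map f).app c ≫ colimι K c j = colimι K c i := colimit.w (diag K c) f

variable {K} in
lemma colim_hom_ext {c : C} {A : SSet.{u}} {f g : colimit (diag K c) ⟶ A}
    (h : ∀ j, colimι K c j ≫ f = colimι K c j ≫ g) : f = g := colimit.hom_ext h

/-- Maps out of the objectwise colimit. -/
def colimDesc {c : C} {A : SSet.{u}} (f : ∀ j, (K.obj j).obj c ⟶ A)
    (hf : ∀ ⦃i j⦄ (φ : i ⟶ j), (K.map φ).app c ≫ f j = f i) : colimit (diag K c) ⟶ A :=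
  colimit.desc (diag K c)
    { pt := A, ι := { app := f, naturality := fun _ _ φ => (hf φ).trans (Category.comp_id _).symm } }

lemma ι_colimDesc {c : C} {A : SSet.{u}} (f : ∀ j, (K.obj j).obj c ⟶ A)
    (hf : ∀ ⦃i j⦄ (φ : i ⟶ j), (K.map φ).app c ≫ f j = f i) (j : J) :
    colimι K c j ≫ colimDesc K f hf = f j := colimit.ι_desc _ _

/-- The objectwise action on the colimit of a diagram. -/
def colimAct (c d : C) :
    ((c ⟶[SSet.{u}] d) ⊗ colimit (diag K d)) ⟶ colimit (diag K c) :=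
  MonoidalClosed.uncurry (colimDesc K
    (fun j => MonoidalClosed.curry ((K.obj j).act c d ≫ colimι K c j)) (fun i j f => by
      rw [← MonoidalClosed.curry_natural_left, ← colimι_w K c f, ← Category.assoc,
        ← Category.assoc, (K.map f).naturality c d]))

lemma ι_colimAct (c d : C) (j : J) :
    (c ⟶[SSet.{u}] d) ◁ colimι K d j ≫ colimAct K c d = (K.obj j).act c d ≫ colimι K c j := by
  rw [colimAct, ← MonoidalClosed.uncurry_natural_left, ι_colimDesc]
  exact MonoidalClosed.uncurry_curry _

variable {K} in
lemma tensor_colim_hom_ext {A B : SSet.{u}} {c : C} {f g : A ⊗ colimit (diag K c) ⟶ B}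
    (h : ∀ j, A ◁ colimι K c j ≫ f = A ◁ colimι K c j ≫ g) : f = g := by
  apply MonoidalClosed.curry_injective
  refine colim_hom_ext fun j => ?_
  rw [← MonoidalClosed.curry_natural_left, ← MonoidalClosed.curry_natural_left, h]

/-- The objectwise colimit. -/
def colimitObj : SPsh C where
  obj c := colimit (diag K c)
  act := colimAct K
  act_id c := colim_hom_ext fun j => by
    rw [leftUnitor_inv_naturality_assoc, whisker_exchange_assoc, ι_colimAct, Category.comp_id,
      ← Category.assoc, ← Category.assoc, Category.assoc _ _ ((K.obj j).act c c),
      (K.obj j).act_id c, Category.id_comp]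
  act_comp b c d := tensor_colim_hom_ext fun j => by
    rw [whisker_exchange_assoc, ι_colimAct, ← Category.assoc, (K.obj j).act_comp b c d,
      tensor_whiskerLeft_assoc, Iso.inv_hom_id_assoc, ← MonoidalCategory.whiskerLeft_comp_assoc,
      ι_colimAct, MonoidalCategory.whiskerLeft_comp_assoc, ι_colimAct, Category.assoc,
      Category.assoc]

/-- The colimit cocone. -/
def colimitCocone : Cocone K where
  pt := colimitObj K
  ι :=
    { app := fun j =>
        { app := fun c => colimι K c j, naturality := fun c d => (ι_colimAct K c d j).symm }
      naturality := fun i j f => by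
        ext c : 1
        exact (colimι_w K c f).trans (Category.comp_id _).symm }

lemma colimDesc_naturality (s : Cocone K) (c d : C) :
    colimAct K c d ≫ colimDesc K (fun j => (s.ι.app j).app c)
        (fun _ _ φ => congrArg (fun f : K.obj _ ⟶ s.pt => f.app c) (s.w φ)) =
      (c ⟶[SSet.{u}] d) ◁ colimDesc K (fun j => (s.ι.app j).app d)
        (fun _ _ φ => congrArg (fun f : K.obj _ ⟶ s.pt => f.app d) (s.w φ)) ≫ s.pt.act c d :=
  tensor_colim_hom_ext fun j => by
    rw [← Category.assoc, ι_colimAct, Category.assoc,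
      ← MonoidalCategory.whiskerLeft_comp_assoc, ι_colimDesc, ι_colimDesc]
    exact (s.ι.app j).naturality c d

/-- The colimit cocone is a colimit cocone. -/
def colimitCoconeIsColimit : IsColimit (colimitCocone K) where
  desc s := { app := fun c => _, naturality := colimDesc_naturality K s }
  fac s j := hom_ext fun c => ι_colimDesc K _
    (fun _ _ φ => congrArg (fun f : K.obj _ ⟶ s.pt => f.app c) (s.w φ)) j
  uniq s m hm := hom_ext fun c => colim_hom_ext fun j => by
    exact (congrArg (fun f : K.obj j ⟶ s.pt => f.app c) (hm j)).trans (ι_colimDesc K _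
      (fun _ _ φ => congrArg (fun f : K.obj _ ⟶ s.pt => f.app c) (s.w φ)) j).symm

instance : HasColimitsOfShape J (SPsh C) where
  has_colimit K := ⟨⟨⟨colimitCocone K, colimitCoconeIsColimit K⟩⟩⟩

end

end Limits

end SPsh

/-! ### The projective model structure on simplicial presheaves -/

/-- Projective weak equivalences: objectwise weak equivalences. -/
def weq : MorphismProperty (SPsh C) := fun _ _ f => ∀ c, sWeq (f.app c)

/-- Projective fibrations: objectwise Kan fibrations. -/
def fib : MorphismProperty (SPsh C) := fun _ _ f => ∀ c, SSet.modelCategoryQuillen.J.rlp (f.app c)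

/-- Projective cofibrations: the left lifting property against trivial fibrations. -/
def cof : MorphismProperty (SPsh C) := (fib ⊓ weq).llp

lemma weq_id (F : SPsh C) : weq (𝟙 F) := fun c => sWeq.id_mem (F.obj c)

lemma weq_comp {F G H : SPsh C} {f : F ⟶ G} {g : G ⟶ H} (hf : weq f) (hg : weq g) :
    weq (f ≫ g) := fun c => sWeq.comp_mem _ _ (hf c) (hg c)

/-- Two simplicial presheaves are equivalent if a finite zigzag of weak equivalences
connects them. -/
def Equivalent (F G : SPsh C) : Prop :=
  Relation.EqvGen (fun A B : SPsh C => ∃ f : A ⟶ B, weq f) F G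

/-- The category of simplicial presheaves equivalent to `F`, with the weak equivalences as
morphisms. -/
structure WeCat (F : SPsh C) where
  /-- the underlying simplicial presheaf -/
  obj : SPsh C
  equiv : Equivalent obj F

instance (F : SPsh C) : Category.{u} (WeCat F) where
  Hom A B := { f : A.obj ⟶ B.obj // weq f }
  id A := ⟨𝟙 A.obj, weq_id _⟩
  comp f g := ⟨f.1 ≫ g.1, weq_comp f.2 g.2⟩

/-- The inclusion of the category of simplicial presheaves equivalent to `F`. -/
def WeCat.incl (F : SPsh C) : WeCat F ⥤ SPsh C where
  obj A := A.obj
  map f := f.1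

/-! ### Extensions -/

/-- The homotopy pullback of `x : * → X` and `p : E → X` is equivalent to `F`. The homotopy
pullback is the strict pullback along a fibrant replacement `q : E' → X` of `p` (the model
structure is right proper, so it is enough to replace one of the two maps). -/
def HasHomotopyFiber (F : SPsh C) {X : SSet.{u}} {E : SPsh C} (p : E ⟶ (SPsh.const C).obj X)
    (x : Δ[0] ⟶ X) : Prop :=
  ∃ (E' : SPsh C) (i : E ⟶ E') (q : E' ⟶ (SPsh.const C).obj X),
    weq i ∧ fib q ∧ i ≫ q = p ∧ Equivalent (pullback ((SPsh.const C).map x) q) F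

/-- Extensions of the trivial presheaf `X` by `F`: maps `E → X` whose homotopy fibre at every
vertex of `X` is equivalent to `F`. -/
structure Ext (F : SPsh C) (X : SSet.{u}) where
  /-- the total object -/
  E : SPsh C
  /-- the projection -/
  p : E ⟶ (SPsh.const C).obj X
  fiber : ∀ x : Δ[0] ⟶ X, HasHomotopyFiber F p x

/-- Morphisms of extensions are the weak equivalences over `X`. -/
instance (F : SPsh C) (X : SSet.{u}) : Category.{u} (Ext F X) where
  Hom A B := { f : A.E ⟶ B.E // weq f ∧ f ≫ B.p = A.p }
  id A := ⟨𝟙 A.E, weq_id _, Category.id_comp _⟩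
  comp f g := ⟨f.1 ≫ g.1, weq_comp f.2.1 g.2.1, by rw [Category.assoc, g.2.2, f.2.2]⟩

/-- The forgetful functor from extensions to presheaves over `X`. -/
def Ext.toOver (F : SPsh C) (X : SSet.{u}) : Ext F X ⥤ Over ((SPsh.const C).obj X) where
  obj A := Over.mk A.p
  map f := Over.homMk f.1 f.2.2

/-! ### Diagrams on the category of simplices -/

/-- The cosimplicial object `n ↦ Δ[n]`, as a functor to simplicial sets. -/
abbrev simplexFunctor : SimplexCategory ⥤ SSet.{u} := SSet.stdSimplex.{u}

/-- The category of simplices of `X`: objects are the maps `Δ[n] ⟶ X` and morphisms are the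
commutative triangles over `X`. -/
abbrev Simplices (X : SSet.{u}) : Type u := CostructuredArrow simplexFunctor.{u} X

variable (C) in
/-- The functor sending `Δ[n] ⟶ X` to the trivial presheaf `Δ[n]`. -/
def U (X : SSet.{u}) : Simplices X ⥤ SPsh C :=
  CostructuredArrow.proj simplexFunctor.{u} X ⋙ simplexFunctor.{u} ⋙ SPsh.const C

variable (C) in
/-- The tautological map from `U` at a simplex to `X`. -/
def toX {X : SSet.{u}} (σ : Simplices X) : (U C X).obj σ ⟶ (SPsh.const C).obj X :=
  (SPsh.const C).map σ.hom

lemma U_map_toX {X : SSet.{u}} ⦃σ τ : Simplices X⦄ (φ : σ ⟶ τ) :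
    (U C X).map φ ≫ toX C τ = toX C σ :=
  ((SPsh.const C).map_comp _ _).symm.trans (congrArg (SPsh.const C).map (CostructuredArrow.w φ))

/-- The category of local data: functors `K` from the category of simplices of `X` to the category
of presheaves equivalent to `F` and weak equivalences, equipped with a natural transformation of
presheaf-valued functors `K ⟶ U`. Morphisms are the natural weak equivalences over `U`. -/
abbrev LocData (F : SPsh C) (X : SSet.{u}) :=
  CostructuredArrow ((Functor.whiskeringRight (Simplices X) _ _).obj (WeCat.incl F)) (U C X)

/-- The forgetful functor from local data to all diagrams over `U`. -/
def LocData.toOver (F : SPsh C) (X : SSet.{u}) : LocData F X ⥤ Over (U C X) :=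
  CostructuredArrow.toOver _ _

/-! ### Localisation -/

variable (C) in
/-- A functorial factorisation into a trivial cofibration followed by a fibration. -/
abbrev FibrantFactorization :=
  MorphismProperty.FunctorialFactorizationData (cof ⊓ weq : MorphismProperty (SPsh C)) fib

/-- The functor sending `E → B` to the fibration `R E → B`. -/
def fibRep (R : FibrantFactorization C) (B : SPsh C) : Over B ⥤ Over B where
  obj E := Over.mk (R.p.app (Arrow.mk E.hom))
  map {E E'} f := Over.homMk
    (R.Z.map (Arrow.homMk f.left (𝟙 B) (by simp) : Arrow.mk E.hom ⟶ Arrow.mk E'.hom))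
    ((R.p.naturality _).trans (Category.comp_id _))
  map_id E := by
    ext : 1
    exact R.Z.map_id _
  map_comp f g := by
    ext : 1
    refine Eq.trans ?_ (R.Z.map_comp _ _)
    exact congrArg R.Z.map (by ext <;> simp)

/-- The localisation of `E → X`: the diagram sending `Δ[n] ⟶ X` to the pullback of
`Δ[n] → X ← E`, with its projection to `U`. -/
def Loc (X : SSet.{u}) : Over ((SPsh.const C).obj X) ⥤ Over (U C X) :=
  pullbackDiagram (toX C) U_map_toX

/-- The functor `RLoc`, on all presheaves over `X`. -/
def RLocOver (R : FibrantFactorization C) (X : SSet.{u}) :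
    Over ((SPsh.const C).obj X) ⥤ Over (U C X) :=
  fibRep R _ ⋙ Loc X

/-- `RLoc` takes extensions to local data, and morphisms of extensions to morphisms of local
data. -/
structure RLocRestricts (R : FibrantFactorization C) (F : SPsh C) (X : SSet.{u}) : Prop where
  equiv : ∀ (A : Ext F X) (σ : Simplices X),
    Equivalent (((RLocOver R X).obj ((Ext.toOver F X).obj A)).left.obj σ) F
  weq_map : ∀ (A : Ext F X) ⦃σ τ : Simplices X⦄ (φ : σ ⟶ τ),
    weq (((RLocOver R X).obj ((Ext.toOver F X).obj A)).left.map φ)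
  weq_app : ∀ ⦃A B : Ext F X⦄ (f : A ⟶ B) (σ : Simplices X),
    weq (((RLocOver R X).map ((Ext.toOver F X).map f)).left.app σ)

/-- The functor `RLoc` from extensions to local data. -/
def RLoc (R : FibrantFactorization C) (F : SPsh C) (X : SSet.{u}) (h : RLocRestricts R F X) :
    Ext F X ⥤ LocData F X where
  obj A := CostructuredArrow.mk
    (Y := ({ obj := fun σ => ⟨_, h.equiv A σ⟩
             map := fun φ => ⟨_, h.weq_map A φ⟩
             map_id := fun σ => Subtype.ext
               (((RLocOver R X).obj ((Ext.toOver F X).obj A)).left.map_id σ)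
             map_comp := fun φ ψ => Subtype.ext
               (((RLocOver R X).obj ((Ext.toOver F X).obj A)).left.map_comp φ ψ) } :
            Simplices X ⥤ WeCat F))
    { app := fun σ => ((RLocOver R X).obj ((Ext.toOver F X).obj A)).hom.app σ
      naturality := ((RLocOver R X).obj ((Ext.toOver F X).obj A)).hom.naturality }
  map f := CostructuredArrow.homMk
    { app := fun σ => ⟨_, h.weq_app f σ⟩
      naturality := fun _ _ φ => Subtype.ext
        (((RLocOver R X).map ((Ext.toOver F X).map f)).left.naturality φ) }
    (by
      ext σ : 2
      exact congrArg (fun t => NatTrans.app t σ)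
        (Over.w ((RLocOver R X).map ((Ext.toOver F X).map f))))
  map_id A := by
    ext σ : 3
    refine Subtype.ext ?_
    exact congrArg (fun t => NatTrans.app (CommaMorphism.left t) σ)
      ((Ext.toOver F X ⋙ RLocOver R X).map_id A)
  map_comp f g := by
    ext σ : 3
    refine Subtype.ext ?_
    exact congrArg (fun t => NatTrans.app (CommaMorphism.left t) σ)
      ((Ext.toOver F X ⋙ RLocOver R X).map_comp f g)

/-! ### Globalisation -/

variable (C) in
/-- A functorial cofibrant replacement in the projective model structure on `J`-diagrams of
simplicial presheaves (weak equivalences and fibrations are objectwise). -/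
structure CofibrantReplacement (J : Type u) [Category.{0} J] where
  /-- the replacement functor -/
  Q : (J ⥤ SPsh C) ⥤ (J ⥤ SPsh C)
  /-- the augmentation -/
  π : Q ⟶ 𝟭 _
  cofibrant (K : J ⥤ SPsh C) :
    (MorphismProperty.functorCategory (fib ⊓ weq : MorphismProperty (SPsh C)) J).llp
      (initial.to (Q.obj K))
  weq_app (K : J ⥤ SPsh C) (j : J) : weq ((π.app K).app j)

/-- The functor `LGlob`, on all diagrams over `U`: it sends `K ⟶ U` to
`colim QK → colim K → colim U = X`. -/
def LGlobOver {X : SSet.{u}} (Q : CofibrantReplacement C (Simplices X)) :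
    Over (U C X) ⥤ Over ((SPsh.const C).obj X) where
  obj K := Over.mk (colimit.desc (Q.Q.obj K.left)
    { pt := (SPsh.const C).obj X
      ι :=
        { app := fun σ => (Q.π.app K.left).app σ ≫ K.hom.app σ ≫ toX C σ
          naturality := fun σ τ φ => by
            have h₁ := (Q.π.app K.left).naturality φ
            have h₂ := K.hom.naturality φ
            dsimp at h₁ h₂ ⊢
            rw [reassoc_of% h₁, reassoc_of% h₂, U_map_toX, Category.comp_id] } })
  map {K L} f := Over.homMk (colimMap (Q.Q.map f.left)) (by
    refine colimit.hom_ext fun σ => ?_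
    have h₁ := congrArg (fun t => NatTrans.app t σ) (Q.π.naturality f.left)
    have h₂ := congrArg (fun t => NatTrans.app t σ) (Over.w f)
    dsimp at h₁ h₂ ⊢
    rw [ι_colimMap_assoc, colimit.ι_desc, colimit.ι_desc]
    dsimp
    rw [reassoc_of% h₁, reassoc_of% h₂])
  map_id K := by
    ext1
    refine colimit.hom_ext fun σ => ?_
    simp
  map_comp f g := by
    ext1
    refine colimit.hom_ext fun σ => ?_
    simp

/-- `LGlob` takes local data to extensions, and morphisms of local data to morphisms of
extensions. -/
structure LGlobRestricts {X : SSet.{u}} (Q : CofibrantReplacement C (Simplices X)) (F : SPsh C) :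
    Prop where
  fiber : ∀ (K : LocData F X) (x : Δ[0] ⟶ X),
    HasHomotopyFiber F ((LGlobOver Q).obj ((LocData.toOver F X).obj K)).hom x
  weq_map : ∀ ⦃K L : LocData F X⦄ (f : K ⟶ L),
    weq ((LGlobOver Q).map ((LocData.toOver F X).map f)).left

/-- The functor `LGlob` from local data to extensions. -/
def LGlob {X : SSet.{u}} (Q : CofibrantReplacement C (Simplices X)) (F : SPsh C)
    (h : LGlobRestricts Q F) : LocData F X ⥤ Ext F X where
  obj K := ⟨_, ((LGlobOver Q).obj ((LocData.toOver F X).obj K)).hom, h.fiber K⟩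
  map f := ⟨_, h.weq_map f, Over.w ((LGlobOver Q).map ((LocData.toOver F X).map f))⟩
  map_id K := Subtype.ext
    (congrArg CommaMorphism.left ((LocData.toOver F X ⋙ LGlobOver Q).map_id K))
  map_comp f g := Subtype.ext
    (congrArg CommaMorphism.left ((LocData.toOver F X ⋙ LGlobOver Q).map_comp f g))

end Presheaves

end ModFib

end

open CategoryTheory Limits MonoidalCategory Opposite HomotopicalAlgebra
open scoped Simplicial

noncomputable section

namespace ModFib

open SemiCartesianMonoidalCategory CartesianMonoidalCategory SSet

/-! Localisation and globalisation are inverse up to natural zigzags of weak equivalences, and a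
natural transformation induces a homotopy of nerves. Two comparisons carry this. For every `A → X`
the map `colim Q(Loc A) → A` is a weak equivalence (`weq_of_Loc`); taking `A = RE` joins `LGlob
(RLoc E)` to `RE`, and so to `E`. For a diagram `L → U` whose transition maps are weak equivalences,
`QL(σ) → σ ×_X R(colim QL)` is a weak equivalence (`weq_to_pullback`); with `QL → L` this joins `L`
to `RLoc (LGlob L)`. The second comparison also computes the homotopy fibres of `colim QL`, so that
`LGlob` does land in extensions. The composites of nerves are therefore identities in the
localisation. Since homotopy classes of maps to a Kan complex factor through the localisation, a map
that becomes invertible there is in `sWeq`, which gives the assertion on `RLoc`.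

Both comparisons are checked at each object of `C`, hence for simplicial sets. A diagram `M` on the
simplices of `X` extends to a cocontinuous functor `Φ` on simplicial sets over `X`, with value
`colim M` at the identity of `X`. If `M` is a value of a projectively cofibrant diagram, then `Φ` is
flat: it preserves monomorphisms (`flat_realization`). The engine is `sWeq_app_of_flat`: a
transformation of flat cocontinuous functors which is a weak equivalence on simplices is one
everywhere, by induction over boundary inclusions applied to a mapping cylinder.

The pullback functor `V ↦ V ×_X A` is flat and cocontinuous, and comparing the realization of `Q(Loc
A)` with it proves the first assertion. For the second, over a simplex `τ` the functor `Φ` is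
compared with `V ↦ V × Φ(τ)`; this is where invertibility of the transition maps enters. Hence `Φ`
sends anodyne extensions over `X` to weak equivalences, and commutes up to weak equivalence with
pullback along a fibration `P → X`. Factoring a simplex of `X` as an anodyne extension followed by
such a fibration then identifies its homotopy pullback (`sWeq_to_pullback`).

The homotopy theory of simplicial sets is developed from the definition of `sWeq` by maps to Kan
complexes. Its central fact is that a Kan fibration which is a weak equivalence is a trivial
fibration (`tfib_of_kfib_of_sWeq`). Between Kan complexes this is a direct argument with homotopies;
the general case follows by extending fibrations along anodyne extensions (`extendsFib_of_anod`).
For a horn the extension exists because the horn contracts to a vertex, so that the fibration embeds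
as a fibrewise deformation retract of a product. Right properness follows. -/

/-- Kan fibrations. -/
abbrev kfib : MorphismProperty SSet.{u} := modelCategoryQuillen.J.rlp

/-- Trivial Kan fibrations. -/
abbrev tfib : MorphismProperty SSet.{u} := modelCategoryQuillen.I.rlp

/-- Anodyne extensions. -/
abbrev anod : MorphismProperty SSet.{u} := anodyneExtensions

/-! ### Lifting properties of Kan fibrations and trivial fibrations -/

lemma kfib.lift {A X E B : SSet.{u}} {p : E ⟶ B} (hp : kfib p) {i : A ⟶ X} (hi : anod i) :
    HasLiftingProperty i p := hi p hp

lemma tfib.lift {A X E B : SSet.{u}} {p : E ⟶ B} (hp : tfib p) (i : A ⟶ X) [Mono i] :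
    HasLiftingProperty i p := by
  have h : (MorphismProperty.monomorphisms SSet.{u}).rlp p := by
    rw [SSet.rlp_monomorphisms]; exact hp
  exact h i ‹_›

lemma tfib.of_lift {E B : SSet.{u}} {p : E ⟶ B}
    (h : ∀ ⦃A X : SSet.{u}⦄ (i : A ⟶ X) [Mono i], HasLiftingProperty i p) : tfib p := by
  have h : (MorphismProperty.monomorphisms SSet.{u}).rlp p := fun _ _ i hi => by
    have : Mono i := hi
    exact h i
  rwa [SSet.rlp_monomorphisms] at h

lemma exists_lift {A X E B : SSet.{u}} {p : E ⟶ B} {i : A ⟶ X} (h : HasLiftingProperty i p)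
    (f : A ⟶ E) (b : X ⟶ B) (w : f ≫ p = i ≫ b) : ∃ g : X ⟶ E, i ≫ g = f ∧ g ≫ p = b := by
  have sq : CommSq f i p b := ⟨w⟩
  exact ⟨sq.lift, sq.fac_left, sq.fac_right⟩

lemma tfib.exists_lift {A X E B : SSet.{u}} {p : E ⟶ B} (hp : tfib p) (i : A ⟶ X) [Mono i]
    (f : A ⟶ E) (b : X ⟶ B) (w : f ≫ p = i ≫ b) : ∃ g : X ⟶ E, i ≫ g = f ∧ g ≫ p = b :=
  ModFib.exists_lift (hp.lift i) f b w

lemma kfib.exists_lift {A X E B : SSet.{u}} {p : E ⟶ B} (hp : kfib p) {i : A ⟶ X} (hi : anod i)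
    (f : A ⟶ E) (b : X ⟶ B) (w : f ≫ p = i ≫ b) : ∃ g : X ⟶ E, i ≫ g = f ∧ g ≫ p = b :=
  ModFib.exists_lift (hp.lift hi) f b w

open modelCategoryQuillen in
lemma kan_iff {K : SSet.{u}} : KanComplex K ↔ kfib (terminal.from K) := by
  rw [KanComplex, isFibrant_iff]
  exact modelCategoryQuillen.fibration_iff _

lemma kfib_terminal (K : SSet.{u}) [KanComplex K] : kfib (terminal.from K) := kan_iff.1 ‹_›

lemma tfib.kfib {E B : SSet.{u}} {p : E ⟶ B} (hp : tfib p) : kfib p := fun _ _ i hi => by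
  have : Mono i := modelCategoryQuillen.J_le_monomorphisms _ hi
  exact hp.lift i

/-! ### Factorizations -/

section

attribute [local instance] Cardinal.fact_isRegular_aleph0 Cardinal.orderBotAleph0OrdToType

instance : MorphismProperty.IsSmall.{u} modelCategoryQuillen.I.{u} :=
  MorphismProperty.isSmall_ofHoms ..

instance : MorphismProperty.IsCardinalForSmallObjectArgument modelCategoryQuillen.I.{u}
    Cardinal.aleph0.{u} where
  preservesColimit {A B X Y} i hi f hf := by
    have : IsFinitelyPresentable.{u} A := by
      obtain ⟨n⟩ := hi
      infer_instance
    infer_instance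

instance : MorphismProperty.HasSmallObjectArgument.{u} modelCategoryQuillen.I.{u} :=
  ⟨.aleph0, inferInstance, inferInstance, inferInstance⟩

/-- By the small object argument such a map is a retract of a countable composition of pushouts of
coproducts of boundary inclusions, and each of these operations preserves monomorphisms. -/
lemma llp_rlp_I_le_monomorphisms :
    modelCategoryQuillen.I.{u}.rlp.llp ≤ MorphismProperty.monomorphisms SSet.{u} := by
  rw [SmallObject.llp_rlp_of_isCardinalForSmallObjectArgument_aleph0]
  have h₁ : MorphismProperty.coproducts.{u} modelCategoryQuillen.I.{u} ≤
      MorphismProperty.monomorphisms SSet.{u} :=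
    (MorphismProperty.coproducts_monotone modelCategoryQuillen.I_le_monomorphisms).trans
      (MorphismProperty.coproducts_le _)
  have h₂ : (MorphismProperty.coproducts.{u} modelCategoryQuillen.I.{u}).pushouts ≤
      MorphismProperty.monomorphisms SSet.{u} :=
    (MorphismProperty.pushouts_monotone h₁).trans MorphismProperty.pushouts_le
  have h₃ : (MorphismProperty.coproducts.{u}
      modelCategoryQuillen.I.{u}).pushouts.transfiniteCompositionsOfShape ℕ ≤
      MorphismProperty.monomorphisms SSet.{u} :=
    (MorphismProperty.transfiniteCompositionsOfShape_monotone ℕ h₂).trans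
      (MorphismProperty.transfiniteCompositionsOfShape_le _ ℕ)
  exact (MorphismProperty.retracts_monotone h₃).trans (MorphismProperty.retracts_le _)

end

lemma exists_mono_tfib_factorization {X Y : SSet.{u}} (f : X ⟶ Y) :
    ∃ (Z : SSet.{u}) (i : X ⟶ Z) (p : Z ⟶ Y), Mono i ∧ tfib p ∧ i ≫ p = f := by
  let F := MorphismProperty.factorizationData modelCategoryQuillen.I.{u}.rlp.llp
    modelCategoryQuillen.I.{u}.rlp f
  refine ⟨F.Z, F.i, F.p, llp_rlp_I_le_monomorphisms _ F.hi, F.hp, F.fac⟩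

lemma exists_anod_kfib_factorization {X Y : SSet.{u}} (f : X ⟶ Y) :
    ∃ (Z : SSet.{u}) (i : X ⟶ Z) (p : Z ⟶ Y), anod i ∧ kfib p ∧ i ≫ p = f := by
  let F := MorphismProperty.factorizationData modelCategoryQuillen.J.{u}.rlp.llp
    modelCategoryQuillen.J.{u}.rlp f
  exact ⟨F.Z, F.i, F.p, F.hi, F.hp, F.fac⟩

/-- Factor `i` as a monomorphism followed by a trivial fibration. Since `i` lifts against the
latter, the monomorphism factors through `i`. -/
lemma anod.mono {A X : SSet.{u}} {i : A ⟶ X} (hi : anod i) : Mono i := by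
  obtain ⟨Y, j, p, hj, hp, h⟩ := exists_mono_tfib_factorization i
  obtain ⟨g, hg, -⟩ := hp.kfib.exists_lift hi j (𝟙 X) (by rw [h, Category.comp_id])
  have : Mono (i ≫ g) := by rwa [hg]
  exact mono_of_mono i g

/-! ### Lifting against pushout-products -/

section PushoutProduct

variable {A X S S' E B : SSet.{u}} {i : A ⟶ X} {j : S ⟶ S'} {p : E ⟶ B}
    (f : X ⊗ S ⟶ E) (h : A ⊗ S' ⟶ E) (b : X ⊗ S' ⟶ B)
    (w₁ : A ◁ j ≫ h = i ▷ S ≫ f) (w₂ : f ≫ p = X ◁ j ≫ b) (w₃ : h ≫ p = i ▷ S' ≫ b)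

include w₁ w₂ w₃

lemma exists_lift_of_pushoutObjObj (sq : (curriedTensor SSet.{u}).PushoutObjObj i j)
    (hp : HasLiftingProperty sq.ι p) :
    ∃ H : X ⊗ S' ⟶ E, X ◁ j ≫ H = f ∧ i ▷ S' ≫ H = h ∧ H ≫ p = b := by
  obtain ⟨H, h₁, h₂⟩ := ModFib.exists_lift hp (sq.isPushout.desc f h w₁.symm) b (by
    apply sq.hom_ext
    · simpa using w₂
    · simpa using w₃)
  refine ⟨H, ?_, ?_, h₂⟩
  · have := sq.inl ≫= h₁
    simpa using this
  · have := sq.inr ≫= h₁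
    simpa using this

lemma kfib.exists_lift_right (hp : kfib p) [Mono i] (hj : anod j) :
    ∃ H : X ⊗ S' ⟶ E, X ◁ j ≫ H = f ∧ i ▷ S' ≫ H = h ∧ H ≫ p = b :=
  exists_lift_of_pushoutObjObj f h b w₁ w₂ w₃ (.ofHasPushout _ _ _)
    (hp.lift (anodyneExtensions_pushoutObjObjι _ hj))

lemma kfib.exists_lift_left (hp : kfib p) (hi : anod i) [Mono j] :
    ∃ H : X ⊗ S' ⟶ E, X ◁ j ≫ H = f ∧ i ▷ S' ≫ H = h ∧ H ≫ p = b :=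
  exists_lift_of_pushoutObjObj f h b w₁ w₂ w₃ (.ofHasPushout _ _ _)
    (hp.lift (anodyneExtensions_pushoutObjObjι' _ hi))

lemma tfib.exists_lift_prod (hp : tfib p) [Mono i] [Mono j] :
    ∃ H : X ⊗ S' ⟶ E, X ◁ j ≫ H = f ∧ i ▷ S' ≫ H = h ∧ H ≫ p = b := by
  -- Replacing `i` and `j` by the inclusions of their ranges turns the pushout-product into the
  -- inclusion of a subcomplex, which is visibly a monomorphism.
  have hi : IsIso (Subcomplex.toRange i) := isIso_of_mono_of_epi _
  have hj : IsIso (Subcomplex.toRange j) := isIso_of_mono_of_epi _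
  have wi : Subcomplex.toRange i ≫ (Subcomplex.range i).ι = i := by simp
  have wj : Subcomplex.toRange j ≫ (Subcomplex.range j).ι = j := by simp
  obtain ⟨H, h₁, h₂, h₃⟩ := exists_lift_of_pushoutObjObj (p := p)
    (X ◁ inv (Subcomplex.toRange j) ≫ f) (inv (Subcomplex.toRange i) ▷ S' ≫ h) b
    (by
      have e₁ : (Subcomplex.range j).ι = inv (Subcomplex.toRange j) ≫ j := by simp
      have e₂ : (Subcomplex.range i).ι = inv (Subcomplex.toRange i) ≫ i := by simp
      rw [e₁, e₂, whisker_exchange_assoc, MonoidalCategory.whiskerLeft_comp,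
        comp_whiskerRight, Category.assoc, Category.assoc, w₁, ← whisker_exchange_assoc i,
        whisker_exchange_assoc])
    (by
      have e₁ : (Subcomplex.range j).ι = inv (Subcomplex.toRange j) ≫ j := by simp
      rw [e₁, MonoidalCategory.whiskerLeft_comp, Category.assoc, Category.assoc, w₂])
    (by
      have e₂ : (Subcomplex.range i).ι = inv (Subcomplex.toRange i) ≫ i := by simp
      rw [e₂, comp_whiskerRight, Category.assoc, Category.assoc, w₃])
    (Subcomplex.unionProd.pushoutObjObj (Subcomplex.range i) (Subcomplex.range j))
    (show HasLiftingProperty (Subcomplex.unionProd _ _).ι p from hp.lift _)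
  refine ⟨H, ?_, ?_, h₃⟩
  · rw [← cancel_epi (X ◁ inv (Subcomplex.toRange j)), ← h₁,
      ← MonoidalCategory.whiskerLeft_comp_assoc]
    congr 2
    simp
  · rw [← cancel_epi (inv (Subcomplex.toRange i) ▷ S'), ← h₂, ← comp_whiskerRight_assoc]
    congr 2
    simp

end PushoutProduct

lemma anod.δ (k : Fin 2) : anod (stdSimplex.{u}.δ k) := by
  have h : ∃ l : Fin 2, Subcomplex.range (stdSimplex.{u}.δ k) = Λ[1, l] := by
    -- Faces are indexed by the omitted vertex, and `Λ[1, l]` is the union of the faces omitting a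
    -- vertex other than `l`. For `l = 1 - k` only the face omitting `k` remains.
    refine ⟨1 - k, ?_⟩
    rw [stdSimplex.range_δ, horn_eq_iSup]
    apply le_antisymm
    · exact le_iSup (fun j : ({1 - k}ᶜ : Set (Fin 2)) => stdSimplex.face.{u} {j.1}ᶜ)
        ⟨k, by fin_cases k <;> simp⟩
    · refine iSup_le fun ⟨j, hj⟩ => le_of_eq ?_
      fin_cases k <;> fin_cases j <;> simp at hj ⊢
  obtain ⟨l, hl⟩ := h
  have : IsIso (Subcomplex.toRange (stdSimplex.{u}.δ k)) := isIso_of_mono_of_epi _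
  have h₂ : anod (Subcomplex.range (stdSimplex.{u}.δ k)).ι := by
    rw [hl]; exact anodyneExtensions.horn_ι l
  have := anodyneExtensions.comp_mem _ _ (anodyneExtensions.of_isIso
    (Subcomplex.toRange (stdSimplex.{u}.δ k))) h₂
  simpa using this

/-- A face map is named after the vertex it omits, so `δ 1` corresponds to the initial end `ι₀` and
`δ 0` to the final end `ι₁`. -/
lemma whiskerLeft_δ_one (X : SSet.{u}) :
    X ◁ stdSimplex.δ (1 : Fin 2) = fst _ _ ≫ ι₀ := by
  ext : 1
  · simp
  · rw [stdSimplex.δ_one_eq_const]; rfl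

lemma whiskerLeft_δ_zero (X : SSet.{u}) :
    X ◁ stdSimplex.δ (0 : Fin 2) = fst _ _ ≫ ι₁ := by
  ext : 1
  · simp
  · rw [stdSimplex.δ_zero_eq_const]; rfl

/-- The section of the projection `X ⊗ Δ[0] ⟶ X`. -/
def toProdPt (X : SSet.{u}) : X ⟶ X ⊗ Δ[0] := lift (𝟙 X) (stdSimplex.isTerminalObj₀.from X)

@[simp]
lemma toProdPt_fst (X : SSet.{u}) : toProdPt X ≫ fst X _ = 𝟙 X := lift_fst _ _

@[simp]
lemma toProdPt_fst_assoc (X : SSet.{u}) {Z : SSet.{u}} (h : X ⟶ Z) :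
    toProdPt X ≫ fst X _ ≫ h = h := by
  rw [← Category.assoc, toProdPt_fst, Category.id_comp]

lemma fst_toProdPt (X : SSet.{u}) : fst X _ ≫ toProdPt X = 𝟙 _ := by
  ext : 1
  · simp
  · exact stdSimplex.isTerminalObj₀.hom_ext _ _

@[simp]
lemma toProdPt_δ_one (X : SSet.{u}) : toProdPt X ≫ X ◁ stdSimplex.δ (1 : Fin 2) = ι₀ := by
  rw [whiskerLeft_δ_one, toProdPt_fst_assoc]

@[simp]
lemma toProdPt_δ_one_assoc (X : SSet.{u}) {Z : SSet.{u}} (h : X ⊗ Δ[1] ⟶ Z) :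
    toProdPt X ≫ X ◁ stdSimplex.δ (1 : Fin 2) ≫ h = ι₀ ≫ h := by
  rw [← toProdPt_δ_one, Category.assoc]

@[simp]
lemma toProdPt_δ_zero (X : SSet.{u}) : toProdPt X ≫ X ◁ stdSimplex.δ (0 : Fin 2) = ι₁ := by
  rw [whiskerLeft_δ_zero, toProdPt_fst_assoc]

@[simp]
lemma toProdPt_δ_zero_assoc (X : SSet.{u}) {Z : SSet.{u}} (h : X ⊗ Δ[1] ⟶ Z) :
    toProdPt X ≫ X ◁ stdSimplex.δ (0 : Fin 2) ≫ h = ι₁ ≫ h := by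
  rw [← toProdPt_δ_zero, Category.assoc]

/-! ### Homotopy extension and lifting -/

section HEP

variable {A X E B : SSet.{u}} {i : A ⟶ X} {p : E ⟶ B}
    (f : X ⟶ E) (h : A ⊗ Δ[1] ⟶ E) (b : X ⊗ Δ[1] ⟶ B)

lemma kfib.homotopyExtension₀ (hp : kfib p) [Mono i] (w₁ : ι₀ ≫ h = i ≫ f)
    (w₂ : f ≫ p = ι₀ ≫ b) (w₃ : h ≫ p = i ▷ _ ≫ b) :
    ∃ H : X ⊗ Δ[1] ⟶ E, ι₀ ≫ H = f ∧ i ▷ _ ≫ H = h ∧ H ≫ p = b := by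
  obtain ⟨H, h₁, h₂, h₃⟩ := hp.exists_lift_right (i := i) (fst _ _ ≫ f) h b
    (by rw [whiskerLeft_δ_one, Category.assoc, w₁, whiskerRight_fst_assoc])
    (by rw [whiskerLeft_δ_one, Category.assoc, Category.assoc, w₂]) w₃ (anod.δ 1)
  refine ⟨H, ?_, h₂, h₃⟩
  rw [← toProdPt_δ_one_assoc, h₁, toProdPt_fst_assoc]

lemma kfib.homotopyExtension₁ (hp : kfib p) [Mono i] (w₁ : ι₁ ≫ h = i ≫ f)
    (w₂ : f ≫ p = ι₁ ≫ b) (w₃ : h ≫ p = i ▷ _ ≫ b) :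
    ∃ H : X ⊗ Δ[1] ⟶ E, ι₁ ≫ H = f ∧ i ▷ _ ≫ H = h ∧ H ≫ p = b := by
  obtain ⟨H, h₁, h₂, h₃⟩ := hp.exists_lift_right (i := i) (fst _ _ ≫ f) h b
    (by rw [whiskerLeft_δ_zero, Category.assoc, w₁, whiskerRight_fst_assoc])
    (by rw [whiskerLeft_δ_zero, Category.assoc, Category.assoc, w₂]) w₃ (anod.δ 0)
  refine ⟨H, ?_, h₂, h₃⟩
  rw [← toProdPt_δ_zero_assoc, h₁, toProdPt_fst_assoc]

end HEP

/-- The two end points of `Δ[1]`. -/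
def ends : (Δ[1] : SSet.{u}).Subcomplex :=
  Subcomplex.range (stdSimplex.δ 1) ⊔ Subcomplex.range (stdSimplex.δ 0)

/-- The first end point. -/
def ends₀ : Δ[0] ⟶ (ends.{u} : SSet.{u}) := Subcomplex.lift (stdSimplex.δ 1) le_sup_left

/-- The last end point. -/
def ends₁ : Δ[0] ⟶ (ends.{u} : SSet.{u}) := Subcomplex.lift (stdSimplex.δ 0) le_sup_right

lemma ends_bicartSq : Subcomplex.BicartSq (⊥ : (Δ[1] : SSet.{u}).Subcomplex)
    (Subcomplex.range (stdSimplex.δ 1)) (Subcomplex.range (stdSimplex.δ 0)) ends where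
  sup_eq := rfl
  inf_eq := by
    rw [stdSimplex.range_δ, stdSimplex.range_δ, stdSimplex.face_inter_face,
      ← stdSimplex.face_empty]
    congr 1

lemma whiskerLeft_ends₀_ι (X : SSet.{u}) : X ◁ ends₀ ≫ X ◁ ends.ι = fst _ _ ≫ ι₀ := by
  rw [← MonoidalCategory.whiskerLeft_comp, ← whiskerLeft_δ_one]; rfl

lemma whiskerLeft_ends₀_ι_assoc (X : SSet.{u}) {Z : SSet.{u}} (h : X ⊗ Δ[1] ⟶ Z) :
    X ◁ ends₀ ≫ X ◁ ends.ι ≫ h = fst _ _ ≫ ι₀ ≫ h := by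
  rw [← Category.assoc, whiskerLeft_ends₀_ι, Category.assoc]

lemma whiskerLeft_ends₁_ι (X : SSet.{u}) : X ◁ ends₁ ≫ X ◁ ends.ι = fst _ _ ≫ ι₁ := by
  rw [← MonoidalCategory.whiskerLeft_comp, ← whiskerLeft_δ_zero]; rfl

lemma whiskerLeft_ends₁_ι_assoc (X : SSet.{u}) {Z : SSet.{u}} (h : X ⊗ Δ[1] ⟶ Z) :
    X ◁ ends₁ ≫ X ◁ ends.ι ≫ h = fst _ _ ≫ ι₁ ≫ h := by
  rw [← Category.assoc, whiskerLeft_ends₁_ι, Category.assoc]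

/-- Currying moves `X` to the target, where `ends` is the disjoint union of two points. -/
lemma tensor_ends_hom_ext {X Z : SSet.{u}} {a b : X ⊗ (ends.{u} : SSet.{u}) ⟶ Z}
    (h₀ : X ◁ ends₀ ≫ a = X ◁ ends₀ ≫ b) (h₁ : X ◁ ends₁ ≫ a = X ◁ ends₁ ≫ b) : a = b := by
  apply MonoidalClosed.curry_injective
  apply ends_bicartSq.isPushout.hom_ext
  · rw [← cancel_epi (Subcomplex.toRange (stdSimplex.{u}.δ (1 : Fin 2)))]
    have e : Subcomplex.toRange (stdSimplex.{u}.δ (1 : Fin 2)) ≫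
      Subcomplex.homOfLE ends_bicartSq.le₂₄ = ends₀ := rfl
    rw [reassoc_of% e, reassoc_of% e]
    rw [← MonoidalClosed.curry_natural_left, ← MonoidalClosed.curry_natural_left, h₀]
  · rw [← cancel_epi (Subcomplex.toRange (stdSimplex.{u}.δ (0 : Fin 2)))]
    have e : Subcomplex.toRange (stdSimplex.{u}.δ (0 : Fin 2)) ≫
      Subcomplex.homOfLE ends_bicartSq.le₃₄ = ends₁ := rfl
    rw [reassoc_of% e, reassoc_of% e]
    rw [← MonoidalClosed.curry_natural_left, ← MonoidalClosed.curry_natural_left, h₁]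

lemma exists_desc_ends {X E : SSet.{u}} (f g : X ⟶ E) : ∃ φ : X ⊗ (ends.{u} : SSet.{u}) ⟶ E,
    X ◁ ends₀ ≫ φ = fst _ _ ≫ f ∧ X ◁ ends₁ ≫ φ = fst _ _ ≫ g := by
  have i₀ : IsIso (Subcomplex.toRange (stdSimplex.{u}.δ (1 : Fin 2))) := isIso_of_mono_of_epi _
  have i₁ : IsIso (Subcomplex.toRange (stdSimplex.{u}.δ (0 : Fin 2))) := isIso_of_mono_of_epi _
  obtain ⟨d, h₀, h₁⟩ := ends_bicartSq.isPushout.exists_desc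
    (inv (Subcomplex.toRange (stdSimplex.{u}.δ (1 : Fin 2))) ≫
      MonoidalClosed.curry (fst X Δ[0] ≫ f))
    (inv (Subcomplex.toRange (stdSimplex.{u}.δ (0 : Fin 2))) ≫
      MonoidalClosed.curry (fst X Δ[0] ≫ g))
    (Subcomplex.isInitialBot.hom_ext _ _)
  rw [IsIso.eq_inv_comp] at h₀ h₁
  have d₀ : ends₀ ≫ d = MonoidalClosed.curry (fst X Δ[0] ≫ f) := h₀
  have d₁ : ends₁ ≫ d = MonoidalClosed.curry (fst X Δ[0] ≫ g) := h₁
  refine ⟨MonoidalClosed.uncurry d, ?_, ?_⟩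
  · rw [← MonoidalClosed.uncurry_natural_left, d₀, MonoidalClosed.uncurry_curry]
  · rw [← MonoidalClosed.uncurry_natural_left, d₁, MonoidalClosed.uncurry_curry]

section

variable {A X E B : SSet.{u}} {i : A ⟶ X} {p : E ⟶ B}
    (f g : X ⟶ E) (h : A ⊗ Δ[1] ⟶ E) (b : X ⊗ Δ[1] ⟶ B)

/-- The hypothesis `hp` is the lifting property of `p` against the pushout-product of `i` with the
inclusion of the end points of `Δ[1]`. Isolating it lets one gluing of `f` and `g` serve anodyne
`i`, trivial `p`, and also monic weak equivalences `i` with a Kan target. -/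
lemma exists_homotopy_rel (hp : ∀ (φ : X ⊗ (ends.{u} : SSet.{u}) ⟶ E),
      A ◁ ends.ι ≫ h = i ▷ _ ≫ φ → φ ≫ p = X ◁ ends.ι ≫ b →
      ∃ H : X ⊗ Δ[1] ⟶ E, X ◁ ends.ι ≫ H = φ ∧ i ▷ _ ≫ H = h ∧ H ≫ p = b)
    (w₀ : ι₀ ≫ h = i ≫ f) (w₁ : ι₁ ≫ h = i ≫ g)
    (w₂ : f ≫ p = ι₀ ≫ b) (w₃ : g ≫ p = ι₁ ≫ b) :
    ∃ H : X ⊗ Δ[1] ⟶ E, ι₀ ≫ H = f ∧ ι₁ ≫ H = g ∧ i ▷ _ ≫ H = h ∧ H ≫ p = b := by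
  obtain ⟨φ, h₀, h₁⟩ := exists_desc_ends f g
  obtain ⟨H, k₁, k₂, k₃⟩ := hp φ
    (by
      apply tensor_ends_hom_ext
      · rw [whiskerLeft_ends₀_ι_assoc, w₀, whisker_exchange_assoc, h₀, whiskerRight_fst_assoc]
      · rw [whiskerLeft_ends₁_ι_assoc, w₁, whisker_exchange_assoc, h₁, whiskerRight_fst_assoc])
    (by
      apply tensor_ends_hom_ext
      · rw [whiskerLeft_ends₀_ι_assoc, ← w₂, reassoc_of% h₀]
      · rw [whiskerLeft_ends₁_ι_assoc, ← w₃, reassoc_of% h₁])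
  refine ⟨H, ?_, ?_, k₂, k₃⟩
  · rw [← k₁, whiskerLeft_ends₀_ι_assoc] at h₀
    simpa using toProdPt X ≫= h₀
  · rw [← k₁, whiskerLeft_ends₁_ι_assoc] at h₁
    simpa using toProdPt X ≫= h₁

lemma kfib.exists_homotopy_rel (hp : kfib p) (hi : anod i)
    (w₀ : ι₀ ≫ h = i ≫ f) (w₁ : ι₁ ≫ h = i ≫ g)
    (w₂ : f ≫ p = ι₀ ≫ b) (w₃ : g ≫ p = ι₁ ≫ b) (w₄ : h ≫ p = i ▷ _ ≫ b) :
    ∃ H : X ⊗ Δ[1] ⟶ E, ι₀ ≫ H = f ∧ ι₁ ≫ H = g ∧ i ▷ _ ≫ H = h ∧ H ≫ p = b :=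
  ModFib.exists_homotopy_rel f g h b
    (fun φ a₁ a₂ => hp.exists_lift_left φ h b a₁ a₂ w₄ hi) w₀ w₁ w₂ w₃

lemma tfib.exists_homotopy_rel (hp : tfib p) [Mono i]
    (w₀ : ι₀ ≫ h = i ≫ f) (w₁ : ι₁ ≫ h = i ≫ g)
    (w₂ : f ≫ p = ι₀ ≫ b) (w₃ : g ≫ p = ι₁ ≫ b) (w₄ : h ≫ p = i ▷ _ ≫ b) :
    ∃ H : X ⊗ Δ[1] ⟶ E, ι₀ ≫ H = f ∧ ι₁ ≫ H = g ∧ i ▷ _ ≫ H = h ∧ H ≫ p = b :=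
  ModFib.exists_homotopy_rel f g h b
    (fun φ a₁ a₂ => hp.exists_lift_prod φ h b a₁ a₂ w₄) w₀ w₁ w₂ w₃

end

/-! ### Homotopies over a base -/

/-- Homotopies over a base. -/
def Htpy {X E B : SSet.{u}} (p : E ⟶ B) (f g : X ⟶ E) : Prop :=
  ∃ H : X ⊗ Δ[1] ⟶ E, ι₀ ≫ H = f ∧ ι₁ ≫ H = g ∧ H ≫ p = fst _ _ ≫ f ≫ p

lemma bot_tensor_hom_ext {X Y Z : SSet.{u}} {f g : ((⊥ : X.Subcomplex) : SSet.{u}) ⊗ Y ⟶ Z} :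
    f = g := by
  ext n x
  exact x.1.2.elim

lemma tfib.exists_homotopy {X E B : SSet.{u}} {p : E ⟶ B} (hp : tfib p) (f g : X ⟶ E)
    (b : X ⊗ Δ[1] ⟶ B) (w₂ : f ≫ p = ι₀ ≫ b) (w₃ : g ≫ p = ι₁ ≫ b) :
    ∃ H : X ⊗ Δ[1] ⟶ E, ι₀ ≫ H = f ∧ ι₁ ≫ H = g ∧ H ≫ p = b := by
  obtain ⟨H, h₁, h₂, -, h₃⟩ := hp.exists_homotopy_rel (i := (⊥ : X.Subcomplex).ι) f g
    (fst _ _ ≫ Subcomplex.isInitialBot.to E) b (Subcomplex.isInitialBot.hom_ext _ _)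
    (Subcomplex.isInitialBot.hom_ext _ _) w₂ w₃ bot_tensor_hom_ext
  exact ⟨H, h₁, h₂, h₃⟩

lemma tfib.htpy {X E B : SSet.{u}} {p : E ⟶ B} (hp : tfib p) {f g : X ⟶ E}
    (w : f ≫ p = g ≫ p) : Htpy p f g :=
  hp.exists_homotopy f g (fst _ _ ≫ f ≫ p) (by simp) (by simp [w])

lemma kfib.htpy {A X E B : SSet.{u}} {p : E ⟶ B} (hp : kfib p) {i : A ⟶ X} (hi : anod i)
    {f g : X ⟶ E} (hA : i ≫ f = i ≫ g) (w : f ≫ p = g ≫ p) : Htpy p f g := by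
  obtain ⟨H, h₁, h₂, -, h₃⟩ := hp.exists_homotopy_rel f g (fst _ _ ≫ i ≫ f)
    (fst _ _ ≫ f ≫ p) hi (by simp) (by simp [hA]) (by simp) (by simp [w]) (by simp)
  exact ⟨H, h₁, h₂, h₃⟩

lemma exists_desc_horn₂₂ {X E : SSet.{u}} (H₁ H₂ : X ⊗ Δ[1] ⟶ E) (h : ι₁ ≫ H₁ = ι₁ ≫ H₂) :
    ∃ φ : X ⊗ (Λ[2, 2] : SSet.{u}) ⟶ E, X ◁ horn₂₂.ι₀₂ ≫ φ = H₁ ∧ X ◁ horn₂₂.ι₁₂ ≫ φ = H₂ := by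
  obtain ⟨d, h₀, h₁⟩ := horn₂₂.isPushout.exists_desc (MonoidalClosed.curry H₁)
    (MonoidalClosed.curry H₂) (by
      rw [← MonoidalClosed.curry_natural_left, ← MonoidalClosed.curry_natural_left,
        whiskerLeft_δ_zero, Category.assoc, Category.assoc, h])
  refine ⟨MonoidalClosed.uncurry d, ?_, ?_⟩
  · rw [← MonoidalClosed.uncurry_natural_left, h₀, MonoidalClosed.uncurry_curry]
  · rw [← MonoidalClosed.uncurry_natural_left, h₁, MonoidalClosed.uncurry_curry]

lemma tensor_horn₂₂_hom_ext {X Z : SSet.{u}} {a b : X ⊗ (Λ[2, 2] : SSet.{u}) ⟶ Z}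
    (h₀ : X ◁ horn₂₂.ι₀₂ ≫ a = X ◁ horn₂₂.ι₀₂ ≫ b)
    (h₁ : X ◁ horn₂₂.ι₁₂ ≫ a = X ◁ horn₂₂.ι₁₂ ≫ b) : a = b := by
  apply MonoidalClosed.curry_injective
  apply horn₂₂.isPushout.hom_ext
  · rw [← MonoidalClosed.curry_natural_left, ← MonoidalClosed.curry_natural_left, h₀]
  · rw [← MonoidalClosed.curry_natural_left, ← MonoidalClosed.curry_natural_left, h₁]

/-- Comparison of two homotopies over the same homotopy of the base, with the same end. -/
lemma kfib.exists_homotopy_comp {A X E B : SSet.{u}} {i : A ⟶ X} [Mono i] {p : E ⟶ B}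
    (hp : kfib p) (H₁ H₂ : X ⊗ Δ[1] ⟶ E) (h : ι₁ ≫ H₁ = ι₁ ≫ H₂) (h' : H₁ ≫ p = H₂ ≫ p)
    (hA : i ▷ _ ≫ H₁ = i ▷ _ ≫ H₂) :
    ∃ K : X ⊗ Δ[1] ⟶ E, ι₀ ≫ K = ι₀ ≫ H₁ ∧ ι₁ ≫ K = ι₀ ≫ H₂ ∧
      i ▷ _ ≫ K = fst _ _ ≫ i ≫ ι₀ ≫ H₁ ∧ K ≫ p = fst _ _ ≫ ι₀ ≫ H₁ ≫ p := by
  obtain ⟨φ, h₁, h₂⟩ := exists_desc_horn₂₂ H₁ H₂ h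
  have e₁ : horn₂₂.ι₀₂ ≫ Λ[2, 2].ι = stdSimplex.{u}.δ 1 := horn.ι_ι _ _ _
  have e₂ : horn₂₂.ι₁₂ ≫ Λ[2, 2].ι = stdSimplex.{u}.δ 0 := horn.ι_ι _ _ _
  have s₁ : stdSimplex.{u}.δ (1 : Fin 3) ≫ stdSimplex.σ (0 : Fin 2) = 𝟙 _ :=
    stdSimplex.{u}.δ_comp_σ_succ (i := (0 : Fin 2))
  have s₀ : stdSimplex.{u}.δ (0 : Fin 3) ≫ stdSimplex.σ (0 : Fin 2) = 𝟙 _ :=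
    stdSimplex.{u}.δ_comp_σ_self (i := (0 : Fin 2))
  have s₂ : stdSimplex.{u}.δ (2 : Fin 3) ≫ stdSimplex.σ (0 : Fin 2) =
      stdSimplex.σ (0 : Fin 1) ≫ stdSimplex.δ (1 : Fin 2) :=
    stdSimplex.{u}.δ_comp_σ_of_gt (i := (1 : Fin 2)) (j := (0 : Fin 1)) (by simp)
  have s₃ : stdSimplex.{u}.δ (1 : Fin 2) ≫ stdSimplex.δ (2 : Fin 3) =
    stdSimplex.δ (1 : Fin 2) ≫ stdSimplex.δ (1 : Fin 3) :=
    stdSimplex.{u}.δ_comp_δ (i := (1 : Fin 2)) (j := (1 : Fin 2)) le_rfl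
  have s₄ : stdSimplex.{u}.δ (0 : Fin 2) ≫ stdSimplex.δ (2 : Fin 3) =
    stdSimplex.δ (1 : Fin 2) ≫ stdSimplex.δ (0 : Fin 3) :=
    stdSimplex.{u}.δ_comp_δ (i := (0 : Fin 2)) (j := (1 : Fin 2)) (by simp)
  -- Put `H₁` on the edge `02` and `H₂` on the edge `12`, and fill the horn over the homotopy of the
  -- base pulled back along `σ 0`, which collapses the edge `01`. The wanted `K` is the filler on
  -- `01`, that is on `δ 2`.
  obtain ⟨L, l₁, l₂, l₃⟩ := hp.exists_lift_right (i := i) φ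
    (A ◁ stdSimplex.σ (0 : Fin 2) ≫ i ▷ _ ≫ H₁) (X ◁ stdSimplex.σ (0 : Fin 2) ≫ H₁ ≫ p)
    (by
      apply tensor_horn₂₂_hom_ext
      · rw [← MonoidalCategory.whiskerLeft_comp_assoc, e₁,
          ← MonoidalCategory.whiskerLeft_comp_assoc, s₁, MonoidalCategory.whiskerLeft_id,
          Category.id_comp, whisker_exchange_assoc, h₁]
      · rw [← MonoidalCategory.whiskerLeft_comp_assoc, e₂,
          ← MonoidalCategory.whiskerLeft_comp_assoc, s₀, MonoidalCategory.whiskerLeft_id,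
          Category.id_comp, whisker_exchange_assoc, h₂, hA])
    (by
      apply tensor_horn₂₂_hom_ext
      · rw [reassoc_of% h₁, ← MonoidalCategory.whiskerLeft_comp_assoc, e₁,
          ← MonoidalCategory.whiskerLeft_comp_assoc, s₁, MonoidalCategory.whiskerLeft_id,
          Category.id_comp]
      · rw [reassoc_of% h₂, ← MonoidalCategory.whiskerLeft_comp_assoc, e₂,
          ← MonoidalCategory.whiskerLeft_comp_assoc, s₀, MonoidalCategory.whiskerLeft_id,
          Category.id_comp, h'])
    (by rw [← whisker_exchange_assoc]; simp) (anodyneExtensions.horn_ι 2)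
  have k : ∀ Z : SSet.{u}, Z ◁ stdSimplex.δ (2 : Fin 3) ≫ Z ◁ stdSimplex.σ (0 : Fin 2) =
      fst _ _ ≫ ι₀ := fun Z => by
    rw [← MonoidalCategory.whiskerLeft_comp, s₂, MonoidalCategory.whiskerLeft_comp,
      whiskerLeft_δ_one, whiskerLeft_fst_assoc]
  refine ⟨X ◁ stdSimplex.δ (2 : Fin 3) ≫ L, ?_, ?_, ?_, ?_⟩
  · rw [← toProdPt_δ_one_assoc, ← MonoidalCategory.whiskerLeft_comp_assoc, s₃, ← e₁,
      MonoidalCategory.whiskerLeft_comp_assoc, MonoidalCategory.whiskerLeft_comp_assoc, l₁, h₁,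
      toProdPt_δ_one_assoc]
  · rw [← toProdPt_δ_zero_assoc, ← MonoidalCategory.whiskerLeft_comp_assoc, s₄, ← e₂,
      MonoidalCategory.whiskerLeft_comp_assoc, MonoidalCategory.whiskerLeft_comp_assoc, l₁, h₂,
      toProdPt_δ_one_assoc]
  · rw [← whisker_exchange_assoc, l₂, reassoc_of% k, ι₀_comp_assoc]
  · rw [Category.assoc, l₃, reassoc_of% k]

lemma Htpy.refl {X E B : SSet.{u}} (p : E ⟶ B) (f : X ⟶ E) : Htpy p f f :=
  ⟨fst _ _ ≫ f, by simp, by simp, by simp⟩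

lemma Htpy.w {X E B : SSet.{u}} {p : E ⟶ B} {f g : X ⟶ E} (h : Htpy p f g) : f ≫ p = g ≫ p := by
  obtain ⟨H, h₀, h₁, h₂⟩ := h
  have := ι₁ ≫= h₂
  rw [reassoc_of% h₁, ← Category.assoc ι₁, ι₁_fst, Category.id_comp] at this
  exact this.symm

lemma Htpy.comp_left {X Y E B : SSet.{u}} {p : E ⟶ B} {f g : X ⟶ E} (h : Htpy p f g)
    (k : Y ⟶ X) : Htpy p (k ≫ f) (k ≫ g) := by
  obtain ⟨H, h₀, h₁, h₂⟩ := h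
  exact ⟨k ▷ _ ≫ H, by rw [ι₀_comp_assoc, h₀], by rw [ι₁_comp_assoc, h₁],
    by rw [Category.assoc, h₂, whiskerRight_fst_assoc, Category.assoc]⟩

lemma Htpy.comp_right {X E B E' B' : SSet.{u}} {p : E ⟶ B} {f g : X ⟶ E} (h : Htpy p f g)
    {p' : E' ⟶ B'} (k : E ⟶ E') (l : B ⟶ B') (w : k ≫ p' = p ≫ l) :
    Htpy p' (f ≫ k) (g ≫ k) := by
  obtain ⟨H, h₀, h₁, h₂⟩ := h
  exact ⟨H ≫ k, by rw [reassoc_of% h₀], by rw [reassoc_of% h₁],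
    by rw [Category.assoc, Category.assoc, w, reassoc_of% h₂]⟩

/-- Comparing two homotopies with a common end fills a horn. With reflexivity this one relation
yields both symmetry and transitivity. -/
lemma Htpy.euclid {X E B : SSet.{u}} {p : E ⟶ B} (hp : kfib p) {f g k : X ⟶ E}
    (h₁ : Htpy p f k) (h₂ : Htpy p g k) : Htpy p f g := by
  have w₁ := h₁.w
  have w₂ := h₂.w
  obtain ⟨H₁, a₁, b₁, c₁⟩ := h₁
  obtain ⟨H₂, a₂, b₂, c₂⟩ := h₂
  obtain ⟨K, k₁, k₂, -, k₃⟩ := hp.exists_homotopy_comp (i := (⊥ : X.Subcomplex).ι) H₁ H₂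
    (b₁.trans b₂.symm) (by rw [c₁, c₂, w₁, w₂]) bot_tensor_hom_ext
  exact ⟨K, k₁.trans a₁, k₂.trans a₂, by rw [k₃, reassoc_of% a₁]⟩

lemma Htpy.symm {X E B : SSet.{u}} {p : E ⟶ B} (hp : kfib p) {f g : X ⟶ E}
    (h : Htpy p f g) : Htpy p g f := (Htpy.refl p g).euclid hp h

lemma Htpy.trans {X E B : SSet.{u}} {p : E ⟶ B} (hp : kfib p) {f g k : X ⟶ E}
    (h₁ : Htpy p f g) (h₂ : Htpy p g k) : Htpy p f k := h₁.euclid hp (h₂.symm hp)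

/-! ### Weak equivalences -/

/-- Homotopies. -/
abbrev SHtpy {X K : SSet.{u}} (f g : X ⟶ K) : Prop := Htpy (terminal.from K) f g

lemma SHtpy.mk {X K : SSet.{u}} (H : X ⊗ Δ[1] ⟶ K) : SHtpy (ι₀ ≫ H) (ι₁ ≫ H) :=
  ⟨H, rfl, rfl, Subsingleton.elim _ _⟩

lemma Htpy.shtpy {X E B : SSet.{u}} {p : E ⟶ B} {f g : X ⟶ E} (h : Htpy p f g) : SHtpy f g := by
  obtain ⟨H, rfl, rfl, -⟩ := h
  exact SHtpy.mk H

lemma SHtpy.comp_right {X K L : SSet.{u}} {f g : X ⟶ K} (h : SHtpy f g) (k : K ⟶ L) :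
    SHtpy (f ≫ k) (g ≫ k) := Htpy.comp_right h k (terminal.from _) (Subsingleton.elim _ _)

/-- The vertex of the simplicial set of maps corresponding to a map. -/
def vtx {A K : SSet.{u}} (f : A ⟶ K) : ((ihom A).obj K) _⦋0⦌ :=
  yonedaEquiv (MonoidalClosed.curry (fst A Δ[0] ≫ f))

lemma vtx_surjective {A K : SSet.{u}} : Function.Surjective (vtx (A := A) (K := K)) := fun x => by
  refine ⟨toProdPt A ≫ MonoidalClosed.uncurry (yonedaEquiv.symm x), ?_⟩
  rw [vtx, ← Category.assoc, fst_toProdPt, Category.id_comp, MonoidalClosed.curry_uncurry,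
    Equiv.apply_symm_apply]

lemma pre_vtx {A B K : SSet.{u}} (f : A ⟶ B) (g : B ⟶ K) :
    ((MonoidalClosed.pre f).app K).app _ (vtx g) = vtx (f ≫ g) := by
  rw [vtx, vtx, ← yonedaEquiv_comp, MonoidalClosed.curry_pre_app]
  simp

lemma π₀Rel_vtx {A K : SSet.{u}} (f g : A ⟶ K) : π₀Rel (vtx f) (vtx g) ↔ SHtpy f g := by
  constructor
  · rintro ⟨e⟩
    have h₁ := e.src_eq
    have h₂ := e.tgt_eq
    obtain ⟨H, hH⟩ : ∃ H : A ⊗ Δ[1] ⟶ K, yonedaEquiv (MonoidalClosed.curry H) = e.edge :=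
      ⟨MonoidalClosed.uncurry (yonedaEquiv.symm e.edge), by simp⟩
    rw [← hH, ← stdSimplex.yonedaEquiv_δ_comp, ← MonoidalClosed.curry_natural_left, vtx,
      yonedaEquiv.injective.eq_iff, MonoidalClosed.curry_injective.eq_iff] at h₁ h₂
    rw [whiskerLeft_δ_one] at h₁
    rw [whiskerLeft_δ_zero] at h₂
    have h₁' : ι₀ ≫ H = f := by simpa using toProdPt A ≫= h₁
    have h₂' : ι₁ ≫ H = g := by simpa using toProdPt A ≫= h₂
    subst h₁' h₂'
    exact SHtpy.mk H
  · rintro ⟨H, rfl, rfl, -⟩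
    refine ⟨Edge.mk (yonedaEquiv (MonoidalClosed.curry H)) ?_ ?_⟩
    · rw [← stdSimplex.yonedaEquiv_δ_comp, ← MonoidalClosed.curry_natural_left,
        whiskerLeft_δ_one, Category.assoc]; rfl
    · rw [← stdSimplex.yonedaEquiv_δ_comp, ← MonoidalClosed.curry_natural_left,
        whiskerLeft_δ_zero, Category.assoc]; rfl

/-- For Kan `K` homotopy is already an equivalence relation, so passing to the generated one, as
`π₀` does, adds nothing. -/
lemma mk_vtx_eq_iff {A K : SSet.{u}} [KanComplex K] (f g : A ⟶ K) :
    π₀.mk (vtx f) = π₀.mk (vtx g) ↔ SHtpy f g := by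
  refine ⟨fun h => ?_, fun h => ?_⟩
  · rw [π₀.mk_eq_mk_iff] at h
    have : ∀ x y : ((ihom A).obj K) _⦋0⦌, Relation.EqvGen π₀Rel x y → ∀ f g : A ⟶ K,
        vtx f = x → vtx g = y → SHtpy f g := by
      intro x y h
      induction h with
      | rel x y h => rintro f g rfl rfl; exact (π₀Rel_vtx _ _).1 h
      | refl x =>
        rintro f g rfl h
        have : g = f := by
          rw [vtx, vtx, yonedaEquiv.injective.eq_iff, MonoidalClosed.curry_injective.eq_iff] at h
          simpa using toProdPt A ≫= h
        rw [this]
        exact Htpy.refl _ _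
      | symm x y _ ih => exact fun f g hf hg => (ih g f hg hf).symm (kfib_terminal K)
      | trans x y z _ _ ih₁ ih₂ =>
        intro f g hf hg
        obtain ⟨k, rfl⟩ := vtx_surjective y
        exact (ih₁ f k hf rfl).trans (kfib_terminal K) (ih₂ k g rfl hg)
    exact this _ _ h f g rfl rfl
  · obtain ⟨e⟩ := (π₀Rel_vtx _ _).2 h
    exact π₀.sound e

/-- Vertices of the mapping complex are maps and its components are homotopy classes, so the two
clauses are surjectivity and injectivity on `π₀`. -/
lemma sWeq_iff {A B : SSet.{u}} (f : A ⟶ B) :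
    sWeq f ↔ ∀ (K : SSet.{u}) [KanComplex K], (∀ g : A ⟶ K, ∃ h : B ⟶ K, SHtpy (f ≫ h) g) ∧
      ∀ h h' : B ⟶ K, SHtpy (f ≫ h) (f ≫ h') → SHtpy h h' := by
  refine forall₂_congr fun K _ => ?_
  rw [Function.Bijective, and_comm]
  refine and_congr ⟨fun H g => ?_, fun H x => ?_⟩ ⟨fun H h h' e => ?_, fun H x y e => ?_⟩
  · obtain ⟨y, hy⟩ := H (π₀.mk (vtx g))
    obtain ⟨y, rfl⟩ := π₀.mk_surjective y
    obtain ⟨h, rfl⟩ := vtx_surjective y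
    rw [mapπ₀_mk, pre_vtx, mk_vtx_eq_iff] at hy
    exact ⟨h, hy⟩
  · obtain ⟨x, rfl⟩ := π₀.mk_surjective x
    obtain ⟨g, rfl⟩ := vtx_surjective x
    obtain ⟨h, hh⟩ := H g
    refine ⟨π₀.mk (vtx h), ?_⟩
    rw [mapπ₀_mk, pre_vtx, mk_vtx_eq_iff]
    exact hh
  · rw [← mk_vtx_eq_iff] at e ⊢
    apply H
    rw [mapπ₀_mk, pre_vtx, mapπ₀_mk, pre_vtx, e]
  · obtain ⟨x, rfl⟩ := π₀.mk_surjective x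
    obtain ⟨h, rfl⟩ := vtx_surjective x
    obtain ⟨y, rfl⟩ := π₀.mk_surjective y
    obtain ⟨h', rfl⟩ := vtx_surjective y
    rw [mapπ₀_mk, pre_vtx, mapπ₀_mk, pre_vtx, mk_vtx_eq_iff] at e
    rw [mk_vtx_eq_iff]
    exact H _ _ e

/-! ### Closure properties of weak equivalences -/

lemma mapπ₀_pre_comp {A B D : SSet.{u}} (f : A ⟶ B) (g : B ⟶ D) (K : SSet.{u}) :
    mapπ₀ ((MonoidalClosed.pre (f ≫ g)).app K) =
      mapπ₀ ((MonoidalClosed.pre f).app K) ∘ mapπ₀ ((MonoidalClosed.pre g).app K) := by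
  funext x
  rw [MonoidalClosed.pre_map]
  exact mapπ₀_comp_apply _ _ x

instance : sWeq.{u}.HasTwoOutOfThreeProperty where
  of_postcomp f g hg hfg K _ := by
    have h := hfg K
    rw [mapπ₀_pre_comp] at h
    exact (Function.Bijective.of_comp_iff _ (hg K)).1 h
  of_precomp f g hf hfg K _ := by
    have h := hfg K
    rw [mapπ₀_pre_comp] at h
    exact (Function.Bijective.of_comp_iff' (hf K) _).1 h

lemma sWeq_of_homotopyInverse {A B : SSet.{u}} (f : A ⟶ B) (g : B ⟶ A)
    (h₁ : ∀ (K : SSet.{u}) [KanComplex K] (k : A ⟶ K), SHtpy (f ≫ g ≫ k) k)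
    (h₂ : ∀ (K : SSet.{u}) [KanComplex K] (k : B ⟶ K), SHtpy (g ≫ f ≫ k) k) : sWeq f := by
  rw [sWeq_iff]
  refine fun K _ => ⟨fun k => ⟨g ≫ k, h₁ K k⟩, fun k k' h => ?_⟩
  exact ((h₂ K k).symm (kfib_terminal K)).trans (kfib_terminal K)
    ((Htpy.comp_left h g).trans (kfib_terminal K) (h₂ K k'))

lemma sWeq_of_homotopyInverse' {A B : SSet.{u}} {f : A ⟶ B} {g : B ⟶ A}
    (h₁ : SHtpy (𝟙 A) (f ≫ g)) (h₂ : SHtpy (𝟙 B) (g ≫ f)) : sWeq f :=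
  sWeq_of_homotopyInverse f g
    (fun K _ k => by simpa using (h₁.comp_right k).symm (kfib_terminal K))
    (fun K _ k => by simpa using (h₂.comp_right k).symm (kfib_terminal K))

lemma sWeq_of_isIso {A B : SSet.{u}} (f : A ⟶ B) [IsIso f] : sWeq f :=
  sWeq_of_homotopyInverse' (g := inv f) (by simpa using Htpy.refl _ _)
    (by simpa using Htpy.refl _ _)

lemma tfib.exists_section {E B : SSet.{u}} {p : E ⟶ B} (hp : tfib p) :
    ∃ s : B ⟶ E, s ≫ p = 𝟙 B ∧ Htpy p (𝟙 E) (p ≫ s) := by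
  obtain ⟨s, -, h⟩ := hp.exists_lift (⊥ : B.Subcomplex).ι (Subcomplex.isInitialBot.to E) (𝟙 B)
    (Subcomplex.isInitialBot.hom_ext _ _)
  exact ⟨s, h, hp.htpy (by simp [h])⟩

lemma tfib.sWeq {E B : SSet.{u}} {p : E ⟶ B} (hp : tfib p) : sWeq p := by
  obtain ⟨s, h₁, h₂⟩ := hp.exists_section
  exact sWeq_of_homotopyInverse' h₂.shtpy (by rw [h₁]; exact Htpy.refl _ _)

/-- Existence is lifting `f` against `K → *`. Uniqueness is lifting, against the same map, the
pushout-product of `f` with the end points of `Δ[1]`. -/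
lemma anod.sWeq {A B : SSet.{u}} {f : A ⟶ B} (hf : anod f) : sWeq f := by
  rw [sWeq_iff]
  refine fun K _ => ⟨fun k => ?_, fun h h' ⟨H, h₀, h₁, _⟩ => ?_⟩
  · obtain ⟨g, rfl, -⟩ := (kfib_terminal K).exists_lift hf k (terminal.from _)
      (Subsingleton.elim _ _)
    exact ⟨g, Htpy.refl _ _⟩
  · obtain ⟨L, rfl, rfl, -⟩ := (kfib_terminal K).exists_homotopy_rel h h' H
      (terminal.from _) hf h₀ h₁ (Subsingleton.elim _ _) (Subsingleton.elim _ _)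
      (Subsingleton.elim _ _)
    exact SHtpy.mk L

lemma sWeq_ι₀ (X : SSet.{u}) : sWeq (ι₀ : X ⟶ X ⊗ Δ[1]) := by
  rw [← toProdPt_δ_one]
  have : IsIso (toProdPt X) := ⟨fst _ _, toProdPt_fst X, fst_toProdPt X⟩
  exact sWeq.comp_mem _ _ (sWeq_of_isIso _) (anod.sWeq ((anod.δ 1).whiskerLeft X))

lemma sWeq_fst (X : SSet.{u}) : sWeq (fst X Δ[1]) :=
  sWeq.of_precomp ι₀ _ (sWeq_ι₀ X) (by rw [ι₀_fst]; exact sWeq.id_mem X)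

/-! ### Trivial fibrations -/

/-- A homotopy `G` from the identity to `p ≫ s` need not be vertical. But `G` and `G ≫ p ≫ s` have
the same image in `B` and the same end, and comparing them produces a vertical homotopy. -/
lemma kfib.htpy_of_section {E B : SSet.{u}} {p : E ⟶ B} (hp : kfib p) {s : B ⟶ E}
    (hs : s ≫ p = 𝟙 B) (h : SHtpy (𝟙 E) (p ≫ s)) : Htpy p (𝟙 E) (p ≫ s) := by
  obtain ⟨G, h₀, h₁, -⟩ := h
  obtain ⟨K, k₀, k₁, -, k₂⟩ := hp.exists_homotopy_comp (i := (⊥ : E.Subcomplex).ι)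
    G (G ≫ p ≫ s) (by rw [reassoc_of% h₁, h₁, reassoc_of% hs]) (by simp [hs])
    bot_tensor_hom_ext
  exact ⟨K, k₀.trans h₀, k₁.trans (by rw [reassoc_of% h₀]), by rw [k₂, reassoc_of% h₀]; simp⟩

/-- For a lifting problem `(f, b)` the map `b ≫ s` is a lift up to the vertical homotopy from `f` to
`f ≫ p ≫ s`. Extending that homotopy backwards from `b ≫ s` corrects it to a strict lift. -/
lemma tfib_of_section {E B : SSet.{u}} {p : E ⟶ B} (hp : kfib p) {s : B ⟶ E}
    (hs : s ≫ p = 𝟙 B) (h : SHtpy (𝟙 E) (p ≫ s)) : tfib p := by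
  obtain ⟨G, h₀, h₁, h₂⟩ := hp.htpy_of_section hs h
  rw [Category.id_comp] at h₂
  refine tfib.of_lift fun A X i _ => ⟨fun {f b} sq => ?_⟩
  have w := sq.w
  obtain ⟨H, k₁, k₂, k₃⟩ := hp.homotopyExtension₁ (i := i) (b ≫ s) (f ▷ _ ≫ G) (fst _ _ ≫ b)
    (by rw [ι₁_comp_assoc, h₁, reassoc_of% w]) (by simp [hs])
    (by rw [Category.assoc, h₂, whiskerRight_fst_assoc, whiskerRight_fst_assoc, w])
  exact ⟨⟨⟨ι₀ ≫ H, by rw [← ι₀_comp_assoc, k₂, ι₀_comp_assoc, h₀, Category.comp_id],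
    by rw [Category.assoc, k₃]; simp⟩⟩⟩

/-- Lifting the homotopy from `r ≫ p` to the identity, starting at `r`, deforms `r` to a strict
section of `p`. -/
lemma tfib_of_homotopyInverse {E B : SSet.{u}} [KanComplex E] [KanComplex B] {p : E ⟶ B}
    (hp : kfib p) {r : B ⟶ E} (h₁ : SHtpy (p ≫ r) (𝟙 E)) (h₂ : SHtpy (r ≫ p) (𝟙 B)) :
    tfib p := by
  obtain ⟨H, a₀, a₁, -⟩ := h₂
  obtain ⟨L, b₀, -, b₁⟩ := hp.homotopyExtension₀ (i := (⊥ : B.Subcomplex).ι) r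
    (fst _ _ ≫ Subcomplex.isInitialBot.to E) H (Subcomplex.isInitialBot.hom_ext _ _) a₀.symm
    bot_tensor_hom_ext
  refine tfib_of_section hp (s := ι₁ ≫ L) (by rw [Category.assoc, b₁, a₁]) ?_
  refine (h₁.symm (kfib_terminal E)).trans (kfib_terminal E) (Htpy.comp_left ?_ p)
  have := SHtpy.mk L
  rwa [b₀] at this

lemma tfib_of_sWeq_of_kan {E B : SSet.{u}} [KanComplex E] [KanComplex B] {p : E ⟶ B}
    (hp : kfib p) (h : sWeq p) : tfib p := by
  rw [sWeq_iff] at h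
  obtain ⟨r, hr⟩ := (h E).1 (𝟙 E)
  refine tfib_of_homotopyInverse hp hr ((h B).2 _ _ ?_)
  simpa using hr.comp_right p

/-! ### Monomorphisms which are weak equivalences -/

lemma curry_pre {A X V Z : SSet.{u}} (i : A ⟶ X) (f : X ⊗ V ⟶ Z) :
    MonoidalClosed.curry f ≫ (MonoidalClosed.pre i).app Z = MonoidalClosed.curry (i ▷ V ≫ f) :=
  MonoidalClosed.curry_pre_app _ _

/-- Exchange of the variables. -/
def flip {A V Z : SSet.{u}} (f : V ⟶ (ihom A).obj Z) : A ⟶ (ihom V).obj Z :=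
  MonoidalClosed.curry ((β_ V A).hom ≫ MonoidalClosed.uncurry f)

lemma flip_flip {A V Z : SSet.{u}} (f : V ⟶ (ihom A).obj Z) : flip (flip f) = f := by
  simp [flip]

lemma flip_pre {A X V Z : SSet.{u}} (i : A ⟶ X) (f : V ⟶ (ihom X).obj Z) :
    flip (f ≫ (MonoidalClosed.pre i).app Z) = i ≫ flip f := by
  obtain ⟨f, rfl⟩ : ∃ g, f = MonoidalClosed.curry g :=
    ⟨_, (MonoidalClosed.curry_uncurry f).symm⟩
  rw [curry_pre, flip, flip, MonoidalClosed.uncurry_curry, MonoidalClosed.uncurry_curry,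
    ← MonoidalClosed.curry_natural_left]
  simp

lemma flip_shtpy {A V Z : SSet.{u}} {f g : V ⟶ (ihom A).obj Z} (h : SHtpy f g) :
    SHtpy (flip f) (flip g) := by
  obtain ⟨H, rfl, rfl, -⟩ := h
  let σ : V ⊗ (A ⊗ Δ[1]) ⟶ A ⊗ (V ⊗ Δ[1]) :=
    lift (snd _ _ ≫ fst _ _) (lift (fst _ _) (snd _ _ ≫ snd _ _))
  have σ₀ : V ◁ ι₀ ≫ σ = (β_ V A).hom ≫ A ◁ ι₀ := by ext <;> rfl
  have σ₁ : V ◁ ι₁ ≫ σ = (β_ V A).hom ≫ A ◁ ι₁ := by ext <;> rfl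
  have := SHtpy.mk (MonoidalClosed.curry (σ ≫ MonoidalClosed.uncurry H))
  rwa [← MonoidalClosed.curry_natural_left, ← MonoidalClosed.curry_natural_left,
    reassoc_of% σ₀, reassoc_of% σ₁, ← MonoidalClosed.uncurry_natural_left,
    ← MonoidalClosed.uncurry_natural_left] at this

/-- A Yoneda argument: exchanging variables, the bijections `[X, Z^V] → [A, Z^V]` become `[V, Z^X] →
[V, Z^A]`. Surjectivity at `V = Z^A` gives a homotopy inverse on one side, and injectivity at `V =
Z^X` shows that it is one on the other side. -/
lemma tfib_pre {A X Z : SSet.{u}} [KanComplex Z] {i : A ⟶ X} [Mono i] (hi : sWeq i) :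
    tfib ((MonoidalClosed.pre i).app Z) := by
  rw [sWeq_iff] at hi
  have hp : kfib ((MonoidalClosed.pre i).app Z) := by
    exact (modelCategoryQuillen.fibration_iff _).1 inferInstance
  obtain ⟨h, hh⟩ := (hi ((ihom ((ihom A).obj Z)).obj Z)).1 (flip (𝟙 _))
  have e₂ : SHtpy (flip h ≫ (MonoidalClosed.pre i).app Z) (𝟙 _) := by
    have := flip_shtpy hh
    rwa [flip_flip, ← flip_flip h, ← flip_pre, flip_flip] at this
  refine tfib_of_homotopyInverse hp ?_ e₂
  have := flip_shtpy ((hi ((ihom ((ihom X).obj Z)).obj Z)).2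
    (flip ((MonoidalClosed.pre i).app Z ≫ flip h)) (flip (𝟙 _)) (by
      rw [← flip_pre i, ← flip_pre i]
      apply flip_shtpy
      rw [Category.id_comp, Category.assoc]
      simpa using Htpy.comp_left e₂ ((MonoidalClosed.pre i).app Z)))
  rwa [flip_flip, flip_flip] at this

/-- A monomorphism which is a weak equivalence has the homotopy extension property with respect
to Kan complexes, relatively to any monomorphism. -/
lemma exists_lift_prod_of_mono_sWeq {A X S S' Z : SSet.{u}} [KanComplex Z] {i : A ⟶ X} [Mono i]
    (hi : sWeq i) {j : S ⟶ S'} [Mono j] (f : X ⊗ S ⟶ Z) (h : A ⊗ S' ⟶ Z)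
    (w : A ◁ j ≫ h = i ▷ S ≫ f) :
    ∃ H : X ⊗ S' ⟶ Z, X ◁ j ≫ H = f ∧ i ▷ S' ≫ H = h := by
  obtain ⟨H, h₁, h₂⟩ := (tfib_pre (Z := Z) hi).exists_lift j (MonoidalClosed.curry f)
    (MonoidalClosed.curry h) (by rw [curry_pre, ← w, MonoidalClosed.curry_natural_left])
  obtain ⟨H, rfl⟩ : ∃ g, H = MonoidalClosed.curry g :=
    ⟨_, (MonoidalClosed.curry_uncurry H).symm⟩
  rw [← MonoidalClosed.curry_natural_left, MonoidalClosed.curry_injective.eq_iff] at h₁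
  rw [curry_pre, MonoidalClosed.curry_injective.eq_iff] at h₂
  exact ⟨H, h₁, h₂⟩

/-- Fibrations between Kan complexes. -/
def kanFib : MorphismProperty SSet.{u} := fun E B p => KanComplex E ∧ KanComplex B ∧ kfib p

/-- The top map extends to `X` up to homotopy because `i` is a weak equivalence, and strictly by
homotopy extension. The image of this extension `h` and the bottom map agree on `A`, hence are
homotopic relative to `A`; lifting that homotopy from `h`, constantly on `A`, ends at a solution. -/
lemma llp_kanFib_of_mono_sWeq {A X : SSet.{u}} {i : A ⟶ X} [Mono i] (hi : sWeq i) :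
    kanFib.llp i := by
  rintro E B q ⟨_, _, hq⟩
  refine ⟨fun {a b} sq => ?_⟩
  have hi' := (sWeq_iff _).1 hi
  obtain ⟨h₀, H, e₀, e₁, -⟩ := (hi' E).1 a
  obtain ⟨H', rfl, e₃, -⟩ := (kfib_terminal E).homotopyExtension₀ (i := i) h₀ H
    (terminal.from _) e₀ (Subsingleton.elim _ _) (Subsingleton.elim _ _)
  obtain ⟨h, hh⟩ : ∃ h : X ⟶ E, i ≫ h = a :=
    ⟨ι₁ ≫ H', by rw [← ι₁_comp_assoc, e₃, e₁]⟩
  obtain ⟨G, g₀, g₁, g₂, -⟩ := exists_homotopy_rel (i := i) (p := terminal.from B) (h ≫ q) b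
    (fst _ _ ≫ i ≫ b) (terminal.from _)
    (fun φ w _ => by
      obtain ⟨H, h₁, h₂⟩ := exists_lift_prod_of_mono_sWeq hi φ _ w
      exact ⟨H, h₁, h₂, Subsingleton.elim _ _⟩)
    (by rw [reassoc_of% hh, sq.w]; simp) (by simp) (Subsingleton.elim _ _)
    (Subsingleton.elim _ _)
  obtain ⟨L, l₀, l₁, l₂⟩ := hq.homotopyExtension₀ (i := i) h (fst _ _ ≫ a) G
    (by simp [hh]) g₀.symm (by rw [g₂, Category.assoc, sq.w])
  exact ⟨⟨⟨ι₁ ≫ L, by rw [← ι₁_comp_assoc, l₁]; simp, by rw [Category.assoc, l₂, g₁]⟩⟩⟩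

/-- The fibrations `K → *` and `K^Δ[1] → K^∂Δ[1]` between Kan complexes detect, respectively,
surjectivity and injectivity on homotopy classes of maps to `K`. -/
lemma sWeq_of_llp_kanFib {A X : SSet.{u}} {i : A ⟶ X} (hi : kanFib.llp i) : sWeq i := by
  rw [sWeq_iff]
  have hT : KanComplex (⊤_ SSet.{u}) := by
    rw [kan_iff]
    have : IsIso (terminal.from (⊤_ SSet.{u})) := ⟨𝟙 _, Subsingleton.elim _ _, Subsingleton.elim _ _⟩
    exact MorphismProperty.of_isIso _ _
  refine fun K _ => ⟨fun k => ?_, fun h h' ⟨H, e₀, e₁, _⟩ => ?_⟩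
  · obtain ⟨g, hg, -⟩ := ModFib.exists_lift (hi (terminal.from K) ⟨‹_›, hT, kfib_terminal K⟩) k
      (terminal.from _) (Subsingleton.elim _ _)
    exact ⟨g, by rw [hg]; exact Htpy.refl _ _⟩
  · obtain ⟨φ, a₀, a₁⟩ := exists_desc_ends h h'
    have hp : kfib ((MonoidalClosed.pre ends.{u}.ι).app K) := by
      exact (modelCategoryQuillen.fibration_iff _).1 inferInstance
    obtain ⟨L, l₁, l₂⟩ := ModFib.exists_lift (hi _ ⟨inferInstance, inferInstance, hp⟩)
      (MonoidalClosed.curry ((β_ _ _).hom ≫ H)) (MonoidalClosed.curry ((β_ _ _).hom ≫ φ)) (by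
        rw [curry_pre, ← MonoidalClosed.curry_natural_left, BraidedCategory.braiding_naturality_left_assoc,
          BraidedCategory.braiding_naturality_right_assoc]
        congr 2
        apply tensor_ends_hom_ext
        · rw [whiskerLeft_ends₀_ι_assoc, e₀, whisker_exchange_assoc, a₀, whiskerRight_fst_assoc]
        · rw [whiskerLeft_ends₁_ι_assoc, e₁, whisker_exchange_assoc, a₁, whiskerRight_fst_assoc])
    obtain ⟨L, rfl⟩ : ∃ g, L = MonoidalClosed.curry ((β_ _ _).hom ≫ g) :=
      ⟨(β_ _ _).hom ≫ MonoidalClosed.uncurry L, by simp⟩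
    rw [curry_pre, MonoidalClosed.curry_injective.eq_iff,
      BraidedCategory.braiding_naturality_left_assoc, cancel_epi] at l₂
    have b₀ : ι₀ ≫ L = h := by
      rw [← l₂, whiskerLeft_ends₀_ι_assoc] at a₀
      simpa using toProdPt X ≫= a₀
    have b₁ : ι₁ ≫ L = h' := by
      rw [← l₂, whiskerLeft_ends₁_ι_assoc] at a₁
      simpa using toProdPt X ≫= a₁
    subst b₀ b₁
    exact SHtpy.mk L

/-! ### Fibres over a cone point -/

lemma app_congr {X Y : SSet.{u}} {f g : X ⟶ Y} (h : f = g) {n : SimplexCategoryᵒᵖ} (x : X.obj n) :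
    f.app n x = g.app n x := by rw [h]

lemma mono_fst_of_isPullback {P X Y Z : SSet.{u}} {f : P ⟶ X} {g : P ⟶ Y} {h : X ⟶ Z}
    {k : Y ⟶ Z} (pb : IsPullback f g h k) [Mono k] : Mono f :=
  MorphismProperty.of_isPullback (P := .monomorphisms SSet.{u}) pb.flip ‹_›

/-- The deformation is a zigzag, from the identity forwards along `H₀` and then backwards along `H₁`
to `r ≫ j`. A lifting problem is solved at the retracted end by `r ≫ z`, and the solution is
transported along `H₁`, then back along `H₀`, staying fixed on `F`. -/
lemma anod_of_deformation {F E : SSet.{u}} {j : F ⟶ E} [Mono j] (H₀ H₁ : E ⊗ Δ[1] ⟶ E)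
    (r : E ⟶ F) (h₀ : ι₀ ≫ H₀ = 𝟙 E) (h : ι₁ ≫ H₀ = ι₁ ≫ H₁) (h₁ : ι₀ ≫ H₁ = r ≫ j)
    (k₀ : j ▷ _ ≫ H₀ = fst _ _ ≫ j) (k₁ : j ▷ _ ≫ H₁ = fst _ _ ≫ j) : anod j := by
  have hr : j ≫ r = 𝟙 F := by
    rw [← cancel_mono j, Category.assoc, ← h₁, ← ι₀_comp_assoc, k₁]
    simp
  intro Z Y q hq
  have hq : kfib q := hq
  refine ⟨fun {z y} sq => ?_⟩
  obtain ⟨L₁, a₁, b₁, c₁⟩ := hq.homotopyExtension₀ (i := j) (r ≫ z) (fst _ _ ≫ z) (H₁ ≫ y)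
    (by simp [reassoc_of% hr]) (by rw [Category.assoc, sq.w, reassoc_of% h₁])
    (by rw [reassoc_of% k₁, Category.assoc, sq.w])
  obtain ⟨L₀, a₀, b₀, c₀⟩ := hq.homotopyExtension₁ (i := j) (ι₁ ≫ L₁) (fst _ _ ≫ z) (H₀ ≫ y)
    (by rw [← ι₁_comp_assoc, b₁]) (by rw [Category.assoc, c₁, reassoc_of% h])
    (by rw [reassoc_of% k₀, Category.assoc, sq.w])
  exact ⟨⟨⟨ι₀ ≫ L₀, by rw [← ι₀_comp_assoc, b₀]; simp,
    by rw [Category.assoc, c₀, reassoc_of% h₀]⟩⟩⟩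

/-- A simplicial set which deforms onto a point by a zigzag of homotopies. -/
def IsConed {B : SSet.{u}} (b : Δ[0] ⟶ B) : Prop :=
  ∃ h₀ h₁ : B ⊗ Δ[1] ⟶ B, ι₀ ≫ h₀ = 𝟙 B ∧ ι₁ ≫ h₀ = ι₁ ≫ h₁ ∧
    ι₀ ≫ h₁ = stdSimplex.isTerminalObj₀.from B ≫ b ∧ b ▷ _ ≫ h₀ = fst _ _ ≫ b ∧
    b ▷ _ ≫ h₁ = fst _ _ ≫ b

/-- The contraction of the base lifts to a deformation of `E` which is stationary on the fibre and
ends inside it. -/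
lemma IsConed.anod_fiber {B E F : SSet.{u}} {b : Δ[0] ⟶ B} (hb : IsConed b) {j : F ⟶ E}
    {f : F ⟶ Δ[0]} {p : E ⟶ B} (pb : IsPullback j f p b) (hp : kfib p) : anod j := by
  obtain ⟨h₀, h₁, e₀, e, e₁, k₀, k₁⟩ := hb
  have : Mono b := ⟨fun _ _ _ => stdSimplex.isTerminalObj₀.hom_ext _ _⟩
  have : Mono j := mono_fst_of_isPullback pb
  have w := pb.w
  have hj : ∀ h : B ⊗ Δ[1] ⟶ B, b ▷ _ ≫ h = fst _ _ ≫ b →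
      (fst _ _ ≫ j) ≫ p = j ▷ Δ[1] ≫ p ▷ _ ≫ h := fun h hh => by
    rw [← comp_whiskerRight_assoc, w, comp_whiskerRight_assoc, hh, whiskerRight_fst_assoc,
      Category.assoc, w]
  obtain ⟨H₀, a₀, c₀, d₀⟩ := hp.homotopyExtension₀ (i := j) (𝟙 E) (fst _ _ ≫ j) (p ▷ _ ≫ h₀)
    (by simp) (by rw [ι₀_comp_assoc, e₀]; simp) (hj _ k₀)
  obtain ⟨H₁, a₁, c₁, d₁⟩ := hp.homotopyExtension₁ (i := j) (ι₁ ≫ H₀) (fst _ _ ≫ j) (p ▷ _ ≫ h₁)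
    (by rw [← ι₁_comp_assoc, c₀]) (by rw [Category.assoc, d₀, ι₁_comp_assoc, e, ι₁_comp_assoc])
    (hj _ k₁)
  refine anod_of_deformation H₀ H₁
    (pb.lift (ι₀ ≫ H₁) (stdSimplex.isTerminalObj₀.from E) ?_) a₀ a₁.symm
    (pb.lift_fst _ _ _).symm c₀ c₁
  rw [Category.assoc, d₁, ι₀_comp_assoc, e₁, ← Category.assoc]
  congr 1

lemma IsConed.anod {B : SSet.{u}} {b : Δ[0] ⟶ B} (hb : IsConed b) : anod b :=
  hb.anod_fiber (p := 𝟙 B) (f := 𝟙 _) (IsPullback.of_vert_isIso ⟨by simp⟩)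
    (MorphismProperty.of_isIso _ _)

/-- The homotopy from `φ` to `max - k`. -/
def coneHomotopy {n : ℕ} (k : Fin (n + 1)) (φ : Fin (n + 1) →o Fin (n + 1))
    (hφ : ∀ i, φ i ≤ max i k) : Δ[n] ⊗ Δ[1] ⟶ (Δ[n] : SSet.{u}) where
  app m := ↾fun x => stdSimplex.objMk
    ⟨fun i => if stdSimplex.asOrderHom x.2 i = 0 then φ (stdSimplex.asOrderHom x.1 i)
        else max (stdSimplex.asOrderHom x.1 i) k, fun i j hij => by
      have h₁ := (stdSimplex.asOrderHom x.1).monotone hij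
      have h₂ := (stdSimplex.asOrderHom x.2).monotone hij
      dsimp only
      split_ifs with hi hj hj
      · exact φ.monotone h₁
      · exact (hφ _).trans (max_le_max_right k h₁)
      · rw [hj] at h₂
        exact absurd (le_antisymm h₂ (Fin.zero_le _)) hi
      · exact max_le_max_right k h₁⟩
  naturality _ _ _ := rfl

lemma ι₀_coneHomotopy {n : ℕ} (k : Fin (n + 1)) (φ : Fin (n + 1) →o Fin (n + 1))
    (hφ : ∀ i, φ i ≤ max i k) :
    ι₀ ≫ coneHomotopy.{u} k φ hφ = SSet.stdSimplex.map (SimplexCategory.Hom.mk φ) := rfl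

lemma const_coneHomotopy {n : ℕ} (k : Fin (n + 1)) (φ : Fin (n + 1) →o Fin (n + 1))
    (hφ : ∀ i, φ i ≤ max i k) (h : φ k = k) :
    SSet.const (X := Δ[0]) (SSet.stdSimplex.obj₀Equiv.symm k) ▷ Δ[1] ≫ coneHomotopy.{u} k φ hφ =
      fst _ _ ≫ SSet.const (SSet.stdSimplex.obj₀Equiv.symm k) := by
  ext m x
  apply stdSimplex.objEquiv.injective
  ext i
  change ((if _ then φ k else max k k : Fin (n + 1)) : ℕ) = k
  simp [h]

/-- The inequalities `i ≤ max i k` and `k ≤ max i k` give the two homotopies. An interior vertex `k`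
is not comparable with all others, which is why contractions are allowed to be zigzags. -/
lemma isConed_stdSimplex {n : ℕ} (k : Fin (n + 1)) :
    IsConed.{u} (SSet.const (X := Δ[0]) (SSet.stdSimplex.obj₀Equiv.symm k : (Δ[n] : SSet.{u}) _⦋0⦌)) :=
  ⟨coneHomotopy.{u} k OrderHom.id (fun _ => le_max_left _ _),
    coneHomotopy.{u} k (OrderHom.const _ k) (fun _ => le_max_right _ _),
    SSet.stdSimplex.{u}.map_id ⦋n⦌, rfl, rfl,
    const_coneHomotopy _ _ _ rfl, const_coneHomotopy _ _ _ rfl⟩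

/-- The homotopies of the simplex preserve the horn: they create no vertices other than those
already present and `k`, while a simplex lies in the horn exactly when its vertices together with
`k` do not exhaust all vertices. -/
lemma isConed_horn {n : ℕ} (k : Fin (n + 2)) :
    ∃ b : Δ[0] ⟶ (Λ[n + 1, k] : SSet.{u}), IsConed b := by
  have hb : Subcomplex.range (SSet.const (X := Δ[0])
      (SSet.stdSimplex.obj₀Equiv.symm k : (Δ[n + 1] : SSet.{u}) _⦋0⦌)) ≤ Λ[n + 1, k] := by
    rintro m _ ⟨x, rfl⟩
    rw [mem_horn_iff]
    intro h
    obtain ⟨l, hl⟩ := exists_ne k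
    have : l ∈ (Set.univ : Set (Fin (n + 2))) := Set.mem_univ l
    rw [← h] at this
    obtain ⟨i, hi⟩ | hi := this
    · exact hl (hi.symm.trans rfl)
    · exact hl hi
  have H : ∀ (φ : Fin (n + 2) →o Fin (n + 2)) (hφ : ∀ i, φ i ≤ max i k),
      (∀ i, φ i = i ∨ φ i = k) →
      Subcomplex.range (Λ[n + 1, k].ι ▷ Δ[1] ≫ coneHomotopy.{u} k φ hφ) ≤ Λ[n + 1, k] := by
    rintro φ hφ h m _ ⟨⟨⟨x, hx⟩, t⟩, rfl⟩
    rw [mem_horn_iff] at hx ⊢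
    refine fun h' => hx (Set.eq_univ_of_forall fun i => ?_)
    have : i ∈ (Set.univ : Set (Fin (n + 2))) := Set.mem_univ i
    rw [← h'] at this
    obtain ⟨l, hl⟩ | hi := this
    · change (if stdSimplex.asOrderHom t l = 0 then φ (stdSimplex.asOrderHom x l)
        else max (stdSimplex.asOrderHom x l) k) = i at hl
      split_ifs at hl
      · rcases h (stdSimplex.asOrderHom x l) with h | h
        · exact Or.inl ⟨l, h.symm.trans hl⟩
        · exact Or.inr (hl.symm.trans h)
      · rcases max_choice (stdSimplex.asOrderHom x l) k with h | h
        · exact Or.inl ⟨l, h.symm.trans hl⟩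
        · exact Or.inr (hl.symm.trans h)
    · exact Or.inr hi
  refine ⟨Subcomplex.lift _ hb,
    Subcomplex.lift _ (H OrderHom.id (fun _ => le_max_left _ _) fun _ => Or.inl rfl),
    Subcomplex.lift _ (H (OrderHom.const _ k) (fun _ => le_max_right _ _) fun _ => Or.inr rfl),
    ?_, rfl, rfl, ?_, ?_⟩
  · rw [← cancel_mono (Λ[n + 1, k].ι)]
    exact (congrArg (fun f => Λ[n + 1, k].ι ≫ f)
      ((ι₀_coneHomotopy k OrderHom.id (fun i => le_max_left i k)).trans
        (SSet.stdSimplex.{u}.map_id ⦋n + 1⦌))).trans (Category.comp_id _)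
  · rw [← cancel_mono (Λ[n + 1, k].ι)]
    exact const_coneHomotopy k OrderHom.id (fun i => le_max_left i k) rfl
  · rw [← cancel_mono (Λ[n + 1, k].ι)]
    exact const_coneHomotopy k (OrderHom.const _ k) (fun i => le_max_right i k) rfl

/-! ### Fibrewise deformation retracts -/

/-- Homotopy extension turns the fibrewise homotopy inverse into a strict retraction `ρ`; it remains
to make the homotopy from the identity to `ρ ≫ w` stationary on `E`, so that `E` is a strong
deformation retract. -/
lemma anod_of_fiberwise {A E E' : SSet.{u}} {q : E ⟶ A} {q' : E' ⟶ A} (hq : kfib q)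
    (hq' : kfib q') {w : E ⟶ E'} [Mono w] (hw : w ≫ q' = q) {v : E' ⟶ E} (hv : v ≫ q = q')
    (h₁ : Htpy q (w ≫ v) (𝟙 E)) (h₂ : Htpy q' (𝟙 E') (v ≫ w)) : anod w := by
  obtain ⟨H, a₀, a₁, a₂⟩ := h₁
  obtain ⟨L, b₀, b₁, b₂⟩ := hq.homotopyExtension₀ (i := w) v H (fst _ _ ≫ q') a₀
    (by simp [hv]) (by simp [a₂, hv, hw])
  obtain ⟨ρ, hρ⟩ : ∃ ρ, ρ = ι₁ ≫ L := ⟨_, rfl⟩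
  have hwρ : w ≫ ρ = 𝟙 E := by rw [hρ, ← ι₁_comp_assoc, b₁, a₁]
  have hρq : ρ ≫ q = q' := by rw [hρ, Category.assoc, b₂]; simp
  have h₃ : Htpy q' (𝟙 E') (ρ ≫ w) := by
    refine h₂.trans hq' (Htpy.comp_right ?_ (p := q) w (𝟙 A) (by simp [hw]))
    exact ⟨L, b₀, hρ.symm, by rw [b₂, hv]⟩
  obtain ⟨K, k₀, k₁, k₂⟩ := h₃
  -- The homotopies `K` and `(ρ ≫ w) ▷ _ ≫ K` have the same end and the same restriction along `w`.
  -- Comparing them cancels the motion of `K` on `E`.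
  obtain ⟨M, m₀, m₁, m₂, m₃⟩ := hq'.exists_homotopy_comp (i := w) K ((ρ ≫ w) ▷ _ ≫ K)
    (by rw [ι₁_comp_assoc, k₁, Category.assoc, reassoc_of% hwρ])
    (by rw [Category.assoc, k₂, whiskerRight_fst_assoc]; simp [hw, hρq])
    (by rw [← comp_whiskerRight_assoc, reassoc_of% hwρ])
  refine anod_of_deformation M (fst _ _ ≫ ρ ≫ w) ρ (m₀.trans k₀) ?_ (by simp) ?_
    (by simp [reassoc_of% hwρ])
  · rw [m₁, ι₀_comp_assoc, k₀]; simp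
  · rw [m₂, k₀, Category.comp_id]

/-! ### Extension of fibrations along a monomorphism -/

lemma IsPushout.whiskerRight {P Q R S : SSet.{u}} {a : P ⟶ Q} {b : P ⟶ R} {c : Q ⟶ S}
    {d : R ⟶ S} (h : IsPushout a b c d) (Z : SSet.{u}) :
    IsPushout (a ▷ Z) (b ▷ Z) (c ▷ Z) (d ▷ Z) := by
  have := h.map (tensorLeft Z)
  exact this.of_iso (β_ _ _) (β_ _ _) (β_ _ _) (β_ _ _) (by simp) (by simp) (by simp) (by simp)

/-- The extension is carved out of `D` as a subcomplex `H` whose restriction to `A` is `E`. It is a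
fibration because the deformation of `P` onto `E` extends to a deformation of `D` over `B` which
ends in `H` and fixes `H`, so that `H` is a retract of `D` over `B`. -/
lemma kfib.exists_extension {B : SSet.{u}} (A : B.Subcomplex) {D P E : SSet.{u}} {q : D ⟶ B}
    (hq : kfib q) {e : E ⟶ A} (he : kfib e) {t : P ⟶ D} {q' : P ⟶ A}
    (pb : IsPullback t q' q A.ι) {w : E ⟶ P} (hw : anod w) (hwe : w ≫ q' = e) :
    ∃ (H : SSet.{u}) (h : H ⟶ B) (k : E ⟶ H) (i : H ⟶ D) (r : D ⟶ H), kfib h ∧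
      IsPullback k e h A.ι ∧ i ≫ r = 𝟙 H ∧ i ≫ q = h ∧ r ≫ h = q ∧ k ≫ i = w ≫ t ∧
      Htpy q (𝟙 D) (r ≫ i) := by
  have hq' : kfib q' := MorphismProperty.of_isPullback pb hq
  have : Mono t := mono_fst_of_isPullback pb
  have : Mono w := hw.mono
  obtain ⟨ρ, hwρ, hρe⟩ := he.exists_lift hw (𝟙 E) q' (by simp [hwe])
  obtain ⟨K, k₀, k₁, k₂, k₃⟩ := hq'.exists_homotopy_rel (𝟙 P) (ρ ≫ w) (fst _ _ ≫ w)
    (fst _ _ ≫ q') hw (by simp) (by simp [reassoc_of% hwρ]) (by simp) (by simp [hwe, hρe])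
    (by simp)
  have hP : ∀ {n} (y : D.obj n), q.app n y ∈ A.obj n → ∃ z : P.obj n, t.app n z = y :=
    fun {n} y hy => by
      obtain ⟨z, hz, -⟩ := Types.exists_of_isPullback
        (pb.map ((CategoryTheory.evaluation _ _).obj n)) y ⟨_, hy⟩ rfl
      exact ⟨z, hz⟩
  have hP' : ∀ {n} (z : P.obj n), q.app n (t.app n z) ∈ A.obj n := fun {n} z => by
    have e : q.app n (t.app n z) = (q'.app n z).1 := app_congr pb.w z
    rw [e]
    exact (q'.app n z).2
  -- The largest subcomplex of `D` whose intersection with `P` is `E`.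
  let H : D.Subcomplex :=
    { obj n := {d | ∀ {m} (θ : n ⟶ m), D.map θ d ∈ (Subcomplex.range t).obj m →
          D.map θ d ∈ (Subcomplex.range (w ≫ t)).obj m}
      map {n m} θ d hd l ξ h := by
        have e : D.map ξ (D.map θ d) = D.map (θ ≫ ξ) d := by simp
        rw [e] at h ⊢
        exact hd _ h }
  have hEH : Subcomplex.range (w ≫ t) ≤ H := by
    rintro n d hd m θ -
    exact (Subcomplex.range (w ≫ t)).map θ hd
  have hEP : Subcomplex.range (w ≫ t) ≤ Subcomplex.range t := by
    rintro n _ ⟨x, rfl⟩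
    exact ⟨_, rfl⟩
  have sq : Subcomplex.BicartSq (Subcomplex.range (w ≫ t)) (Subcomplex.range t) H
      (Subcomplex.range t ⊔ H) :=
    { sup_eq := rfl
      inf_eq := by
        refine le_antisymm ?_ (le_inf hEP hEH)
        rintro n d ⟨h₁, h₂⟩
        have := h₂ (𝟙 n)
        rw [Functor.map_id_apply] at this
        exact this h₁ }
  have i₁ : IsIso (Subcomplex.toRange t) := isIso_of_mono_of_epi _
  have i₂ : IsIso (Subcomplex.toRange (w ≫ t)) := isIso_of_mono_of_epi _
  have f₁ : Subcomplex.toRange (w ≫ t) ≫ Subcomplex.homOfLE hEP = w ≫ Subcomplex.toRange t := rfl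
  -- On `P ∪ H` the homotopy is `K` on `P` and constant on `H`. These agree on the intersection `E`,
  -- where `K` is stationary.
  obtain ⟨Φ, φ₁, φ₂⟩ := (IsPushout.whiskerRight sq.isPushout Δ[1]).exists_desc
    (inv (Subcomplex.toRange t) ▷ _ ≫ K ≫ t) (fst _ _ ≫ H.ι) (by
      rw [← cancel_epi (Subcomplex.toRange (w ≫ t) ▷ _), ← comp_whiskerRight_assoc, f₁,
        ← comp_whiskerRight_assoc, Category.assoc, IsIso.hom_inv_id, Category.comp_id,
        reassoc_of% k₂]
      rfl)
  have φ₁' : Subcomplex.toRange t ▷ _ ≫ Subcomplex.homOfLE sq.le₂₄ ▷ _ ≫ Φ = K ≫ t := by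
    rw [φ₁, ← comp_whiskerRight_assoc, IsIso.hom_inv_id, id_whiskerRight, Category.id_comp]
  obtain ⟨L, l₀, l₁, l₂⟩ := hq.homotopyExtension₀ (i := (Subcomplex.range t ⊔ H).ι) (𝟙 D) Φ
    (fst _ _ ≫ q)
    (by
      apply sq.isPushout.hom_ext
      · rw [← cancel_epi (Subcomplex.toRange t), ← ι₀_comp_assoc, ← ι₀_comp_assoc, φ₁',
          reassoc_of% k₀]
        rfl
      · rw [← ι₀_comp_assoc, φ₂]
        rfl)
    (by simp)
    (by
      apply (IsPushout.whiskerRight sq.isPushout Δ[1]).hom_ext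
      · rw [← cancel_epi (Subcomplex.toRange t ▷ _), reassoc_of% φ₁', pb.w, reassoc_of% k₃, ← pb.w]
        rfl
      · rw [reassoc_of% φ₂]
        rfl)
  -- A face of an end point of `L` which lies in `P` comes from a simplex of `P`, since `L` is
  -- vertical. On `P` the homotopy is `K`, which ends in `E`.
  have hL : Subcomplex.range (ι₁ ≫ L) ≤ H := by
    rintro n _ ⟨d, rfl⟩ m θ h
    obtain ⟨z, hz⟩ := h
    have e₁ : D.map θ ((ι₁ ≫ L).app n d) = (ι₁ ≫ L).app m (D.map θ d) :=
      (NatTrans.naturality_apply (ι₁ ≫ L) θ d).symm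
    rw [e₁] at hz ⊢
    have e₂ : q.app m (D.map θ d) = q.app m ((ι₁ ≫ L).app m (D.map θ d)) := by
      have : (ι₁ ≫ L) ≫ q = q := by rw [Category.assoc, l₂]; simp
      conv_lhs => rw [← this]
      rfl
    obtain ⟨y, hy⟩ := hP (D.map θ d) (by
      rw [e₂, ← hz]
      exact hP' z)
    have e₃ : t ≫ ι₁ ≫ L = ρ ≫ w ≫ t := by
      have : t = Subcomplex.toRange t ≫ Subcomplex.homOfLE sq.le₂₄ ≫
        (Subcomplex.range t ⊔ H).ι := rfl
      conv_lhs => rw [this]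
      rw [Category.assoc, Category.assoc, ← ι₁_comp_assoc, l₁, ← ι₁_comp_assoc, ← ι₁_comp_assoc,
        φ₁', reassoc_of% k₁]
    rw [← hy]
    exact ⟨ρ.app m y, (app_congr e₃ y).symm⟩
  have hιr : H.ι ≫ Subcomplex.lift (ι₁ ≫ L) hL = 𝟙 _ := by
    rw [← cancel_mono H.ι, Category.assoc, Category.id_comp]
    change H.ι ≫ ι₁ ≫ L = H.ι
    have : H.ι = Subcomplex.homOfLE sq.le₃₄ ≫ (Subcomplex.range t ⊔ H).ι := rfl
    conv_lhs => rw [this]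
    rw [Category.assoc, ← ι₁_comp_assoc, l₁, ← ι₁_comp_assoc, φ₂]
    simp
  have hr : Subcomplex.lift (ι₁ ≫ L) hL ≫ H.ι ≫ q = q := by
    change (ι₁ ≫ L) ≫ q = q
    rw [Category.assoc, l₂]; simp
  have hk : Subcomplex.lift (w ≫ t) hEH ≫ H.ι = w ≫ t := rfl
  refine ⟨H, H.ι ≫ q, Subcomplex.lift (w ≫ t) hEH, H.ι, Subcomplex.lift (ι₁ ≫ L) hL, ?_,
    ⟨⟨by rw [reassoc_of% hk, pb.w, reassoc_of% hwe]⟩, ⟨?_⟩⟩, hιr, rfl, hr, hk,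
    ⟨L, l₀, rfl, by rw [l₂, Category.id_comp]⟩⟩
  · refine MorphismProperty.of_retract (P := kfib) (f := H.ι ≫ q) (g := q) ?_ hq
    exact ⟨Arrow.homMk H.ι (𝟙 B), Arrow.homMk (Subcomplex.lift (ι₁ ≫ L) hL) (𝟙 B) (by simpa using hr),
      by ext : 1 <;> simp [hιr]⟩
  · refine PullbackCone.IsLimit.mk _ (fun s => pb.lift (s.fst ≫ H.ι) s.snd
      (by rw [Category.assoc, s.condition]) ≫ ρ) (fun s => ?_) (fun s => ?_) (fun s m hm _ => ?_)
    · rw [← cancel_mono H.ι, Category.assoc, Category.assoc, hk]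
      ext n x
      obtain ⟨z, hz⟩ : ∃ z, (pb.lift (s.fst ≫ H.ι) s.snd
        (by rw [Category.assoc, s.condition])).app n x = z := ⟨_, rfl⟩
      have hz' : t.app n z = (s.fst.app n x).1 := by
        rw [← hz]
        exact app_congr (pb.lift_fst _ _ _) x
      have h₁ := (s.fst.app n x).2 (𝟙 n)
      rw [Functor.map_id_apply, ← hz'] at h₁
      obtain ⟨y, hy⟩ := h₁ ⟨z, rfl⟩
      have hy : w.app n y = z := ((mono_iff_injective _).1
        (inferInstance : Mono (t.app n))) hy
      change t.app n (w.app n (ρ.app n ((pb.lift (s.fst ≫ H.ι) s.snd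
        (by rw [Category.assoc, s.condition])).app n x))) = (s.fst.app n x).1
      rw [hz, ← hz', ← hy]
      exact congrArg (fun y => t.app n (w.app n y)) (app_congr hwρ y)
    · rw [Category.assoc, hρe, pb.lift_snd]
    · have e : m ≫ w = pb.lift (s.fst ≫ H.ι) s.snd (by rw [Category.assoc, s.condition]) := by
        rw [← cancel_mono t, pb.lift_fst, ← hm, Category.assoc, Category.assoc, hk]
      rw [← e, Category.assoc, hwρ, Category.comp_id]

/-! ### Extension of fibrations along horn inclusions -/

lemma isPullback_fst {X Y T : SSet.{u}} (hT : IsTerminal T) :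
    IsPullback (fst X Y) (snd X Y) (hT.from X) (hT.from Y) :=
  IsPullback.of_is_product' (tensorProductIsBinaryProduct X Y) hT

lemma isPullback_whiskerRight_fst {X X' : SSet.{u}} (f : X ⟶ X') (Y : SSet.{u}) :
    IsPullback (f ▷ Y) (fst X Y) (fst X' Y) f := by
  refine ⟨⟨by simp⟩, ⟨PullbackCone.IsLimit.mk _ (fun s => lift s.snd (s.fst ≫ snd _ _))
    (fun s => ?_) (fun s => ?_) (fun s m h₁ h₂ => ?_)⟩⟩
  · ext : 1
    · simp [s.condition]
    · simp
  · simp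
  · ext : 1
    · simpa using h₂
    · simp [← h₁]

lemma kfib_fst {X Y : SSet.{u}} [KanComplex Y] : kfib (fst X Y) :=
  MorphismProperty.of_isPullback (P := kfib) (isPullback_fst (X := X) (Y := Y) terminalIsTerminal).flip
    (kfib_terminal Y)

lemma kan_of_kfib {K T : SSet.{u}} (hT : IsTerminal T) {f : K ⟶ T} (hf : kfib f) :
    KanComplex K := by
  rw [kan_iff]
  have : IsIso (terminal.from T) :=
    ⟨hT.from _, hT.hom_ext _ _, Subsingleton.elim _ _⟩
  have h : terminal.from K = f ≫ terminal.from T := Subsingleton.elim _ _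
  rw [h]
  exact kfib.comp_mem _ _ hf (MorphismProperty.of_isIso _ _)

lemma SHtpy.of_tfib_terminal {X I T : SSet.{u}} (hT : IsTerminal T) {p : I ⟶ T} (hp : tfib p)
    (f g : X ⟶ I) : SHtpy f g := (hp.htpy (f := f) (g := g) (hT.hom_ext _ _)).shtpy

/-- The fibre `F` over the cone point is anodyne in `E`, which provides a retraction of `E` onto `F`
and a map `Λ × F → E` over the horn. So `E` is fibrewise homotopy equivalent to a product with a Kan
complex. The product extends over the simplex, and the extension of `E` is cut out of it. -/
lemma exists_extension_horn {n : ℕ} (k : Fin (n + 2)) {E : SSet.{u}}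
    {e : E ⟶ (Λ[n + 1, k] : SSet.{u})} (he : kfib e) :
    ∃ (H : SSet.{u}) (h : H ⟶ Δ[n + 1]) (l : E ⟶ H), kfib h ∧ IsPullback l e h Λ[n + 1, k].ι := by
  obtain ⟨b, hb⟩ := isConed_horn.{u} k
  obtain ⟨F, j, f, pb⟩ : ∃ (F : SSet.{u}) (j : F ⟶ E) (f : F ⟶ Δ[0]), IsPullback j f e b :=
    ⟨_, _, _, IsPullback.of_hasPullback e b⟩
  have hj : ModFib.anod j := hb.anod_fiber pb he
  have hF : KanComplex F := kan_of_kfib stdSimplex.isTerminalObj₀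
    (MorphismProperty.of_isPullback (P := kfib) pb he)
  obtain ⟨r, hr, -⟩ := (kfib_terminal F).exists_lift hj (𝟙 F) (terminal.from _)
    (Subsingleton.elim _ _)
  -- The contractible factor `I` serves to make the comparison of `E` with a product a monomorphism.
  obtain ⟨I, c, π, hc, hπ, -⟩ := exists_mono_tfib_factorization (stdSimplex.isTerminalObj₀.from E)
  have hI : KanComplex I := kan_of_kfib stdSimplex.isTerminalObj₀ hπ.kfib
  have hFI : KanComplex (F ⊗ I) := kan_of_kfib (f := fst F I ≫ terminal.from F)
    terminalIsTerminal (kfib.comp_mem _ _ kfib_fst (kfib_terminal F))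
  obtain ⟨a, ha⟩ : ∃ a : F ⟶ (Λ[n + 1, k] : SSet.{u}) ⊗ F, a = lift (f ≫ b) (𝟙 F) := ⟨_, rfl⟩
  have ha' : ModFib.anod a := by
    have : IsIso (lift f (𝟙 F)) := ⟨snd _ _, by simp, by
      ext : 1
      · exact stdSimplex.isTerminalObj₀.hom_ext _ _
      · simp⟩
    have e₁ : a = lift f (𝟙 F) ≫ b ▷ F := by rw [ha]; ext : 1 <;> simp
    rw [e₁]
    exact anodyneExtensions.comp_mem _ _ (.of_isIso _) (hb.anod.whiskerRight F)
  obtain ⟨s, hs₁, hs₂⟩ := he.exists_lift ha' j (fst _ _) (by rw [pb.w, ha]; simp)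
  have hw : Mono (lift e (lift r c)) := by
    have : Mono (lift e (lift r c) ≫ snd _ _ ≫ snd _ _) := by simpa using hc
    exact mono_of_mono _ (snd _ _ ≫ snd _ _)
  have e₂ : lift e (lift r c) ≫ _ ◁ fst F I = lift e r := by ext : 1 <;> simp
  have e₃ : j ≫ lift e r = a := by rw [ha]; ext : 1 <;> simp [hr, pb.w]
  have hwanod : ModFib.anod (lift e (lift r c)) := by
    refine anod_of_fiberwise (q' := fst _ (F ⊗ I)) (v := _ ◁ fst F I ≫ s) he kfib_fst
      (by simp) (by rw [Category.assoc, hs₂]; simp) ?_ ?_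
    · refine he.htpy hj ?_ ?_
      · rw [reassoc_of% e₂, reassoc_of% e₃, hs₁, Category.comp_id]
      · rw [reassoc_of% e₂, Category.assoc, hs₂]; simp
    · obtain ⟨H₁, a₀, a₁, -⟩ := Htpy.comp_left ((kfib_terminal F).htpy ha'
        (f := snd _ _) (g := s ≫ r) (by rw [reassoc_of% hs₁, hr, ha]; simp)
        (Subsingleton.elim _ _)) ((Λ[n + 1, k] : SSet.{u}) ◁ fst F I)
      obtain ⟨H₂, b₀, b₁, -⟩ := SHtpy.of_tfib_terminal stdSimplex.isTerminalObj₀ hπ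
        (snd (Λ[n + 1, k] : SSet.{u}) _ ≫ snd F I)
        (((Λ[n + 1, k] : SSet.{u}) ◁ fst F I ≫ s) ≫ c)
      refine ⟨lift (fst _ _ ≫ fst _ _) (lift H₁ H₂), ?_, ?_, by simp⟩
      · ext : 1
        · simp
        · ext : 1
          · simpa using a₀
          · simpa using b₀
      · ext : 1
        · simp [hs₂]
        · ext : 1
          · simpa using a₁
          · simpa using b₁
  obtain ⟨H, h, l, -, -, hh, pb', -⟩ := kfib.exists_extension Λ[n + 1, k] (kfib_fst (Y := F ⊗ I)) he
    (isPullback_whiskerRight_fst _ _) hwanod (by simp)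
  exact ⟨H, h, l, hh, pb'⟩

/-! ### Cocontinuous functors on simplicial sets over `X` -/

section Realization

variable {X : SSet.{u}}

/-- The functor sending a simplex `Δ[n] ⟶ X` to itself, as a simplicial set over `X`. -/
abbrev simplexOver (X : SSet.{u}) : Simplices X ⥤ Over X :=
  CostructuredArrow.toOver simplexFunctor.{u} X

namespace total

variable (P : (Simplices X)ᵒᵖ ⥤ Type u)

/-- The simplices of the total space of a presheaf on the category of simplices. -/
abbrev Simplex (n : SimplexCategory) : Type u :=
  Σ x : simplexFunctor.obj n ⟶ X, P.obj (op (CostructuredArrow.mk x))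

variable {P} in
-- Equality of pairs is tested along a map of simplices lying over an identity, which avoids
-- transporting the second components along an equation.
lemma Simplex.ext {n : SimplexCategory} {s t : Simplex P n}
    (φ : CostructuredArrow.mk s.1 ⟶ CostructuredArrow.mk t.1) (h : φ.left = 𝟙 _)
    (h' : P.map φ.op t.2 = s.2) : s = t := by
  obtain ⟨x, a⟩ := s
  obtain ⟨y, b⟩ := t
  have e : x = y := by
    have := CostructuredArrow.w φ
    simpa [h] using this.symm
  subst e
  have e : φ = 𝟙 _ := by ext : 1; exact h
  subst e
  rw [← show P.map (𝟙 _) b = a from h', Functor.map_id_apply]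

variable {P} in
/-- The action of a map of the simplex category on the simplices of the total space. -/
def Simplex.map {m n : SimplexCategory} (α : n ⟶ m) (s : Simplex P m) : Simplex P n :=
  ⟨simplexFunctor.map α ≫ s.1, P.map (CostructuredArrow.homMk α rfl :
      CostructuredArrow.mk (simplexFunctor.map α ≫ s.1) ⟶ CostructuredArrow.mk s.1).op s.2⟩

lemma Simplex.map_id {n : SimplexCategory} (s : Simplex P n) : s.map (𝟙 n) = s :=
  Simplex.ext (CostructuredArrow.homMk (𝟙 _)
    (show simplexFunctor.map (𝟙 n) ≫ s.1 = simplexFunctor.map (𝟙 n) ≫ s.1 from rfl)) rfl rfl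

variable {P} in
lemma map_map {ρ σ τ : Simplices X} {f : ρ ⟶ σ} {g : σ ⟶ τ} {h : ρ ⟶ τ} (e : f.left ≫ g.left = h.left)
    (a : P.obj (op τ)) : P.map f.op (P.map g.op a) = P.map h.op a := by
  have : f ≫ g = h := by ext : 1; exact e
  rw [← this, op_comp, Functor.map_comp_apply]

lemma Simplex.map_comp {l m n : SimplexCategory} (β : l ⟶ m) (α : m ⟶ n) (s : Simplex P n) :
    s.map (β ≫ α) = (s.map α).map β := by
  refine Simplex.ext (CostructuredArrow.homMk (𝟙 _) (by simp [Simplex.map])) rfl ?_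
  refine (congrArg _ (map_map (h := CostructuredArrow.homMk (β ≫ α) (by simp [Simplex.map])) rfl
    s.2)).trans (map_map ?_ _)
  exact Category.id_comp _

lemma simplexFunctor_map_id_comp {n : SimplexCategory} {Y : SSet.{u}}
    (v : simplexFunctor.obj n ⟶ Y) : simplexFunctor.map (𝟙 n) ≫ v = v := by
  rw [CategoryTheory.Functor.map_id, Category.id_comp]

/-- The total space of a presheaf on the category of simplices. -/
def space : SSet.{u} where
  obj n := Simplex P n.unop
  map α := ↾Simplex.map α.unop
  map_id _ := ConcreteCategory.hom_ext _ _ fun s => Simplex.map_id P s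
  map_comp α β := ConcreteCategory.hom_ext _ _ fun s => Simplex.map_comp P β.unop α.unop s

/-- The projection of the total space. -/
def proj : space P ⟶ X where
  app _ := ↾fun s => yonedaEquiv s.1
  naturality _ _ _ := ConcreteCategory.hom_ext _ _ fun _ => (SSet.yonedaEquiv_naturality _ _).symm

/-- The map from a simplex to another one with the same underlying map to `X`. -/
def homOfEq {σ : Simplices X} {x : simplexFunctor.obj σ.left ⟶ X} (h : x = σ.hom) :
    σ ⟶ CostructuredArrow.mk x :=
  CostructuredArrow.homMk (𝟙 _) (by rw [h]; simp)

variable {P} {V : Over X} (a : ∀ ⦃σ : Simplices X⦄, ((simplexOver X).obj σ ⟶ V) → P.obj (op σ))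

/-- The simplex of the total space determined by a simplex of `V`. -/
abbrev simplex {n : SimplexCategory} (v : simplexFunctor.obj n ⟶ V.left) : Simplex P n :=
  ⟨v ≫ V.hom, a (Over.homMk v : (simplexOver X).obj (CostructuredArrow.mk (v ≫ V.hom)) ⟶ V)⟩

variable (ha : ∀ ⦃σ τ : Simplices X⦄ (φ : σ ⟶ τ) (t : (simplexOver X).obj τ ⟶ V),
    P.map φ.op (a t) = a ((simplexOver X).map φ ≫ t))

include ha in
lemma map_eq {σ τ τ' : Simplices X} {φ : σ ⟶ τ} {t : (simplexOver X).obj τ ⟶ V} {ψ : σ ⟶ τ'}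
    {t' : (simplexOver X).obj τ' ⟶ V}
    (h : ((simplexOver X).map φ).left ≫ t.left = ((simplexOver X).map ψ).left ≫ t'.left) :
    P.map φ.op (a t) = P.map ψ.op (a t') := by
  rw [ha, ha]
  congr 1
  ext : 1
  exact h

include ha in
lemma map_simplex {m n : SimplexCategory} (α : n ⟶ m) (v : simplexFunctor.obj m ⟶ V.left) :
    (simplex a v).map α = simplex a (simplexFunctor.map α ≫ v) := by
  refine Simplex.ext (CostructuredArrow.homMk (𝟙 _) (by simp [Simplex.map])) rfl ?_
  refine map_eq a ha ?_
  exact simplexFunctor_map_id_comp _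

/-- A compatible family of elements of `P`, indexed by the simplices of `V`, is a map over `X` to
the total space of `P`. -/
def lift : V ⟶ Over.mk (proj P) :=
  Over.homMk
    { app := fun _ => ↾fun v => simplex a (yonedaEquiv.symm v)
      naturality := fun _ _ α => ConcreteCategory.hom_ext _ _ fun v => by
        refine Eq.trans ?_ (map_simplex a ha α.unop _).symm
        exact congrArg (simplex a) (yonedaEquiv_symm_naturality_left _ _).symm }
    (by
      ext n v
      change yonedaEquiv (yonedaEquiv.symm v ≫ V.hom) = _
      rw [yonedaEquiv_symm_comp, Equiv.apply_symm_apply]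
      rfl)

lemma lift_app {n : SimplexCategory} (v : simplexFunctor.obj n ⟶ V.left) :
    (lift a ha).left.app _ (yonedaEquiv v) = simplex a v :=
  congrArg (simplex a) (yonedaEquiv.symm_apply_apply v)

lemma Simplex.congr_snd {n : SimplexCategory} {s t : Simplex P n} (h : s = t) {σ : Simplices X}
    (φ : σ ⟶ CostructuredArrow.mk s.1) (ψ : σ ⟶ CostructuredArrow.mk t.1) (h' : φ.left = ψ.left) :
    P.map φ.op s.2 = P.map ψ.op t.2 := by
  subst h
  have : φ = ψ := by ext : 1; exact h'
  rw [this]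

lemma lift_injective {a b : ∀ ⦃σ : Simplices X⦄, ((simplexOver X).obj σ ⟶ V) → P.obj (op σ)}
    (ha : ∀ ⦃σ τ : Simplices X⦄ (φ : σ ⟶ τ) (t : (simplexOver X).obj τ ⟶ V),
      P.map φ.op (a t) = a ((simplexOver X).map φ ≫ t))
    (hb : ∀ ⦃σ τ : Simplices X⦄ (φ : σ ⟶ τ) (t : (simplexOver X).obj τ ⟶ V),
      P.map φ.op (b t) = b ((simplexOver X).map φ ≫ t))
    (h : lift a ha = lift b hb) {σ : Simplices X} (t : (simplexOver X).obj σ ⟶ V) :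
    a t = b t := by
  have h₁ : simplex a t.left = simplex b t.left :=
    (lift_app a ha _).symm.trans ((app_congr (congrArg CommaMorphism.left h) _).trans
      (lift_app b hb _))
  have h₂ := Simplex.congr_snd h₁ (homOfEq (Over.w t)) (homOfEq (Over.w t)) rfl
  have h₃ (c : ∀ ⦃σ : Simplices X⦄, ((simplexOver X).obj σ ⟶ V) → P.obj (op σ))
      (hc : ∀ ⦃σ τ : Simplices X⦄ (φ : σ ⟶ τ) (t : (simplexOver X).obj τ ⟶ V),
      P.map φ.op (c t) = c ((simplexOver X).map φ ≫ t)) :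
      P.map (homOfEq (Over.w t)).op (simplex c t.left).2 = c t := by
    refine (hc _ _).trans (congrArg (fun t => c t) ?_)
    ext : 1
    exact simplexFunctor_map_id_comp _
  exact (h₃ a ha).symm.trans (h₂.trans (h₃ b hb))

/-- The element attached to a simplex of `V` is read off from its image under `k`; the base
simplices agree only up to a proved equality, across which `homOfEq` carries the element. With
`lift_injective`, maps to the total space are the same as compatible families. -/
lemma lift_surjective (k : V ⟶ Over.mk (proj P)) : ∃ a ha, k = lift a ha := by
  have hk {n : SimplexCategory} (v : simplexFunctor.obj n ⟶ V.left) :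
      (show Simplex P n from k.left.app _ (yonedaEquiv v)).1 = v ≫ V.hom := by
    have := app_congr (Over.w k) (yonedaEquiv v)
    change yonedaEquiv (show Simplex P n from k.left.app _ (yonedaEquiv v)).1 = _ at this
    apply yonedaEquiv.injective
    rw [this]
    rfl
  have hk' {n m : SimplexCategory} (α : m ⟶ n) (v : simplexFunctor.obj n ⟶ V.left) :
      (show Simplex P m from k.left.app _ (yonedaEquiv (simplexFunctor.map α ≫ v))) =
        (show Simplex P n from k.left.app _ (yonedaEquiv v)).map α := by
    rw [← SSet.yonedaEquiv_naturality]
    exact ConcreteCategory.congr_hom (k.left.naturality α.op) _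
  refine ⟨fun σ t => P.map (homOfEq ((hk t.left).trans (Over.w t))).op
      (show Simplex P σ.left from k.left.app _ (yonedaEquiv t.left)).2, fun σ τ φ t => ?_, ?_⟩
  · refine (map_map (h := (CostructuredArrow.homMk φ.left
      ((congrArg (simplexFunctor.map φ.left ≫ ·) ((hk t.left).trans (Over.w t))).trans
        (CostructuredArrow.w φ)) : σ ⟶ CostructuredArrow.mk
          (show Simplex P τ.left from k.left.app _ (yonedaEquiv t.left)).1)) (Category.comp_id _) _).trans ?_
    refine (map_map ?_ _).symm.trans (Simplex.congr_snd (hk' φ.left t.left).symm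
      (homOfEq ?_) _ rfl)
    · exact Category.id_comp _
    · exact (congrArg (simplexFunctor.map φ.left ≫ ·) ((hk t.left).trans (Over.w t))).trans
        (CostructuredArrow.w φ)
  · ext n v
    obtain ⟨w, rfl⟩ := yonedaEquiv.surjective v
    refine Eq.trans ?_ (lift_app _ _ w).symm
    refine (Simplex.ext (homOfEq (hk w).symm) rfl ?_)
    refine (map_map (h := 𝟙 _) (Category.id_comp _) _).trans ?_
    exact Functor.map_id_apply P _ _

end total

/-- The right adjoint is forced: it sends `S` to the total space of the presheaf `σ ↦ Hom(Φ σ, S)`,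
and the hypothesis says that maps out of `Φ V` are compatible families of its elements. -/
lemma isLeftAdjoint_of_dense (Φ : Over X ⥤ SSet.{u})
    (hΦ : ∀ (V : Over X) (S : SSet.{u})
      (a : ∀ ⦃σ : Simplices X⦄, ((simplexOver X).obj σ ⟶ V) → (Φ.obj ((simplexOver X).obj σ) ⟶ S)),
      (∀ ⦃σ τ : Simplices X⦄ (φ : σ ⟶ τ) (t : (simplexOver X).obj τ ⟶ V),
        Φ.map ((simplexOver X).map φ) ≫ a t = a ((simplexOver X).map φ ≫ t)) →
      ∃! g : Φ.obj V ⟶ S, ∀ ⦃σ : Simplices X⦄ (t : (simplexOver X).obj σ ⟶ V), Φ.map t ≫ g = a t) :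
    Φ.IsLeftAdjoint := by
  let P (S : SSet.{u}) : (Simplices X)ᵒᵖ ⥤ Type u := (simplexOver X).op ⋙ Φ.op ⋙ yoneda.obj S
  have h₀ {V : Over X} {S : SSet.{u}} (g : Φ.obj V ⟶ S) ⦃σ τ : Simplices X⦄ (φ : σ ⟶ τ)
      (t : (simplexOver X).obj τ ⟶ V) : Φ.map ((simplexOver X).map φ) ≫ Φ.map t ≫ g =
        Φ.map ((simplexOver X).map φ ≫ t) ≫ g := by
    rw [Functor.map_comp, Category.assoc]
  let e (V : Over X) (S : SSet.{u}) : (Φ.obj V ⟶ S) ≃ (V ⟶ Over.mk (total.proj (P S))) :=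
    Equiv.ofBijective (fun g => total.lift (P := P S) (fun σ t => Φ.map t ≫ g) (h₀ g)) (by
      constructor
      · intro g g' h
        obtain ⟨f, -, hf⟩ := hΦ V S (fun σ t => Φ.map t ≫ g) (h₀ g)
        exact (hf g fun _ _ => rfl).trans
          (hf g' fun σ t => (total.lift_injective (P := P S) (h₀ g) (h₀ g') h t).symm).symm
      · intro k
        obtain ⟨a, ha, rfl⟩ := total.lift_surjective k
        obtain ⟨g, hg, -⟩ := hΦ V S a ha
        refine ⟨g, ?_⟩
        have : (fun σ t => Φ.map t ≫ g) = a := by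
          funext σ t
          exact hg t
        subst this
        rfl)
  refine (Adjunction.adjunctionOfEquivRight e fun V' V S f g => ?_).isLeftAdjoint
  ext n v
  obtain ⟨w, rfl⟩ := yonedaEquiv.surjective v
  refine (total.lift_app (P := P S) _ (h₀ _) w).trans ?_
  change _ = (total.lift (P := P S) _ (h₀ g)).left.app n (f.left.app n (yonedaEquiv w))
  rw [← yonedaEquiv_comp]
  refine Eq.trans ?_ (total.lift_app (P := P S) _ (h₀ g) (w ≫ f.left)).symm
  refine total.Simplex.ext (total.homOfEq (by simp)) rfl ?_
  change Φ.map _ ≫ Φ.map _ ≫ g = Φ.map _ ≫ Φ.map f ≫ g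
  rw [← Functor.map_comp_assoc, ← Functor.map_comp_assoc]
  congr 2
  ext : 1
  exact total.simplexFunctor_map_id_comp _

end Realization

/-- A map of simplicial sets given by a natural transformation on simplices. -/
def homOfSimplices {A B : SSet.{u}}
    (g : ∀ ⦃n : SimplexCategory⦄, (simplexFunctor.obj n ⟶ A) → (simplexFunctor.obj n ⟶ B))
    (hg : ∀ ⦃m n : SimplexCategory⦄ (α : m ⟶ n) (z : simplexFunctor.obj n ⟶ A),
      g (simplexFunctor.map α ≫ z) = simplexFunctor.map α ≫ g z) : A ⟶ B where
  app _ := ↾fun v => yonedaEquiv (g (yonedaEquiv.symm v))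
  naturality m n α := ConcreteCategory.hom_ext _ _ fun v => by
    change yonedaEquiv (g (yonedaEquiv.symm _)) = B.map α (yonedaEquiv (g (yonedaEquiv.symm v)))
    obtain ⟨w, rfl⟩ := yonedaEquiv.surjective v
    have h : A.map α (yonedaEquiv w) = yonedaEquiv (simplexFunctor.map α.unop ≫ w) :=
      SSet.yonedaEquiv_naturality α.unop w
    refine (congrArg (fun v => yonedaEquiv (g (yonedaEquiv.symm v))) h).trans ?_
    rw [Equiv.symm_apply_apply, Equiv.symm_apply_apply, hg]
    exact (SSet.yonedaEquiv_naturality α.unop _).symm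

lemma comp_homOfSimplices {A B : SSet.{u}}
    (g : ∀ ⦃n : SimplexCategory⦄, (simplexFunctor.obj n ⟶ A) → (simplexFunctor.obj n ⟶ B))
    (hg : ∀ ⦃m n : SimplexCategory⦄ (α : m ⟶ n) (z : simplexFunctor.obj n ⟶ A),
      g (simplexFunctor.map α ≫ z) = simplexFunctor.map α ≫ g z) {n : SimplexCategory}
    (z : simplexFunctor.obj n ⟶ A) : z ≫ homOfSimplices g hg = g z := by
  apply yonedaEquiv.injective
  rw [yonedaEquiv_comp]
  change yonedaEquiv (g (yonedaEquiv.symm (yonedaEquiv z))) = _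
  rw [Equiv.symm_apply_apply]

lemma hom_ext_simplices {A B : SSet.{u}} {f g : A ⟶ B}
    (h : ∀ ⦃n : SimplexCategory⦄ (z : simplexFunctor.obj n ⟶ A), z ≫ f = z ≫ g) : f = g := by
  ext n v
  obtain ⟨w, rfl⟩ := yonedaEquiv.surjective v
  have := congrArg yonedaEquiv (h w)
  rwa [yonedaEquiv_comp, yonedaEquiv_comp] at this

/-! ### Base change as a cocontinuous functor -/

section BaseChange

variable {X Y : SSet.{u}} (p : Y ⟶ X)

/-- The functor sending `V ⟶ X` to the pullback of `V ⟶ X ⟵ Y`. -/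
def baseChange : Over X ⥤ SSet.{u} := Over.pullback p ⋙ Over.forget Y

/-- The first projection of the base change. -/
def baseChangeFst (V : Over X) : (baseChange p).obj V ⟶ V.left := pullback.fst V.hom p

/-- The second projection of the base change. -/
def baseChangeSnd (V : Over X) : (baseChange p).obj V ⟶ Y := pullback.snd V.hom p

lemma isPullback_baseChange (V : Over X) :
    IsPullback (baseChangeFst p V) (baseChangeSnd p V) V.hom p := IsPullback.of_hasPullback _ _

lemma baseChange_map_fst {V W : Over X} (f : V ⟶ W) :
    (baseChange p).map f ≫ baseChangeFst p W = baseChangeFst p V ≫ f.left :=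
  pullback.lift_fst _ _ _

lemma baseChange_map_snd {V W : Over X} (f : V ⟶ W) :
    (baseChange p).map f ≫ baseChangeSnd p W = baseChangeSnd p V :=
  pullback.lift_snd _ _ _

lemma baseChange_map_fst_assoc {V W : Over X} (f : V ⟶ W) {Z : SSet.{u}} (h : W.left ⟶ Z) :
    (baseChange p).map f ≫ baseChangeFst p W ≫ h = baseChangeFst p V ≫ f.left ≫ h := by
  rw [← Category.assoc, baseChange_map_fst, Category.assoc]

lemma isPullback_baseChange_map {V W : Over X} (f : V ⟶ W) :
    IsPullback ((baseChange p).map f) (baseChangeFst p V) (baseChangeFst p W) f.left := by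
  have h := isPullback_baseChange p V
  rw [← Over.w f] at h
  refine IsPullback.of_right ?_ (baseChange_map_fst p f) (isPullback_baseChange p W).flip
  rw [baseChange_map_snd]
  exact h.flip

/-- A simplex of `V ×_X Y` lying over the simplex `t` of `V` comes from the base change of that
simplex, where it appears as a section. -/
lemma exists_section {V : Over X} {σ : Simplices X} (t : (simplexOver X).obj σ ⟶ V)
    (z : simplexFunctor.obj σ.left ⟶ (baseChange p).obj V) (h : z ≫ baseChangeFst p V = t.left) :
    ∃ s : simplexFunctor.obj σ.left ⟶ (baseChange p).obj ((simplexOver X).obj σ),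
      s ≫ baseChangeFst p _ = 𝟙 (simplexFunctor.obj σ.left) ∧ s ≫ (baseChange p).map t = z :=
  ⟨(isPullback_baseChange_map p t).lift z (𝟙 (simplexFunctor.obj σ.left))
    (h.trans (Category.id_comp t.left).symm), (isPullback_baseChange_map p t).lift_snd _ _ _,
    (isPullback_baseChange_map p t).lift_fst _ _ _⟩

/-- The map from the simplex of `X` given by a simplex of `V`. -/
abbrev simplexTo {V : Over X} {n : SimplexCategory} (v : simplexFunctor.obj n ⟶ V.left) :
    (simplexOver X).obj (CostructuredArrow.mk (v ≫ V.hom)) ⟶ V :=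
  Over.homMk v

/-- The value prescribed on a simplex of `V ×_X Y` does not depend on the section presenting it, and
is natural in it: two sections related by `α` already correspond under the map of simplices which
`α` defines. -/
lemma section_comp_eq {V : Over X} {S : SSet.{u}}
    (a : ∀ ⦃σ : Simplices X⦄, ((simplexOver X).obj σ ⟶ V) →
      ((baseChange p).obj ((simplexOver X).obj σ) ⟶ S))
    (ha : ∀ ⦃σ τ : Simplices X⦄ (φ : σ ⟶ τ) (t : (simplexOver X).obj τ ⟶ V),
      (baseChange p).map ((simplexOver X).map φ) ≫ a t = a ((simplexOver X).map φ ≫ t))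
    {σ τ : Simplices X} (t : (simplexOver X).obj σ ⟶ V) (r : (simplexOver X).obj τ ⟶ V)
    (α : τ.left ⟶ σ.left)
    (s : simplexFunctor.obj σ.left ⟶ (baseChange p).obj ((simplexOver X).obj σ))
    (hs : s ≫ baseChangeFst p _ = 𝟙 (simplexFunctor.obj σ.left))
    (q : simplexFunctor.obj τ.left ⟶ (baseChange p).obj ((simplexOver X).obj τ))
    (hq : q ≫ baseChangeFst p _ = 𝟙 (simplexFunctor.obj τ.left))
    (h : q ≫ (baseChange p).map r = simplexFunctor.map α ≫ s ≫ (baseChange p).map t) :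
    q ≫ a r = simplexFunctor.map α ≫ s ≫ a t := by
  have h₀ {ρ : Simplices X} (t : (simplexOver X).obj ρ ⟶ V)
      (s : simplexFunctor.obj ρ.left ⟶ (baseChange p).obj ((simplexOver X).obj ρ))
      (hs : s ≫ baseChangeFst p _ = 𝟙 (simplexFunctor.obj ρ.left)) :
      (s ≫ (baseChange p).map t) ≫ baseChangeFst p V = t.left := by
    rw [Category.assoc, baseChange_map_fst]
    exact (Category.assoc _ _ _).symm.trans ((congrArg (· ≫ t.left) hs).trans (Category.id_comp _))
  have h₁ : simplexFunctor.map α ≫ t.left = r.left := by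
    rw [← h₀ t s hs, ← h₀ r q hq, h]
    exact (Category.assoc _ _ _).symm
  let φ : τ ⟶ σ := CostructuredArrow.homMk α (by
    refine Eq.trans ?_ (Over.w r)
    rw [← h₁]
    refine Eq.trans ?_ (Category.assoc _ _ _).symm
    exact congrArg (simplexFunctor.map α ≫ ·) (Over.w t).symm)
  have h₂ : (simplexOver X).map φ ≫ t = r := by
    ext : 1
    exact h₁
  have h₃ : q ≫ (baseChange p).map ((simplexOver X).map φ) = simplexFunctor.map α ≫ s := by
    refine (isPullback_baseChange_map p t).hom_ext ?_ ?_
    · rw [Category.assoc, ← Functor.map_comp, h₂, h, Category.assoc]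
    · refine (Category.assoc _ _ _).trans ?_
      refine (congrArg (q ≫ ·) (baseChange_map_fst p _)).trans ?_
      refine (Category.assoc _ _ _).symm.trans ?_
      refine (congrArg (· ≫ simplexFunctor.map α) hq).trans ?_
      refine (Category.id_comp _).trans ?_
      refine Eq.trans ?_ (Category.assoc _ _ _).symm
      exact ((congrArg (simplexFunctor.map α ≫ ·) hs).trans (Category.comp_id _)).symm
  rw [← h₂, ← ha, ← Category.assoc, h₃, Category.assoc]

/-- Colimits are universal: a simplex of `V ×_X Y` factors through the base change of its image in
`V`, so a compatible family on the simplices of `V` glues uniquely. -/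
instance : (baseChange p).IsLeftAdjoint := by
  refine isLeftAdjoint_of_dense _ fun V S a ha => ?_
  choose s hs₁ hs₂ using fun n (z : simplexFunctor.obj n ⟶ (baseChange p).obj V) =>
    exists_section p (simplexTo (z ≫ baseChangeFst p V)) z rfl
  refine ⟨homOfSimplices (fun n z => s n z ≫ a (simplexTo (z ≫ baseChangeFst p V)))
    fun m n α z => ?_, fun σ t => hom_ext_simplices fun n z => ?_,
    fun g hg => hom_ext_simplices fun n z => ?_⟩
  · refine section_comp_eq p a ha _ _ α _ (hs₁ n z) _ (hs₁ m _) ?_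
    rw [hs₂, hs₂]
  · rw [← Category.assoc, comp_homOfSimplices]
    obtain ⟨α, hα⟩ := simplexFunctor.map_surjective (show simplexFunctor.obj n ⟶
      simplexFunctor.obj σ.left from z ≫ baseChangeFst p _)
    let φ : CostructuredArrow.mk (simplexFunctor.map α ≫ σ.hom) ⟶ σ := CostructuredArrow.homMk α
    obtain ⟨q, hq₁, hq₂⟩ := exists_section p ((simplexOver X).map φ) z hα.symm
    refine (section_comp_eq p a ha ((simplexOver X).map φ ≫ t) _ (𝟙 n) q hq₁ _ (hs₁ n _)
      ?_).trans ?_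
    · rw [hs₂, Functor.map_comp]
      exact ((total.simplexFunctor_map_id_comp _).trans ((Category.assoc _ _ _).symm.trans
        (congrArg (· ≫ (baseChange p).map t) hq₂))).symm
    · refine (total.simplexFunctor_map_id_comp _).trans ?_
      rw [← ha, ← Category.assoc]
      exact congrArg (· ≫ a t) hq₂
  · rw [comp_homOfSimplices, ← hg, ← Category.assoc, hs₂]

end BaseChange

/-! ### Transporting left lifting properties along left adjoints -/

section Saturation

variable {X : SSet.{u}}

lemma hasLiftingProperty_of_left {V W S T : Over X} {f : V ⟶ W} {q : S ⟶ T}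
    (h : HasLiftingProperty f.left q.left) : HasLiftingProperty f q := by
  refine ⟨fun {a b} sq => ?_⟩
  have sq' : CommSq a.left f.left q.left b.left := ⟨congrArg CommaMorphism.left sq.w⟩
  refine ⟨⟨⟨Over.homMk sq'.lift ?_, ?_, ?_⟩⟩⟩
  · rw [← Over.w q, sq'.fac_right_assoc, Over.w]
  · ext : 1
    exact sq'.fac_left
  · ext : 1
    exact sq'.fac_right

/-- A lifting problem of simplicial sets lives over `X` through its bottom map. That structure map
is arbitrary, hence the quantification over `x`. -/
lemma rlp_left {K : MorphismProperty SSet.{u}} {S T : Over X} {q : S ⟶ T}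
    (h : ∀ ⦃A B : SSet.{u}⦄ (i : A ⟶ B) (_ : K i) (x : B ⟶ X),
      HasLiftingProperty (Over.homMk i : Over.mk (i ≫ x) ⟶ Over.mk x) q) : K.rlp q.left := by
  intro A B i hi
  refine ⟨fun {a b} sq => ?_⟩
  have := h i hi (b ≫ T.hom)
  have sq' : CommSq (Over.homMk a (by
      change _ = i ≫ b ≫ T.hom
      rw [← sq.w_assoc, Over.w]) : Over.mk (i ≫ b ≫ T.hom) ⟶ S)
      (Over.homMk i : Over.mk (i ≫ b ≫ T.hom) ⟶ Over.mk (b ≫ T.hom)) q (Over.homMk b) :=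
    ⟨by ext : 1; exact sq.w⟩
  exact ⟨⟨⟨sq'.lift.left, congrArg CommaMorphism.left sq'.fac_left,
    congrArg CommaMorphism.left sq'.fac_right⟩⟩⟩

/-- By adjunction the question is whether `f` lifts against the image of `q` under the right
adjoint, and this image lifts against all of `K.rlp.llp` once it does against `K`. -/
lemma llp_map_of_isLeftAdjoint (Φ : Over X ⥤ SSet.{u}) [Φ.IsLeftAdjoint]
    {K W : MorphismProperty SSet.{u}}
    (h : ∀ ⦃A B : SSet.{u}⦄ (i : A ⟶ B) (_ : K i) (x : B ⟶ X),
      W.llp (Φ.map (Over.homMk i : Over.mk (i ≫ x) ⟶ Over.mk x)))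
    {V V' : Over X} (f : V ⟶ V') (hf : K.rlp.llp f.left) : W.llp (Φ.map f) := by
  intro S T q hq
  rw [(Adjunction.ofIsLeftAdjoint Φ).hasLiftingProperty_iff]
  refine hasLiftingProperty_of_left (hf _ (rlp_left fun A B i hi x => ?_))
  rw [← (Adjunction.ofIsLeftAdjoint Φ).hasLiftingProperty_iff]
  exact h i hi x _ hq

lemma anod.rlp_llp {A B : SSet.{u}} {i : A ⟶ B} (hi : ModFib.anod i) :
    SSet.modelCategoryQuillen.J.rlp.llp i := by
  rwa [← anodyneExtensions_eq_llp_rlp]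

end Saturation

/-! ### Pulling anodyne extensions back along fibrations -/

section Anodyne

lemma isConed_vertex {n : ℕ} (b : Δ[0] ⟶ Δ[n]) : IsConed.{u} b := by
  obtain ⟨v, rfl⟩ := yonedaEquiv.symm.surjective b
  obtain ⟨k, rfl⟩ := SSet.stdSimplex.obj₀Equiv.symm.surjective v
  rw [yonedaEquiv_symm_zero]
  exact isConed_stdSimplex k

/-- Both total spaces contain the fibre over `b` as an anodyne subobject, so two out of three
applies. -/
lemma sWeq_of_isPullback_of_isConed {A B D E : SSet.{u}} {i : A ⟶ B} {b : Δ[0] ⟶ A}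
    (hb : IsConed b) (hb' : IsConed (b ≫ i)) {d : D ⟶ A} {e : E ⟶ B} {l : D ⟶ E}
    (pb : IsPullback l d e i) (he : kfib e) : sWeq l := by
  have hd : kfib d := MorphismProperty.of_isPullback (P := kfib) pb he
  have h₁ := hb.anod_fiber (IsPullback.of_hasPullback d b) hd
  have h₂ := hb'.anod_fiber ((IsPullback.of_hasPullback d b).paste_horiz pb) he
  exact sWeq.of_precomp _ _ (anod.sWeq h₁) (anod.sWeq h₂)

variable {X Y : SSet.{u}} {p : Y ⟶ X}

lemma sWeq_baseChange_horn (hp : kfib p) {n : ℕ} (k : Fin (n + 2)) (x : Δ[n + 1] ⟶ X) :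
    sWeq ((baseChange p).map
      (Over.homMk Λ[n + 1, k].ι : Over.mk (Λ[n + 1, k].ι ≫ x) ⟶ Over.mk x)) := by
  obtain ⟨b, hb⟩ := isConed_horn.{u} k
  exact sWeq_of_isPullback_of_isConed hb (isConed_vertex _) (isPullback_baseChange_map p _)
    (MorphismProperty.of_isPullback (P := kfib) (isPullback_baseChange p (Over.mk x)).flip hp)

/-- Base change is a left adjoint, so horns suffice. A horn and its simplex are both coned at the
same vertex. -/
lemma sWeq_baseChange_of_anod (hp : kfib p) {V W : Over X} (f : V ⟶ W)
    (hf : ModFib.anod f.left) : sWeq ((baseChange p).map f) := by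
  refine sWeq_of_llp_kanFib (llp_map_of_isLeftAdjoint (K := SSet.modelCategoryQuillen.J)
    _ (fun A B i hi x => ?_) f hf.rlp_llp)
  simp only [modelCategoryQuillen.J, MorphismProperty.iSup_iff] at hi
  obtain ⟨n, ⟨k⟩⟩ := hi
  have : Mono ((baseChange p).map
      (Over.homMk Λ[n + 1, k].ι : Over.mk (Λ[n + 1, k].ι ≫ x) ⟶ Over.mk x)) :=
    mono_fst_of_isPullback (isPullback_baseChange_map p _)
  exact llp_kanFib_of_mono_sWeq (sWeq_baseChange_horn hp k x)

lemma sWeq_of_isPullback_of_anod {A B D E : SSet.{u}} {i : A ⟶ B} {d : D ⟶ A} {e : E ⟶ B}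
    {l : D ⟶ E} (pb : IsPullback l d e i) (he : kfib e) (hi : ModFib.anod i) : sWeq l := by
  have h := sWeq_baseChange_of_anod he (Over.homMk i : Over.mk i ⟶ Over.mk (𝟙 B)) hi
  have h₁ := isPullback_baseChange e (Over.mk i)
  have h₂ := isPullback_baseChange e (Over.mk (𝟙 B))
  have : IsIso (Over.mk (𝟙 B)).hom := inferInstanceAs (IsIso (𝟙 B))
  have : IsIso (baseChangeSnd e (Over.mk (𝟙 B))) := h₂.isIso_snd_of_isIso
  have e₁ : l = (h₁.isoIsPullback _ _ pb.flip).inv ≫ (baseChange e).map (Over.homMk i :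
      Over.mk i ⟶ Over.mk (𝟙 B)) ≫ baseChangeSnd e _ := by
    rw [baseChange_map_snd, IsPullback.isoIsPullback_inv_snd]
  rw [e₁]
  exact sWeq.comp_mem _ _ (sWeq_of_isIso _) (sWeq.comp_mem _ _ h (sWeq_of_isIso _))

end Anodyne

/-! ### Descent -/

lemma isPullback_of_app {A B D E : SSet.{u}} {t : A ⟶ B} {l : A ⟶ D} {r : B ⟶ E} {b : D ⟶ E}
    (w : t ≫ r = l ≫ b) (h₁ : ∀ n (x y : A.obj n), t.app n x = t.app n y →
      l.app n x = l.app n y → x = y)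
    (h₂ : ∀ n (x : B.obj n) (y : D.obj n), r.app n x = b.app n y →
      ∃ z, t.app n z = x ∧ l.app n z = y) : IsPullback t l r b where
  w := w
  isLimit' := ⟨evaluationJointlyReflectsLimits _ fun n => by
    refine (isLimitMapConePullbackConeEquiv _ _).2 (IsPullback.isLimit ?_)
    dsimp
    rw [Types.isPullback_iff]
    exact ⟨NatTrans.congr_app w n, fun x y h => h₁ n x y h.1 h.2, h₂ n⟩⟩

lemma isPullback_app {A B D E : SSet.{u}} {t : A ⟶ B} {l : A ⟶ D} {r : B ⟶ E} {b : D ⟶ E}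
    (h : IsPullback t l r b) (n : SimplexCategoryᵒᵖ) :
    IsPullback (t.app n) (l.app n) (r.app n) (b.app n) :=
  h.map ((CategoryTheory.evaluation _ _).obj n)

section Descent

universe w w'

variable {J : Type w} [Category.{w'} J]

variable (J) in
/-- A shape such that elements of a diagram of types with the same image in the colimit are
identified at a later stage. -/
def IsAmalgamated : Prop :=
  ∀ (F : J ⥤ Type u) (c : Cocone F) (_ : IsColimit c) (i j : J) (x : F.obj i) (y : F.obj j),
    c.ι.app i x = c.ι.app j y → ∃ (k : J) (f : i ⟶ k) (g : j ⟶ k), F.map f x = F.map g y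

lemma isAmalgamated_discrete (J : Type u) : IsAmalgamated.{u} (Discrete J) := by
  intro F c hc i j x y h
  let s : Cocone F :=
    { pt := Σ j, F.obj j
      ι := Discrete.natTrans fun j => ↾fun x => ⟨j, x⟩ }
  have hs (j) (x : F.obj j) : hc.desc s (c.ι.app j x) = (⟨j, x⟩ : Σ j, F.obj j) :=
    ConcreteCategory.congr_hom (hc.fac s j) x
  have h' : Sigma.mk (β := fun j => F.obj j) i x = ⟨j, y⟩ := by
    rw [← hs, h, hs]
  obtain rfl : i = j := congrArg Sigma.fst h'
  obtain rfl : x = y := by simpa using h'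
  exact ⟨i, 𝟙 _, 𝟙 _, rfl⟩

lemma isAmalgamated_nat : IsAmalgamated.{u} ℕ := by
  intro F c hc i j x y h
  rwa [Types.FilteredColimit.isColimit_eq_iff _ hc] at h

variable [HasColimitsOfShape J (Type u)] {E D : J ⥤ SSet.{u}} {α : E ⟶ D}
  {cE : Cocone E} {cD : Cocone D} {f : cE.pt ⟶ cD.pt}

/-- Descent for a cartesian transformation: two elements with the same image in the colimit meet at
some later stage, where the pullback squares of `hα` can be used. -/
lemma isPullback_of_isColimit [Quiver.IsThin J] (hJ : IsAmalgamated.{u} J)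
    (hα : ∀ ⦃i j : J⦄ (φ : i ⟶ j), IsPullback (E.map φ) (α.app i) (α.app j) (D.map φ))
    (hE : IsColimit cE) (hD : IsColimit cD) (hf : ∀ j, cE.ι.app j ≫ f = α.app j ≫ cD.ι.app j)
    (j : J) : IsPullback (cE.ι.app j) (α.app j) f (cD.ι.app j) := by
  have hE' (n) := isColimitOfPreserves ((CategoryTheory.evaluation _ _).obj n) hE
  have hD' (n) := isColimitOfPreserves ((CategoryTheory.evaluation _ _).obj n) hD
  have hw (n) {i j : J} (φ : i ⟶ j) (x : (E.obj i).obj n) :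
      (cE.ι.app j).app n ((E.map φ).app n x) = (cE.ι.app i).app n x :=
    app_congr (cE.w φ) x
  refine isPullback_of_app (hf j) (fun n x y h₁ h₂ => ?_) (fun n x y h => ?_)
  · obtain ⟨k, a, b, e⟩ := hJ _ _ (hE' n) j j x y h₁
    -- Both elements sit at the same stage `j`; thinness of `J` makes the two maps along which they
    -- are identified equal.
    obtain rfl := Subsingleton.elim a b
    exact Types.ext_of_isPullback (isPullback_app (hα a) n) e h₂
  · obtain ⟨k, z, rfl⟩ := Types.jointly_surjective_of_isColimit (hE' n) x
    obtain ⟨m, a, b, e⟩ := hJ _ _ (hD' n) k j ((α.app k).app n z) y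
      ((app_congr (hf k) z).symm.trans h)
    have e' : (α.app m).app n ((E.map a).app n z) = (D.map b).app n y :=
      (app_congr (α.naturality a) z).trans e
    obtain ⟨t, ht₁, ht₂⟩ := Types.exists_of_isPullback (isPullback_app (hα b) n) _ _ e'
    refine ⟨t, ?_, ht₂⟩
    exact (hw n b t).symm.trans ((congrArg _ ht₁).trans (hw n a z))

/-- A horn-filling problem sees the base through one simplex, so it can be solved in a pullback
through which that simplex factors. -/
lemma kfib_of_simplices {E B : SSet.{u}} {p : E ⟶ B}
    (h : ∀ ⦃n : ℕ⦄ (x : Δ[n] ⟶ B), ∃ (A D : SSet.{u}) (y : Δ[n] ⟶ A) (a : A ⟶ B) (d : D ⟶ A)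
      (l : D ⟶ E), y ≫ a = x ∧ IsPullback l d p a ∧ kfib d) : kfib p := by
  intro A' B' i hi
  simp only [modelCategoryQuillen.J, MorphismProperty.iSup_iff] at hi
  obtain ⟨n, ⟨k⟩⟩ := hi
  refine ⟨fun {f x} sq => ?_⟩
  obtain ⟨A, D, y, a, d, l, rfl, pb, hd⟩ := h x
  have := hd _ (SSet.modelCategoryQuillen.horn_ι_mem_J (n + 1) k)
  have sq' : CommSq (pb.lift f (Λ[n + 1, k].ι ≫ y) (by rw [sq.w, Category.assoc])) Λ[n + 1, k].ι d y :=
    ⟨pb.lift_snd _ _ _⟩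
  exact ⟨⟨⟨sq'.lift ≫ l, by rw [sq'.fac_left_assoc, pb.lift_fst],
    by rw [Category.assoc, pb.w, sq'.fac_right_assoc]⟩⟩⟩

lemma exists_fac_of_isColimit (hD : IsColimit cD) {n : ℕ} (x : Δ[n] ⟶ cD.pt) :
    ∃ (j : J) (y : Δ[n] ⟶ D.obj j), y ≫ cD.ι.app j = x := by
  obtain ⟨j, y, hy⟩ := Types.jointly_surjective_of_isColimit
    (isColimitOfPreserves ((CategoryTheory.evaluation _ _).obj (op ⦋n⦌)) hD) (yonedaEquiv x)
  refine ⟨j, yonedaEquiv.symm y, ?_⟩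
  rw [yonedaEquiv_symm_comp, Equiv.symm_apply_eq]
  exact hy

lemma kfib_of_isColimit (hD : IsColimit cD)
    (hf : ∀ j, IsPullback (cE.ι.app j) (α.app j) f (cD.ι.app j))
    (hα : ∀ j, kfib (α.app j)) : kfib f :=
  kfib_of_simplices fun n x => by
    obtain ⟨j, y, hy⟩ := exists_fac_of_isColimit hD x
    exact ⟨_, _, y, _, _, _, hy, hf j, hα j⟩

end Descent

/-! ### Extension of fibrations along anodyne extensions -/

/-- The maps along which every Kan fibration can be extended. -/
def extendsFib : MorphismProperty SSet.{u} := fun V W i =>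
  ∀ ⦃E : SSet.{u}⦄ (e : E ⟶ V), kfib e → ∃ (H : SSet.{u}) (h : H ⟶ W) (l : E ⟶ H),
    kfib h ∧ IsPullback l e h i

lemma isPullback_of_cover {E V H W : SSet.{u}} {l : E ⟶ H} {e : E ⟶ V} {h : H ⟶ W} {i : V ⟶ W}
    (w : l ≫ h = e ≫ i) (hc : ∀ n (v : V.obj n), ∃ (A D : SSet.{u}) (a : A ⟶ V) (y : A.obj n)
      (m : D ⟶ E) (d : D ⟶ A), a.app n y = v ∧ IsPullback m d e a ∧
        IsPullback (m ≫ l) d h (a ≫ i)) : IsPullback l e h i := by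
  refine isPullback_of_app w (fun n x x' h₁ h₂ => ?_) (fun n x v hx => ?_)
  · obtain ⟨A, D, a, y, m, d, hy, pb, pb'⟩ := hc n (e.app n x)
    obtain ⟨z, rfl, hz⟩ := Types.exists_of_isPullback (isPullback_app pb n) _ _ hy.symm
    obtain ⟨z', rfl, hz'⟩ := Types.exists_of_isPullback (isPullback_app pb n) _ _
      (h₂.symm.trans hy.symm)
    exact congrArg _ (Types.ext_of_isPullback (isPullback_app pb' n) h₁ (hz.trans hz'.symm))
  · obtain ⟨A, D, a, y, m, d, rfl, pb, pb'⟩ := hc n v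
    obtain ⟨z, hz, hz'⟩ := Types.exists_of_isPullback (isPullback_app pb' n) x y hx
    exact ⟨m.app n z, hz, (app_congr pb.w z).trans (congrArg _ hz')⟩

/-- The restriction of the fibration to each summand is extended separately; the coproduct of the
extensions is again a fibration by descent. -/
lemma extendsFib.of_coproducts {V W : SSet.{u}} {i : V ⟶ W}
    (hi : MorphismProperty.coproducts.{u} extendsFib i) : extendsFib i := by
  rw [MorphismProperty.coproducts_iff] at hi
  obtain ⟨J, ⟨X₁, X₂, c₁, c₂, h₁, h₂, f, hf⟩⟩ := hi
  intro E e he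
  have pb (j) := isPullback_baseChange e (Over.mk (c₁.ι.app j))
  choose H h l hh pb' using fun j => hf j (baseChangeFst e (Over.mk (c₁.ι.app j)))
    (MorphismProperty.of_isPullback (P := kfib) (pb j).flip he)
  let H' : Discrete J ⥤ SSet.{u} := Discrete.functor fun j => H ⟨j⟩
  let α : H' ⟶ X₂ := Discrete.natTrans fun j => h j
  have hα ⦃i j : Discrete J⦄ (φ : i ⟶ j) :
      IsPullback (H'.map φ) (α.app i) (α.app j) (X₂.map φ) :=
    IsPullback.of_horiz_isIso ⟨α.naturality φ⟩
  let h' : colimit H' ⟶ c₂.pt := (colimit.isColimit H').desc ⟨_, α ≫ c₂.ι⟩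
  have hh' (j) : colimit.ι H' j ≫ h' = h j ≫ c₂.ι.app j :=
    (colimit.isColimit H').fac ⟨_, α ≫ c₂.ι⟩ j
  have pb₂ (j) : IsPullback (colimit.ι H' j) (h j) h' (c₂.ι.app j) :=
    isPullback_of_isColimit (isAmalgamated_discrete J) hα (colimit.isColimit H') h₂ hh' j
  -- Base change along `e` preserves colimits, so `E` is the coproduct of its restrictions and maps
  -- out of it can be glued.
  have hcE := isColimitOfPreserves (baseChange e) (Over.isColimitToOver h₁)
  let E₁ := (baseChange e).obj (Over.mk (𝟙 c₁.pt))
  let q : E₁ ⟶ E := baseChangeSnd e (Over.mk (𝟙 c₁.pt))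
  have : IsIso (Over.mk (𝟙 c₁.pt)).hom := inferInstanceAs (IsIso (𝟙 c₁.pt))
  have : IsIso q := (isPullback_baseChange e (Over.mk (𝟙 c₁.pt))).isIso_snd_of_isIso
  let t (j) : (baseChange e).obj (Over.mk (c₁.ι.app j)) ⟶ E₁ :=
    (baseChange e).map (c₁.toOver.ι.app j)
  have ht (j) : t j ≫ q = baseChangeSnd e (Over.mk (c₁.ι.app j)) := baseChange_map_snd e _
  obtain ⟨l', hl'⟩ : ∃ l' : E₁ ⟶ colimit H', ∀ j, t j ≫ l' = l j ≫ colimit.ι H' j :=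
    ⟨hcE.desc ⟨_, Discrete.natTrans fun j => l j ≫ colimit.ι H' j⟩,
      hcE.fac ⟨_, Discrete.natTrans fun j => l j ≫ colimit.ι H' j⟩⟩
  have hE₁ {Z : SSet.{u}} {a b : E₁ ⟶ Z} (h : ∀ j, t j ≫ a = t j ≫ b) : a = b := hcE.hom_ext h
  have hφ (j) : c₁.ι.app j ≫ h₁.desc ⟨_, f ≫ c₂.ι⟩ = f.app j ≫ c₂.ι.app j :=
    h₁.fac ⟨_, f ≫ c₂.ι⟩ j
  have hm (j) : baseChangeSnd e (Over.mk (c₁.ι.app j)) ≫ inv q ≫ l' = l j ≫ colimit.ι H' j := by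
    rw [← hl', ← ht, Category.assoc, IsIso.hom_inv_id_assoc]
  refine ⟨colimit H', h', inv q ≫ l',
    kfib_of_isColimit (cE := colimit.cocone H') (α := α) h₂ pb₂ (fun j => hh j),
    isPullback_of_cover ?_ fun n v => ?_⟩
  · rw [← cancel_epi q]
    refine hE₁ fun j => ?_
    rw [Category.assoc, IsIso.hom_inv_id_assoc, reassoc_of% hl', reassoc_of% ht, hh',
      ← Category.assoc, (pb' j).w, Category.assoc, ← hφ, ← Category.assoc, ← Category.assoc]
    exact congrArg (· ≫ _) (pb j).w
  · obtain ⟨j, y, hy⟩ := Types.jointly_surjective_of_isColimit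
      (isColimitOfPreserves ((CategoryTheory.evaluation _ _).obj n) h₁) v
    refine ⟨_, _, c₁.ι.app j, y, _, _, hy, (pb j).flip, ?_⟩
    have := (pb' j).paste_horiz (pb₂ j)
    rwa [← hφ, ← hm] at this

/-- Extend the pullback of `e` along `g`, then glue the result to `E`. A pushout along a
monomorphism is van Kampen, so the glued map restricts to the given pieces. -/
lemma extendsFib.of_isPushout {V W V' W' : SSet.{u}} {i : V ⟶ V'} {g : V ⟶ W} {g' : V' ⟶ W'}
    {i' : W ⟶ W'} [Mono i] (sq : IsPushout i g g' i') (hi : extendsFib i) : extendsFib i' := by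
  intro E e he
  have pb' : IsPullback (pullback.fst e g) (pullback.snd e g) e g := IsPullback.of_hasPullback e g
  obtain ⟨H, h, l, hh, pb⟩ := hi (pullback.snd e g)
    (MorphismProperty.of_isPullback (P := kfib) pb' he)
  have po := IsPushout.of_hasPushout l (pullback.fst e g)
  have w : l ≫ h ≫ g' = pullback.fst e g ≫ e ≫ i' := by
    rw [← Category.assoc, pb.w, Category.assoc, sq.w, ← Category.assoc, ← pb'.w, Category.assoc]
  obtain ⟨h₁, h₂⟩ := (Adhesive.van_kampen sq _ _ _ _ _ h e (po.desc (h ≫ g') (e ≫ i') w)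
    pb pb' ⟨by simp⟩ ⟨by simp⟩ po.toCommSq).1 po
  refine ⟨_, _, _, kfib_of_simplices fun n x => ?_, h₂⟩
  obtain ⟨j, y, hy⟩ := exists_fac_of_isColimit sq.isColimit x
  match j with
  | .zero => exact ⟨_, _, y ≫ i, _, _, _, (Category.assoc _ _ _).trans hy, h₁, hh⟩
  | .left => exact ⟨_, _, y, _, _, _, hy, h₁, hh⟩
  | .right => exact ⟨_, _, y, _, _, _, hy, h₂, he⟩

lemma extendsFib.of_retract {V W V' W' : SSet.{u}} {i : V ⟶ W} {i' : V' ⟶ W'}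
    (r : RetractArrow i i') (hi : extendsFib i') : extendsFib i := by
  intro E e he
  have pb₁ : IsPullback (pullback.fst e r.r.left) (pullback.snd e r.r.left) e r.r.left :=
    IsPullback.of_hasPullback _ _
  obtain ⟨H, h, l, hh, pb⟩ := hi _ (MorphismProperty.of_isPullback (P := kfib) pb₁ he)
  have pb₂ : IsPullback (pullback.fst h r.i.right) (pullback.snd h r.i.right) h r.i.right :=
    IsPullback.of_hasPullback _ _
  have w₁ : r.i.left ≫ r.r.left = 𝟙 V := r.retract_left
  have pb₃ : IsPullback (pb₁.lift (𝟙 E) (e ≫ r.i.left) (by simp [w₁])) e (pullback.snd e r.r.left)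
      r.i.left := by
    refine IsPullback.of_right ?_ (pb₁.lift_snd _ _ _) pb₁
    rw [pb₁.lift_fst, w₁]
    exact IsPullback.of_id_fst
  have pb₄ := pb₃.paste_horiz pb
  have w₂ : r.i.left ≫ i' = i ≫ r.i.right := r.i_w
  rw [w₂] at pb₄
  refine ⟨_, pullback.snd h r.i.right, pb₂.lift _ (e ≫ i) (by rw [pb₄.w, Category.assoc]),
    MorphismProperty.of_isPullback (P := kfib) pb₂ hh, IsPullback.of_right ?_ (pb₂.lift_snd _ _ _) pb₂⟩
  rw [pb₂.lift_fst]
  exact pb₄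

/-- A Kan fibration with given base. -/
structure FibOver (B : SSet.{u}) where
  /-- the total space -/
  E : SSet.{u}
  /-- the projection -/
  p : E ⟶ B
  kfib : kfib p

/-- The extensions chosen successively form a sequence with cartesian transition squares, so its
colimit restricts to each stage. -/
lemma extendsFib.of_transfiniteComposition {V W : SSet.{u}} {i : V ⟶ W}
    (hi : extendsFib.TransfiniteCompositionOfShape ℕ i) : extendsFib i := by
  intro E e he
  have hF (n : ℕ) (s : FibOver (hi.F.obj n)) : ∃ (t : FibOver (hi.F.obj (n + 1))) (l : s.E ⟶ t.E),
      IsPullback l s.p t.p (hi.F.map (homOfLE (Nat.le_add_right n 1))) := by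
    obtain ⟨H, h, l, hh, pb⟩ := hi.map_mem n (not_isMax n) s.p s.kfib
    exact ⟨⟨H, h, hh⟩, l, pb⟩
  choose T L hL using hF
  let S (n : ℕ) : FibOver (hi.F.obj n) :=
    Nat.rec ⟨E, e ≫ hi.isoBot.inv, kfib.comp_mem _ _ he (MorphismProperty.of_isIso _ _)⟩ (fun n s => T n s) n
  let G : ℕ ⥤ SSet.{u} := Functor.ofSequence (X := fun n => (S n).E) fun n => L n (S n)
  have hG (n : ℕ) : G.map (homOfLE (Nat.le_add_right n 1)) = L n (S n) :=
    Functor.ofSequence_map_homOfLE_succ _ n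
  let α : G ⟶ hi.F := NatTrans.ofSequence (fun n => (S n).p) fun n => by
    rw [hG]
    exact (hL n (S n)).w
  have hα ⦃m n : ℕ⦄ (φ : m ⟶ n) : IsPullback (G.map φ) (α.app m) (α.app n) (hi.F.map φ) := by
    obtain ⟨k, rfl⟩ := Nat.exists_eq_add_of_le (leOfHom φ)
    induction k with
    | zero =>
      obtain rfl : φ = 𝟙 m := Subsingleton.elim _ _
      exact IsPullback.of_horiz_isIso ⟨α.naturality _⟩
    | succ k ih =>
      obtain rfl : φ = homOfLE (Nat.le_add_right m k) ≫ homOfLE (Nat.le_add_right (m + k) 1) :=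
        Subsingleton.elim _ _
      rw [Functor.map_comp, Functor.map_comp]
      refine (ih _).paste_horiz ?_
      rw [hG]
      exact hL _ _
  let h' : colimit G ⟶ W := (colimit.isColimit G).desc ⟨_, α ≫ hi.incl⟩
  have hh' (j) : colimit.ι G j ≫ h' = α.app j ≫ hi.incl.app j :=
    (colimit.isColimit G).fac ⟨_, α ≫ hi.incl⟩ j
  have pb (j) : IsPullback (colimit.ι G j) (α.app j) h' (hi.incl.app j) :=
    isPullback_of_isColimit isAmalgamated_nat hα (colimit.isColimit G) hi.isColimit hh' j
  refine ⟨_, h', colimit.ι G 0, kfib_of_isColimit (cE := colimit.cocone G) (α := α) hi.isColimit pb fun n => (S n).kfib, ?_⟩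
  rw [← hi.fac]
  have : IsPullback (𝟙 E) e (e ≫ hi.isoBot.inv) hi.isoBot.inv := IsPullback.of_horiz_isIso ⟨by simp⟩
  exact (congrArg (fun m => IsPullback m e h' (hi.isoBot.inv ≫ hi.incl.app 0))
    (Category.id_comp (X := E) _)).mp (this.paste_horiz (pb 0))

/-- Anodyne extensions are retracts of countable compositions of pushouts of coproducts of horn
inclusions, and extendability passes through each of these operations. -/
lemma extendsFib_of_anod {V W : SSet.{u}} {i : V ⟶ W} (hi : ModFib.anod i) : extendsFib i := by
  obtain ⟨V', W', i', r, ⟨h⟩⟩ :=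
    anodyneExtensions_eq_retracts_transfiniteCompositionsOfShape.le _ hi
  refine extendsFib.of_retract r (.of_transfiniteComposition (h.ofLE ?_))
  rintro A B f ⟨A', B', g, _, _, hg, sq⟩
  have : Mono g := anod.mono (anodyneExtensions_eq_llp_rlp.ge _
    (MorphismProperty.coproducts_le_llp_rlp _ _ hg))
  refine .of_isPushout sq.flip (.of_coproducts (MorphismProperty.coproducts_monotone ?_ _ hg))
  intro A B j hj E e he
  simp only [modelCategoryQuillen.J, MorphismProperty.iSup_iff] at hj
  obtain ⟨n, ⟨k⟩⟩ := hj
  exact exists_extension_horn k he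


/-! ### Trivial fibrations, anodyne extensions and weak equivalences -/

/-- Extend `p` to a fibration over a Kan complex `B'` containing `B` by an anodyne extension. The
inclusion of total spaces is a weak equivalence, so the extended fibration is one too; it is trivial
by the Kan case, and `p` is a pullback of it. -/
lemma tfib_of_kfib_of_sWeq {E B : SSet.{u}} {p : E ⟶ B} (hp : kfib p) (h : sWeq p) : tfib p := by
  obtain ⟨B', b, t, hb, ht, -⟩ := exists_anod_kfib_factorization (terminal.from B)
  have : KanComplex B' := kan_of_kfib terminalIsTerminal ht
  obtain ⟨E', p', l, hp', pb⟩ := extendsFib_of_anod hb p hp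
  have : KanComplex E' := kan_of_kfib terminalIsTerminal (kfib.comp_mem _ _ hp' ht)
  have hl := sWeq_of_isPullback_of_anod pb hp' hb
  have h' : sWeq p' := by
    refine sWeq.of_precomp l p' hl ?_
    rw [pb.w]
    exact sWeq.comp_mem _ _ h (anod.sWeq hb)
  exact MorphismProperty.of_isPullback (P := tfib) pb (tfib_of_sWeq_of_kan hp' h')

lemma exists_anod_tfib_factorization {A B : SSet.{u}} {f : A ⟶ B} (hf : sWeq f) :
    ∃ (Z : SSet.{u}) (i : A ⟶ Z) (p : Z ⟶ B), ModFib.anod i ∧ tfib p ∧ i ≫ p = f := by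
  obtain ⟨Z, j, q, hj, hq, rfl⟩ := exists_anod_kfib_factorization f
  exact ⟨Z, j, q, hj, tfib_of_kfib_of_sWeq hq (sWeq.of_precomp j q (anod.sWeq hj) hf), rfl⟩

/-- Right properness: a weak equivalence is an anodyne extension followed by a trivial fibration,
and both behave well under pullback along a fibration. -/
lemma sWeq_of_isPullback {A B D E : SSet.{u}} {i : A ⟶ B} {d : D ⟶ A} {e : E ⟶ B}
    {l : D ⟶ E} (pb : IsPullback l d e i) (he : kfib e) (hi : sWeq i) : sWeq l := by
  obtain ⟨Z, j, q, hj, hq, rfl⟩ := exists_anod_tfib_factorization hi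
  have pb' := IsPullback.of_hasPullback e q
  have pb'' : IsPullback (pb'.lift l (d ≫ j) (by rw [pb.w, Category.assoc])) d (pullback.snd e q) j := by
    refine IsPullback.of_right ?_ (pb'.lift_snd _ _ _) pb'
    rwa [pb'.lift_fst]
  rw [← pb'.lift_fst l (d ≫ j) (by rw [pb.w, Category.assoc])]
  exact sWeq.comp_mem _ _ (sWeq_of_isPullback_of_anod pb''
    (MorphismProperty.of_isPullback (P := kfib) pb' he) hj)
    (MorphismProperty.of_isPullback (P := tfib) pb'.flip hq).sWeq

/-- Factor the graph `E → E ×_X E'` as an anodyne extension followed by a fibration. Both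
projections become fibrations, and are weak equivalences by two out of three. -/
lemma exists_tfib_span_of_sWeq {X E E' : SSet.{u}} {p : E ⟶ X} {p' : E' ⟶ X}
    (hp : kfib p) (hp' : kfib p') {f : E ⟶ E'} (hf : sWeq f) (w : f ≫ p' = p) :
    ∃ (Z : SSet.{u}) (s : E ⟶ Z) (a : Z ⟶ E) (b : Z ⟶ E'), tfib a ∧ tfib b ∧ s ≫ a = 𝟙 E ∧
      s ≫ b = f ∧ a ≫ p = b ≫ p' := by
  obtain ⟨Z, s, q, hs, hq, e⟩ := exists_anod_kfib_factorization
    (pullback.lift (𝟙 E) f (by simp [w]) : E ⟶ pullback p p')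
  have h₁ : s ≫ q ≫ pullback.fst p p' = 𝟙 E := by rw [reassoc_of% e, pullback.lift_fst]
  have h₂ : s ≫ q ≫ pullback.snd p p' = f := by rw [reassoc_of% e, pullback.lift_snd]
  have pb := IsPullback.of_hasPullback p p'
  refine ⟨Z, s, q ≫ pullback.fst p p', q ≫ pullback.snd p p', ?_, ?_, h₁, h₂, by
    simp [pullback.condition]⟩
  · exact tfib_of_kfib_of_sWeq (kfib.comp_mem _ _ hq
      (MorphismProperty.of_isPullback (P := kfib) pb.flip hp'))
      (sWeq.of_precomp _ _ (anod.sWeq hs) (by rw [h₁]; exact sWeq.id_mem E))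
  · exact tfib_of_kfib_of_sWeq (kfib.comp_mem _ _ hq
      (MorphismProperty.of_isPullback (P := kfib) pb hp))
      (sWeq.of_precomp _ _ (anod.sWeq hs) (by rwa [h₂]))

/-- Trivial fibrations are stable under pullback, so the span of trivial fibrations presenting `f`
pulls back to one presenting `f'`. -/
lemma sWeq_of_isPullback_of_kfib {X Y E E' F F' : SSet.{u}} {p : E ⟶ X} {p' : E' ⟶ X}
    (hp : kfib p) (hp' : kfib p') {f : E ⟶ E'} (hf : sWeq f) (w : f ≫ p' = p) {g : Y ⟶ X}
    {a : F ⟶ E} {b : F ⟶ Y} (pb : IsPullback a b p g) {a' : F' ⟶ E'} {b' : F' ⟶ Y}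
    (pb' : IsPullback a' b' p' g) {f' : F ⟶ F'} (h₁ : f' ≫ a' = a ≫ f) (h₂ : f' ≫ b' = b) :
    sWeq f' := by
  obtain ⟨Z, s, c, d, hc, hd, hsc, hsd, e⟩ := exists_tfib_span_of_sWeq hp hp' hf w
  have pbZ := IsPullback.of_hasPullback (c ≫ p) g
  have pb₁ : IsPullback (pullback.fst (c ≫ p) g)
      (pb.lift (pullback.fst (c ≫ p) g ≫ c) (pullback.snd (c ≫ p) g)
        (by rw [Category.assoc, pbZ.w])) c a := by
    refine (IsPullback.of_right ?_ ?_ pb.flip).flip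
    · rw [pb.lift_snd]
      exact pbZ.flip
    · rw [pb.lift_fst]
  have pb₂ : IsPullback (pullback.fst (c ≫ p) g)
      (pb'.lift (pullback.fst (c ≫ p) g ≫ d) (pullback.snd (c ≫ p) g)
        (by rw [Category.assoc, ← e, pbZ.w])) d a' := by
    refine (IsPullback.of_right ?_ ?_ pb'.flip).flip
    · rw [pb'.lift_snd, ← e]
      exact pbZ.flip
    · rw [pb'.lift_fst]
  let t := pbZ.lift (a ≫ s) b (by rw [Category.assoc, reassoc_of% hsc, pb.w])
  have h₃ := (MorphismProperty.of_isPullback (P := tfib) pb₁ hc).sWeq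
  have h₄ := (MorphismProperty.of_isPullback (P := tfib) pb₂ hd).sWeq
  have h₅ : sWeq t := by
    refine sWeq.of_postcomp t _ h₃ ?_
    have : t ≫ pb.lift (pullback.fst (c ≫ p) g ≫ c) (pullback.snd (c ≫ p) g)
        (by rw [Category.assoc, pbZ.w]) = 𝟙 F := by
      refine pb.hom_ext ?_ ?_
      · rw [Category.assoc, pb.lift_fst, pbZ.lift_fst_assoc, Category.assoc, hsc, Category.comp_id,
          Category.id_comp]
      · rw [Category.assoc, pb.lift_snd, pbZ.lift_snd, Category.id_comp]
    rw [this]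
    exact sWeq.id_mem F
  have h₆ : t ≫ pb'.lift (pullback.fst (c ≫ p) g ≫ d) (pullback.snd (c ≫ p) g)
      (by rw [Category.assoc, ← e, pbZ.w]) = f' := by
    refine pb'.hom_ext ?_ ?_
    · rw [Category.assoc, pb'.lift_fst, pbZ.lift_fst_assoc, Category.assoc, hsd, h₁]
    · rw [Category.assoc, pb'.lift_snd, pbZ.lift_snd, h₂]
  rw [← h₆]
  exact sWeq.comp_mem _ _ h₅ h₄

/-! ### Functors determined by their values on simplices -/

section Dense

variable {X : SSet.{u}}

/-- A functor on simplicial sets over `X` is the left Kan extension of its restriction to the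
simplices of `X`. -/
def Dense (Φ : Over X ⥤ SSet.{u}) : Prop :=
  ∀ (V : Over X) (S : SSet.{u})
    (a : ∀ ⦃σ : Simplices X⦄, ((simplexOver X).obj σ ⟶ V) → (Φ.obj ((simplexOver X).obj σ) ⟶ S)),
    (∀ ⦃σ τ : Simplices X⦄ (φ : σ ⟶ τ) (t : (simplexOver X).obj τ ⟶ V),
      Φ.map ((simplexOver X).map φ) ≫ a t = a ((simplexOver X).map φ ≫ t)) →
    ∃! g : Φ.obj V ⟶ S, ∀ ⦃σ : Simplices X⦄ (t : (simplexOver X).obj σ ⟶ V), Φ.map t ≫ g = a t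

lemma Dense.isLeftAdjoint {Φ : Over X ⥤ SSet.{u}} (h : Dense Φ) : Φ.IsLeftAdjoint :=
  isLeftAdjoint_of_dense Φ h

lemma Dense.hom_ext {Φ : Over X ⥤ SSet.{u}} (h : Dense Φ) {V : Over X} {S : SSet.{u}}
    {f g : Φ.obj V ⟶ S}
    (w : ∀ ⦃σ : Simplices X⦄ (t : (simplexOver X).obj σ ⟶ V), Φ.map t ≫ f = Φ.map t ≫ g) :
    f = g := by
  obtain ⟨k, -, hk⟩ := h V S (fun σ t => Φ.map t ≫ g) fun σ τ φ t => by
    rw [Functor.map_comp, Category.assoc]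
  exact (hk f w).trans (hk g fun _ _ => rfl).symm

lemma over_hom_ext_simplices {V W : Over X} {f g : V ⟶ W}
    (h : ∀ ⦃σ : Simplices X⦄ (t : (simplexOver X).obj σ ⟶ V), t ≫ f = t ≫ g) : f = g := by
  ext : 1
  exact hom_ext_simplices fun n z => congrArg CommaMorphism.left (h (simplexTo z))

lemma exists_over_hom {V W : Over X}
    (a : ∀ ⦃σ : Simplices X⦄, ((simplexOver X).obj σ ⟶ V) → ((simplexOver X).obj σ ⟶ W))
    (ha : ∀ ⦃σ τ : Simplices X⦄ (φ : σ ⟶ τ) (t : (simplexOver X).obj τ ⟶ V),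
      (simplexOver X).map φ ≫ a t = a ((simplexOver X).map φ ≫ t)) :
    ∃ g : V ⟶ W, ∀ ⦃σ : Simplices X⦄ (t : (simplexOver X).obj σ ⟶ V), t ≫ g = a t := by
  have key {σ τ : Simplices X} (t : (simplexOver X).obj τ ⟶ V) (s : (simplexOver X).obj σ ⟶ V)
      (α : σ.left ⟶ τ.left) (h : simplexFunctor.map α ≫ t.left = s.left) :
      (a s).left = simplexFunctor.map α ≫ (a t).left := by
    let φ : σ ⟶ τ := CostructuredArrow.homMk α (by
      refine Eq.trans ?_ (Over.w s)
      rw [← h]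
      refine Eq.trans ?_ (Category.assoc _ _ _).symm
      exact congrArg (simplexFunctor.map α ≫ ·) (Over.w t).symm)
    have h' : (simplexOver X).map φ ≫ t = s := by
      ext : 1
      exact h
    rw [← h', ← ha]
    rfl
  let g : V.left ⟶ W.left := homOfSimplices (fun n z => (a (simplexTo z)).left)
    fun m n α z => key (simplexTo z) (simplexTo (simplexFunctor.map α ≫ z)) α rfl
  have hg {n : SimplexCategory} (z : simplexFunctor.obj n ⟶ V.left) :
      z ≫ g = (a (simplexTo z)).left := comp_homOfSimplices _ _ z
  refine ⟨Over.homMk g (hom_ext_simplices fun n z => ?_), fun σ t => ?_⟩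
  · rw [← Category.assoc, hg]
    exact Over.w (a (simplexTo z))
  · ext : 1
    refine (hg t.left).trans ?_
    exact (key t (simplexTo t.left) (𝟙 _) (total.simplexFunctor_map_id_comp _)).trans
      (total.simplexFunctor_map_id_comp _)

lemma dense_of_isLeftAdjoint (Φ : Over X ⥤ SSet.{u}) [Φ.IsLeftAdjoint] : Dense Φ := by
  intro V S a ha
  let adj := Adjunction.ofIsLeftAdjoint Φ
  obtain ⟨g, hg⟩ := exists_over_hom (fun σ t => adj.homEquiv _ _ (a t)) fun σ τ φ t => by
    rw [← ha, adj.homEquiv_naturality_left]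
  refine ⟨(adj.homEquiv _ _).symm g, fun σ t => ?_, fun g' hg' => ?_⟩
  · rw [← adj.homEquiv_naturality_left_symm, hg, Equiv.symm_apply_apply]
  · rw [Equiv.eq_symm_apply]
    refine over_hom_ext_simplices fun σ t => ?_
    rw [hg, ← hg', adj.homEquiv_naturality_left]

lemma Dense.of_isPushout {Φ₀ Φ₁ Φ₂ Φ₃ : Over X ⥤ SSet.{u}} {l : Φ₀ ⟶ Φ₁} {r : Φ₀ ⟶ Φ₂}
    {i₁ : Φ₁ ⟶ Φ₃} {i₂ : Φ₂ ⟶ Φ₃} (sq : ∀ V, IsPushout (l.app V) (r.app V) (i₁.app V) (i₂.app V))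
    (h₀ : Dense Φ₀) (h₁ : Dense Φ₁) (h₂ : Dense Φ₂) : Dense Φ₃ := by
  intro V S a ha
  obtain ⟨g₁, hg₁, -⟩ := h₁ V S (fun σ t => i₁.app _ ≫ a t) fun σ τ φ t => by
    rw [← ha, i₁.naturality_assoc]
  obtain ⟨g₂, hg₂, -⟩ := h₂ V S (fun σ t => i₂.app _ ≫ a t) fun σ τ φ t => by
    rw [← ha, i₂.naturality_assoc]
  have w : l.app V ≫ g₁ = r.app V ≫ g₂ := h₀.hom_ext fun σ t => by
    rw [l.naturality_assoc, r.naturality_assoc, hg₁, hg₂, reassoc_of% (sq _).w]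
  refine ⟨(sq V).desc g₁ g₂ w, fun σ t => (sq _).hom_ext ?_ ?_, fun g hg => (sq _).hom_ext ?_ ?_⟩
  · rw [← i₁.naturality_assoc, (sq V).inl_desc, hg₁]
  · rw [← i₂.naturality_assoc, (sq V).inr_desc, hg₂]
  · rw [(sq V).inl_desc]
    exact h₁.hom_ext fun σ t => by rw [i₁.naturality_assoc, hg, hg₁]
  · rw [(sq V).inr_desc]
    exact h₂.hom_ext fun σ t => by rw [i₂.naturality_assoc, hg, hg₂]

end Dense

/-! ### Corner maps of natural transformations between cocontinuous functors -/

section Corner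

variable {X : SSet.{u}} {Φ Φ' : Over X ⥤ SSet.{u}} (j : Φ ⟶ Φ')

/-- The map `Φ V' ⊔_{Φ V} Φ' V ⟶ Φ' V'` has the left lifting property against `q`. -/
def CornerLift {V V' : Over X} (f : V ⟶ V') {S T : SSet.{u}} (q : S ⟶ T) : Prop :=
  ∀ (a : Φ.obj V' ⟶ S) (b : Φ'.obj V ⟶ S) (c : Φ'.obj V' ⟶ T), Φ.map f ≫ a = j.app V ≫ b →
    j.app V' ≫ c = a ≫ q → Φ'.map f ≫ c = b ≫ q →
    ∃ l : Φ'.obj V' ⟶ S, j.app V' ≫ l = a ∧ Φ'.map f ≫ l = b ∧ l ≫ q = c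

lemma homEquiv_conjugateEquiv {D E : Type*} [Category D] [Category E] {L L' : D ⥤ E} {R R' : E ⥤ D}
    (adj : L ⊣ R) (adj' : L' ⊣ R') (j : L ⟶ L') {V : D} {S : E} (l : L'.obj V ⟶ S) :
    adj'.homEquiv _ _ l ≫ (conjugateEquiv adj' adj j).app S = adj.homEquiv _ _ (j.app V ≫ l) := by
  rw [Adjunction.homEquiv_unit, Adjunction.homEquiv_unit, Category.assoc, NatTrans.naturality,
    reassoc_of% (unit_conjugateEquiv adj' adj j V), Functor.map_comp]

/-- Adjunction turns the corner problem into lifting `f` against the gap map from `R' S` to `R S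
×_{R T} R' T`, where `R` and `R'` are the right adjoints. Its solvability is thus a saturated
condition on `f`. -/
lemma exists_cornerLift_iff [Φ.IsLeftAdjoint] [Φ'.IsLeftAdjoint] {S T : SSet.{u}} (q : S ⟶ T) :
    ∃ (V₁ V₂ : Over X) (r : V₁ ⟶ V₂), ∀ ⦃V V' : Over X⦄ (f : V ⟶ V'),
      CornerLift j f q ↔ HasLiftingProperty f r := by
  let adj := Adjunction.ofIsLeftAdjoint Φ
  let adj' := Adjunction.ofIsLeftAdjoint Φ'
  let m := conjugateEquiv adj' adj j
  have hm {V : Over X} {S : SSet.{u}} (l : Φ'.obj V ⟶ S) :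
      adj'.homEquiv _ _ l ≫ m.app S = adj.homEquiv _ _ (j.app V ≫ l) :=
    homEquiv_conjugateEquiv adj adj' j l
  let r := pullback.lift (m.app S) ((Functor.rightAdjoint Φ').map q) (m.naturality q).symm
  have hr₁ : r ≫ pullback.fst _ _ = m.app S := pullback.lift_fst _ _ _
  have hr₂ : r ≫ pullback.snd _ _ = (Functor.rightAdjoint Φ').map q := pullback.lift_snd _ _ _
  clear_value r
  refine ⟨_, _, r, fun V V' f => ⟨fun h => ⟨fun {x y} sq => ?_⟩, fun h a b c w₁ w₂ w₃ => ?_⟩⟩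
  · obtain ⟨b, rfl⟩ := (adj'.homEquiv _ _).surjective x
    obtain ⟨a, ha⟩ := (adj.homEquiv _ _).surjective (y ≫ pullback.fst _ _)
    obtain ⟨c, hc⟩ := (adj'.homEquiv _ _).surjective (y ≫ pullback.snd _ _)
    obtain ⟨l, hl₁, hl₂, hl₃⟩ := h a b c ((adj.homEquiv _ _).injective (by
      rw [adj.homEquiv_naturality_left, ha, ← hm, ← hr₁, sq.w_assoc]))
      ((adj.homEquiv _ _).injective (by
        rw [← hm, hc, adj.homEquiv_naturality_right, ha, Category.assoc, Category.assoc,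
          pullback.condition]))
      ((adj'.homEquiv _ _).injective (by
        rw [adj'.homEquiv_naturality_left, hc, adj'.homEquiv_naturality_right, ← hr₂,
          sq.w_assoc]))
    refine ⟨⟨⟨adj'.homEquiv _ _ l, ?_, pullback.hom_ext ?_ ?_⟩⟩⟩
    · rw [← adj'.homEquiv_naturality_left, hl₂]
    · rw [Category.assoc, hr₁, hm, hl₁, ha]
    · rw [Category.assoc, hr₂, ← hc, ← adj'.homEquiv_naturality_right, hl₃]
  · have sq : CommSq (adj'.homEquiv _ _ b) f r (pullback.lift (adj.homEquiv _ _ a)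
        (adj'.homEquiv _ _ c) (by rw [hm, w₂, adj.homEquiv_naturality_right])) := ⟨by
      apply pullback.hom_ext
      · rw [Category.assoc, Category.assoc, pullback.lift_fst, hr₁, hm, ← w₁,
          adj.homEquiv_naturality_left]
      · rw [Category.assoc, Category.assoc, pullback.lift_snd, hr₂,
          ← adj'.homEquiv_naturality_right, ← w₃, adj'.homEquiv_naturality_left]⟩
    obtain ⟨l, hl⟩ := (adj'.homEquiv _ _).surjective sq.lift
    refine ⟨l, (adj.homEquiv _ _).injective ?_, (adj'.homEquiv _ _).injective ?_,
      (adj'.homEquiv _ _).injective ?_⟩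
    · rw [← hm, hl, ← hr₁, sq.fac_right_assoc, pullback.lift_fst]
    · rw [adj'.homEquiv_naturality_left, hl, sq.fac_left]
    · rw [adj'.homEquiv_naturality_right, hl, ← hr₂, sq.fac_right_assoc, pullback.lift_snd]

lemma CornerLift.of_rlp_llp [Φ.IsLeftAdjoint] [Φ'.IsLeftAdjoint] {S T : SSet.{u}} {q : S ⟶ T}
    {K : MorphismProperty SSet.{u}}
    (h : ∀ ⦃A B : SSet.{u}⦄ (i : A ⟶ B) (_ : K i) (x : B ⟶ X),
      CornerLift j (Over.homMk i : Over.mk (i ≫ x) ⟶ Over.mk x) q)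
    {V V' : Over X} (f : V ⟶ V') (hf : K.rlp.llp f.left) : CornerLift j f q := by
  obtain ⟨V₁, V₂, r, hr⟩ := exists_cornerLift_iff j q
  rw [hr]
  exact hasLiftingProperty_of_left (hf _ (rlp_left fun A B i hi x => (hr _).1 (h i hi x)))

end Corner

/-! ### Natural transformations between flat functors -/

section Cylinder

variable {X : SSet.{u}}

/-- Functors preserving monomorphisms. -/
def Flat (Φ : Over X ⥤ SSet.{u}) : Prop :=
  ∀ ⦃V V' : Over X⦄ (f : V ⟶ V'), Mono f.left → Mono (Φ.map f)

lemma mono_of_llp_tfib {A B : SSet.{u}} {f : A ⟶ B} (h : tfib.llp f) : Mono f := by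
  obtain ⟨Z, i, p, hi, hp, rfl⟩ := exists_mono_tfib_factorization f
  obtain ⟨s, hs, -⟩ := ModFib.exists_lift (h p hp) i (𝟙 B) (by simp)
  have : Mono ((i ≫ p) ≫ s) := by rwa [hs]
  exact mono_of_mono _ s

variable {Φ Φ' : Over X ⥤ SSet.{u}} (θ : Φ ⟶ Φ')

/-- Here `Γ` is the mapping cylinder of `θ` and `j` the inclusion of its free end. It replaces `θ`
by a transformation with the same weak equivalences, whose corner maps against monomorphisms are
cofibrations. -/
lemma exists_cylinder (hΦ : Dense Φ) (hΦ' : Dense Φ') : ∃ (Γ : Over X ⥤ SSet.{u}) (j : Φ ⟶ Γ),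
    Dense Γ ∧ (∀ V, sWeq (j.app V) ↔ sWeq (θ.app V)) ∧
      (Flat Φ → Flat Φ' → ∀ ⦃V V' : Over X⦄ (f : V ⟶ V'), Mono f.left →
        ∀ ⦃S T : SSet.{u}⦄ (q : S ⟶ T), tfib q → CornerLift j f q) := by
  let I : Over X ⥤ SSet.{u} := Φ ⋙ tensorRight Δ[1]
  let e₀ : Φ ⟶ I := { app := fun V => ι₀, naturality := fun V W f => (ι₀_comp (Φ.map f)).symm }
  let e₁ : Φ ⟶ I := { app := fun V => ι₁, naturality := fun V W f => (ι₁_comp (Φ.map f)).symm }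
  have sq (V : Over X) : IsPushout (ι₁ : Φ.obj V ⟶ Φ.obj V ⊗ Δ[1]) (θ.app V)
      ((pushout.inl e₁ θ).app V) ((pushout.inr e₁ θ).app V) :=
    (IsPushout.of_hasPushout e₁ θ).map ((evaluation _ _).obj V)
  have hI : Dense I := by
    have := hΦ.isLeftAdjoint
    have : I.IsLeftAdjoint := inferInstanceAs (Φ ⋙ tensorRight Δ[1]).IsLeftAdjoint
    exact dense_of_isLeftAdjoint I
  refine ⟨pushout e₁ θ, e₀ ≫ pushout.inl e₁ θ, Dense.of_isPushout (l := e₁) (r := θ) (i₁ := pushout.inl e₁ θ)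
    (i₂ := pushout.inr e₁ θ) sq hΦ hI hΦ', fun V => ?_,
    fun hf hf' V V' f _ S T q hq a b c w₁ w₂ w₃ => ?_⟩
  · have h₁ : sWeq ((pushout.inr e₁ θ).app V) := by
      refine anod.sWeq (MorphismProperty.of_isPushout (P := anod) (sq V).flip ?_)
      have : IsIso (toProdPt (Φ.obj V)) := ⟨fst _ _, toProdPt_fst _, fst_toProdPt _⟩
      rw [← toProdPt_δ_zero]
      exact (MorphismProperty.cancel_left_of_respectsIso anod _ _).2 ((anod.δ 0).whiskerLeft _)
    let q := (sq V).desc (fst _ _ ≫ θ.app V) (𝟙 _) (by simp)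
    have h₂ : sWeq q := sWeq.of_precomp _ _ h₁ (by
      rw [(sq V).inr_desc]
      exact sWeq.id_mem _)
    have h₃ : (ι₀ ≫ (pushout.inl e₁ θ).app V) ≫ q = θ.app V := by
      rw [Category.assoc, (sq V).inl_desc, ι₀_fst_assoc]
    rw [← h₃]
    exact ⟨fun h => sWeq.comp_mem _ _ h h₂, fun h => sWeq.of_postcomp _ _ h₂ h⟩
  · have := hf f inferInstance
    have := hf' f inferInstance
    -- First lift on the copy of `Φ'` at the end of the cylinder, then on the cylinder itself,
    -- relative to both ends and to `V`.
    obtain ⟨l, hl₁, hl₂⟩ := hq.exists_lift (Φ'.map f) ((pushout.inr e₁ θ).app V ≫ b)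
      ((pushout.inr e₁ θ).app V' ≫ c) (by
        rw [Category.assoc, ← w₃, (pushout.inr e₁ θ).naturality_assoc])
    obtain ⟨H, k₁, k₂, k₃, k₄⟩ := hq.exists_homotopy_rel (i := Φ.map f) a (θ.app V' ≫ l)
      ((pushout.inl e₁ θ).app V ≫ b) ((pushout.inl e₁ θ).app V' ≫ c)
      (by simpa using w₁.symm)
      (by rw [reassoc_of% (sq V).w, ← hl₁, θ.naturality_assoc])
      (by simpa using w₂.symm)
      (by rw [reassoc_of% (sq V').w, Category.assoc, hl₂])
      (by
        rw [Category.assoc, ← w₃]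
        exact ((pushout.inl e₁ θ).naturality_assoc f c).symm)
    refine ⟨(sq V').desc H l k₂, ?_, (sq V).hom_ext ?_ ?_, (sq V').hom_ext ?_ ?_⟩
    · refine (Category.assoc _ _ _).trans ?_
      exact (congrArg (ι₀ ≫ ·) ((sq V').inl_desc _ _ _)).trans k₁
    · rw [← (pushout.inl e₁ θ).naturality_assoc, (sq V').inl_desc]
      exact k₃
    · rw [← (pushout.inr e₁ θ).naturality_assoc, (sq V').inr_desc, hl₁]
    · rw [(sq V').inl_desc_assoc, k₄]
    · rw [(sq V').inr_desc_assoc, hl₂]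

end Cylinder

/-- The inclusions of the boundaries of the simplices of dimension less than `n`. -/
abbrev boundaryLT (n : ℕ) : MorphismProperty SSet.{u} :=
  MorphismProperty.ofHoms fun k : Fin n => (∂Δ[k.1] : (Δ[k.1] : SSet.{u}).Subcomplex).ι

lemma rlp_llp_of_cells {A B : SSet.{u}} (i : A ⟶ B) [Mono i] {I : MorphismProperty SSet.{u}}
    (h : ∀ (d : ℕ), Nonempty (relativeCellComplexOfMono.Cell i d) →
      I (∂Δ[d] : (Δ[d] : SSet.{u}).Subcomplex).ι) : I.rlp.llp i := by
  have c := (relativeCellComplexOfMono i).transfiniteCompositionOfShape' (I := I)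
    fun s => h s.j ⟨s.k⟩
  exact MorphismProperty.transfiniteCompositionsOfShape_pushouts_coproducts_le_llp_rlp _ _ _ c.mem

/-- The cells missing from `E` are nondegenerate simplices of `∂Δ[n]`, hence of dimension less than
`n`; this is what feeds the induction on dimension. -/
lemma rlp_llp_boundary (n : ℕ) {E : SSet.{u}} (i : E ⟶ (∂Δ[n] : (Δ[n] : SSet.{u}).Subcomplex))
    [Mono i] : (boundaryLT n).rlp.llp i :=
  rlp_llp_of_cells i fun d ⟨c⟩ => 
    MorphismProperty.ofHoms.mk (f := fun k : Fin n => (∂Δ[k.1] : (Δ[k.1] : SSet.{u}).Subcomplex).ι)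
      ⟨d, dim_lt_of_nonDegenerate _ ⟨c.simplex, c.nonDegenerate⟩ n⟩

/-! ### Weak equivalences between flat functors are detected on simplices -/

section

variable {X : SSet.{u}} {Φ Φ' : Over X ⥤ SSet.{u}} [Φ.IsLeftAdjoint] [Φ'.IsLeftAdjoint]

variable (X) in
/-- The empty simplicial set over `X`. -/
abbrev emptyOver : Over X := Over.mk (initial.to X)

lemma emptyOver_hom_ext {V : Over X} {f g : emptyOver X ⟶ V} : f = g := by
  ext : 1
  exact initialIsInitial.hom_ext _ _

lemma map_emptyOver_hom_ext {S : SSet.{u}} {f g : Φ.obj (emptyOver X) ⟶ S} : f = g :=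
  ((Adjunction.ofIsLeftAdjoint Φ).homEquiv _ _).injective emptyOver_hom_ext

lemma exists_map_emptyOver_hom (S : SSet.{u}) : Nonempty (Φ.obj (emptyOver X) ⟶ S) :=
  ⟨((Adjunction.ofIsLeftAdjoint Φ).homEquiv _ _).symm
    (Over.homMk (initial.to _) (initialIsInitial.hom_ext _ _))⟩

lemma mono_initial_to (A : SSet.{u}) : Mono (initial.to A) := by
  have : Mono ((initialIsInitial.to ((⊥ : A.Subcomplex) : SSet.{u})) ≫ (⊥ : A.Subcomplex).ι) := by
    have : IsIso (initialIsInitial.to ((⊥ : A.Subcomplex) : SSet.{u})) :=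
      ⟨Subcomplex.isInitialBot.to _, initialIsInitial.hom_ext _ _,
        Subcomplex.isInitialBot.hom_ext _ _⟩
    infer_instance
  rwa [initialIsInitial.hom_ext (initial.to A) (_ ≫ (⊥ : A.Subcomplex).ι)]

/-- The map from the empty simplicial set. -/
abbrev emptyTo (V : Over X) : emptyOver X ⟶ V :=
  Over.homMk (initial.to V.left) (initialIsInitial.hom_ext _ _)

variable {j : Φ ⟶ Φ'}

/-- Left adjoints preserve the initial object, so the corner map of `∅ → V` is `j.app V` itself. -/
lemma CornerLift.hasLiftingProperty {V : Over X} {S T : SSet.{u}} {q : S ⟶ T}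
    (h : CornerLift j (emptyTo V) q) : HasLiftingProperty (j.app V) q := by
  refine ⟨fun {a c} sq => ?_⟩
  obtain ⟨b⟩ := exists_map_emptyOver_hom (Φ := Φ') S
  obtain ⟨l, h₁, -, h₂⟩ := h a b c map_emptyOver_hom_ext sq.w.symm map_emptyOver_hom_ext
  exact ⟨⟨⟨l, h₁, h₂⟩⟩⟩

lemma cornerLift_boundary
    (hj : ∀ ⦃V V' : Over X⦄ (f : V ⟶ V'), Mono f.left →
        ∀ ⦃S T : SSet.{u}⦄ (q : S ⟶ T), tfib q → CornerLift j f q)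
    (hj' : ∀ σ, sWeq (j.app ((simplexOver X).obj σ))) (n : ℕ) :
    ∀ (x : Δ[n] ⟶ X) ⦃S T : SSet.{u}⦄ (q : S ⟶ T), kanFib q → CornerLift j
      (Over.homMk (∂Δ[n] : (Δ[n] : SSet.{u}).Subcomplex).ι :
        Over.mk ((∂Δ[n] : (Δ[n] : SSet.{u}).Subcomplex).ι ≫ x) ⟶ Over.mk x) q := by
  induction n using Nat.strong_induction_on with
  | h n hn =>
    intro x
    let f : Over.mk ((∂Δ[n] : (Δ[n] : SSet.{u}).Subcomplex).ι ≫ x) ⟶ Over.mk x :=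
      Over.homMk (∂Δ[n] : (Δ[n] : SSet.{u}).Subcomplex).ι
    change ∀ ⦃S T : SSet.{u}⦄ (q : S ⟶ T), kanFib q → CornerLift j f q
    -- The boundary is built from cells of dimension less than `n`, so induction makes the value of
    -- `j` there a trivial cofibration, as far as lifting against fibrations of Kan complexes is
    -- concerned.
    have h₁ : kanFib.llp (j.app (Over.mk ((∂Δ[n] : (Δ[n] : SSet.{u}).Subcomplex).ι ≫ x))) := by
      intro S T q hq
      have := mono_initial_to (∂Δ[n] : (Δ[n] : SSet.{u}).Subcomplex)
      refine CornerLift.hasLiftingProperty (CornerLift.of_rlp_llp j (K := boundaryLT n) ?_ _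
        (rlp_llp_boundary n _))
      rintro _ _ _ ⟨k⟩ x
      exact hn k.1 k.2 x q hq
    have sq := IsPushout.of_hasPushout (j.app (Over.mk ((∂Δ[n] : (Δ[n] : SSet.{u}).Subcomplex).ι ≫ x)))
      (Φ.map f)
    have h₂ : sWeq (pushout.inr (j.app (Over.mk ((∂Δ[n] : (Δ[n] : SSet.{u}).Subcomplex).ι ≫ x)))
      (Φ.map f)) := sWeq_of_llp_kanFib (MorphismProperty.of_isPushout sq.flip h₁)
    -- The corner map `κ` is a weak equivalence by two out of three, since `j` is one on the
    -- simplex, and a monomorphism since it lifts against trivial fibrations.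
    let κ := sq.desc (Φ'.map f) (j.app _) (j.naturality f).symm
    have hκ : sWeq κ := sWeq.of_precomp _ _ h₂ (by
      rw [sq.inr_desc]
      exact hj' (CostructuredArrow.mk (Y := SimplexCategory.mk n) x))
    have hκ' {S T : SSet.{u}} (q : S ⟶ T) : CornerLift j f q ↔ HasLiftingProperty κ q := by
      refine ⟨fun h => ⟨fun {a c} w => ?_⟩, fun h a b c w₁ w₂ w₃ => ?_⟩
      · obtain ⟨l, hl₁, hl₂, hl₃⟩ := h (pushout.inr _ _ ≫ a) (pushout.inl _ _ ≫ a) c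
          (by rw [sq.w_assoc]) (by rw [Category.assoc, w.w, sq.inr_desc_assoc])
          (by rw [Category.assoc, w.w, sq.inl_desc_assoc])
        exact ⟨⟨⟨l, sq.hom_ext (by rw [sq.inl_desc_assoc, hl₂]) (by rw [sq.inr_desc_assoc, hl₁]),
          hl₃⟩⟩⟩
      · obtain ⟨l, hl₁, hl₂⟩ := ModFib.exists_lift h (sq.desc b a w₁.symm) c
          (sq.hom_ext (by rw [sq.inl_desc_assoc, sq.inl_desc_assoc, w₃])
            (by rw [sq.inr_desc_assoc, sq.inr_desc_assoc, w₂]))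
        exact ⟨l, by rw [← sq.inr_desc_assoc (Φ'.map f) (j.app _) (j.naturality f).symm, hl₁,
          sq.inr_desc], by rw [← sq.inl_desc_assoc (Φ'.map f) (j.app _) (j.naturality f).symm, hl₁,
          sq.inl_desc], hl₂⟩
    have : Mono κ := mono_of_llp_tfib fun S T q hq => (hκ' q).1
      (hj f (inferInstanceAs (Mono (∂Δ[n] : (Δ[n] : SSet.{u}).Subcomplex).ι)) q hq)
    exact fun S T q hq => (hκ' q).2 (llp_kanFib_of_mono_sWeq hκ q hq)

/-- A natural transformation between flat cocontinuous functors is a weak equivalence if it is one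
on simplices. -/
theorem sWeq_app_of_flat (hΦ : Flat Φ) (hΦ' : Flat Φ') (θ : Φ ⟶ Φ')
    (hθ : ∀ σ, sWeq (θ.app ((simplexOver X).obj σ))) (V : Over X) : sWeq (θ.app V) := by
  obtain ⟨Γ, j, hΓ, hj, hj'⟩ := exists_cylinder θ (dense_of_isLeftAdjoint Φ)
    (dense_of_isLeftAdjoint Φ')
  have := hΓ.isLeftAdjoint
  rw [← hj]
  refine sWeq_of_llp_kanFib fun S T q hq => ?_
  have := mono_initial_to V.left
  refine CornerLift.hasLiftingProperty (CornerLift.of_rlp_llp j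
    (K := MorphismProperty.ofHoms fun n : ℕ => (∂Δ[n] : (Δ[n] : SSet.{u}).Subcomplex).ι) ?_ _
        (rlp_llp_of_cells _ fun d _ => ⟨d⟩))
  rintro _ _ _ ⟨k⟩ x
  exact cornerLift_boundary (hj' hΦ hΦ') (fun σ => (hj _).2 (hθ σ)) k x q hq

end

/-! ### Realization of diagrams on the category of simplices -/

section Realization

variable {X : SSet.{u}}

/-- A simplicial set over `X` is the colimit of its simplices. -/
def isColimitSimplices (V : Over X) :
    IsColimit (Cocone.mk (F := CostructuredArrow.proj (simplexOver X) V ⋙ simplexOver X) V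
      { app := fun t => t.hom, naturality := fun _ _ f => (CostructuredArrow.w f).trans (Category.comp_id _).symm }) :=
  IsColimit.ofExistsUnique fun s => by
    obtain ⟨g, hg⟩ := exists_over_hom (V := V) (W := s.pt)
      (fun σ t => s.ι.app (CostructuredArrow.mk t)) fun σ τ φ t => by
        exact s.w (CostructuredArrow.homMk φ : CostructuredArrow.mk ((simplexOver X).map φ ≫ t) ⟶
          CostructuredArrow.mk t)
    refine ⟨g, fun t => hg t.hom, fun g' hg' => over_hom_ext_simplices fun σ t => ?_⟩
    exact (hg' (CostructuredArrow.mk t)).trans (hg t).symm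

lemma dense_of_preservesColimits (Φ : Over X ⥤ SSet.{u}) [PreservesColimitsOfSize.{0, u} Φ] :
    Dense Φ := by
  intro V S a ha
  have h := isColimitOfPreserves Φ (isColimitSimplices V)
  let s : Cocone ((CostructuredArrow.proj (simplexOver X) V ⋙ simplexOver X) ⋙ Φ) :=
    { pt := S
      ι :=
        { app := fun t => a t.hom
          naturality := fun t t' f => by
            refine Eq.trans ?_ (Category.comp_id _).symm
            refine (ha f.left t'.hom).trans (congrArg (fun t => a t) (CostructuredArrow.w f)) } }
  refine ⟨h.desc s, fun σ t => h.fac s (CostructuredArrow.mk t), fun g hg => ?_⟩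
  exact h.uniq s g fun t => hg t.hom

lemma preservesColimits_of_comp_forget {Z : SSet.{u}} (G : Over X ⥤ Over Z)
    [(G ⋙ Over.forget Z).IsLeftAdjoint] : PreservesColimitsOfSize.{0, u} G :=
  have : PreservesColimitsOfSize.{0, u} (G ⋙ Over.forget Z) :=
    (Adjunction.ofIsLeftAdjoint (G ⋙ Over.forget Z)).leftAdjoint_preservesColimits
  preservesColimits_of_reflects_of_preserves G (Over.forget Z)

/-- The forgetful functor reflects colimits, so `G` preserves them. Density then supplies a right
adjoint for the composite without one for `G`. -/
lemma isLeftAdjoint_comp {Z : SSet.{u}} (G : Over X ⥤ Over Z)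
    [(G ⋙ Over.forget Z).IsLeftAdjoint] (Φ : Over Z ⥤ SSet.{u}) [Φ.IsLeftAdjoint] :
    (G ⋙ Φ).IsLeftAdjoint :=
  have : PreservesColimitsOfSize.{0, u} Φ :=
    (Adjunction.ofIsLeftAdjoint Φ).leftAdjoint_preservesColimits
  have := preservesColimits_of_comp_forget G
  (dense_of_preservesColimits (G ⋙ Φ)).isLeftAdjoint

variable (M : Simplices X ⥤ SSet.{u})

/-- The cocontinuous functor on simplicial sets over `X` with given values at the simplices. -/
abbrev realization : Over X ⥤ SSet.{u} := (simplexOver X).pointwiseLeftKanExtension M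

/-- The comparison of a diagram with the values of its realization at the simplices. -/
abbrev realizationUnit : M ⟶ simplexOver X ⋙ realization M :=
  (simplexOver X).pointwiseLeftKanExtensionUnit M

instance : IsIso (realizationUnit M) :=
  ((simplexOver X).pointwiseLeftKanExtensionIsPointwiseLeftKanExtension M).isIso_hom

variable {M}

lemma exists_realization_desc {V : Over X} {S : SSet.{u}}
    (a : ∀ ⦃σ : Simplices X⦄, ((simplexOver X).obj σ ⟶ V) → (M.obj σ ⟶ S))
    (ha : ∀ ⦃σ τ : Simplices X⦄ (φ : σ ⟶ τ) (t : (simplexOver X).obj τ ⟶ V),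
      M.map φ ≫ a t = a ((simplexOver X).map φ ≫ t)) :
    ∃! g : (realization M).obj V ⟶ S, ∀ ⦃σ : Simplices X⦄ (t : (simplexOver X).obj σ ⟶ V),
      (realizationUnit M).app σ ≫ (realization M).map t ≫ g = a t := by
  have h := (simplexOver X).pointwiseLeftKanExtensionIsPointwiseLeftKanExtension M V
  let s : Cocone (CostructuredArrow.proj (simplexOver X) V ⋙ M) :=
    { pt := S
      ι :=
        { app := fun t => a t.hom
          naturality := fun t t' f => by
            refine Eq.trans ?_ (Category.comp_id _).symm
            refine (ha f.left t'.hom).trans (congrArg (fun t => a t) (CostructuredArrow.w f)) } }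
  refine ⟨h.desc s, fun σ t => ?_, fun g hg => h.uniq s g fun t => ?_⟩
  · exact (Category.assoc _ _ _).symm.trans (h.fac s (CostructuredArrow.mk t))
  · exact (Category.assoc _ _ _).trans (hg t.hom)

lemma realization_hom_ext {V : Over X} {S : SSet.{u}} {f g : (realization M).obj V ⟶ S}
    (h : ∀ ⦃σ : Simplices X⦄ (t : (simplexOver X).obj σ ⟶ V),
      (realizationUnit M).app σ ≫ (realization M).map t ≫ f =
        (realizationUnit M).app σ ≫ (realization M).map t ≫ g) : f = g := by
  obtain ⟨k, -, hk⟩ := exists_realization_desc (M := M) (V := V) (S := S)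
    (fun σ t => (realizationUnit M).app σ ≫ (realization M).map t ≫ g) fun σ τ φ t => by
      rw [(realizationUnit M).naturality_assoc, Functor.comp_map, ← Functor.map_comp_assoc]
  exact (hk f h).trans (hk g fun _ _ => rfl).symm

instance : (realization M).IsLeftAdjoint := by
  refine isLeftAdjoint_of_dense _ fun V S a ha => ?_
  obtain ⟨g, hg, hg'⟩ := exists_realization_desc (M := M)
    (fun σ t => (realizationUnit M).app σ ≫ a t) fun σ τ φ t => by
      rw [← ha, (realizationUnit M).naturality_assoc, Functor.comp_map]
  refine ⟨g, fun σ t => ?_, fun k hk => hg' k fun σ t => by rw [hk]⟩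
  rw [← cancel_epi ((realizationUnit M).app σ), hg]

/-- The map from the realization to the target of a cocone. -/
lemma exists_realization_desc_cocone (c : Cocone M) :
    ∃ g : (realization M).obj (Over.mk (𝟙 X)) ⟶ c.pt, ∀ σ : Simplices X,
      (realizationUnit M).app σ ≫ (realization M).map (Over.mkIdTerminal.from _) ≫ g = c.ι.app σ := by
  obtain ⟨g, hg, -⟩ := exists_realization_desc (M := M) (V := Over.mk (𝟙 X)) (S := c.pt)
    (fun σ _ => c.ι.app σ) fun σ τ φ t => c.w φ
  exact ⟨g, fun σ => hg _⟩

/-- The realization at `X` is the colimit. -/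
lemma isIso_of_isColimit {c : Cocone M} (hc : IsColimit c)
    {g : (realization M).obj (Over.mk (𝟙 X)) ⟶ c.pt} (hg : ∀ σ : Simplices X,
      (realizationUnit M).app σ ≫ (realization M).map (Over.mkIdTerminal.from _) ≫ g =
        c.ι.app σ) : IsIso g := by
  let s : Cocone M :=
    { pt := (realization M).obj (Over.mk (𝟙 X))
      ι :=
        { app := fun σ => (realizationUnit M).app σ ≫ (realization M).map (Over.mkIdTerminal.from _)
          naturality := fun σ τ φ => by
            rw [(realizationUnit M).naturality_assoc, Functor.comp_map, ← Functor.map_comp,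
              Over.mkIdTerminal.hom_ext ((simplexOver X).map φ ≫ Over.mkIdTerminal.from _)
                (Over.mkIdTerminal.from _)]
            exact (Category.comp_id _).symm } }
  refine ⟨hc.desc s, realization_hom_ext fun σ t => ?_, hc.hom_ext fun σ => ?_⟩
  · obtain rfl := Over.mkIdTerminal.hom_ext t (Over.mkIdTerminal.from _)
    rw [reassoc_of% hg, Category.comp_id]
    exact hc.fac s σ
  · rw [hc.fac_assoc, Category.comp_id]
    exact (Category.assoc _ _ _).trans (hg σ)

lemma exists_realization_natTrans {Φ : Over X ⥤ SSet.{u}} (α : M ⟶ simplexOver X ⋙ Φ) :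
    ∃ θ : realization M ⟶ Φ, ∀ σ, (realizationUnit M).app σ ≫ θ.app _ = α.app σ :=
  ⟨(realization M).descOfIsLeftKanExtension (realizationUnit M) Φ α,
    fun σ => (realization M).descOfIsLeftKanExtension_fac_app (realizationUnit M) Φ α σ⟩

end Realization

/-! ### Homotopy cartesian squares over simplices -/

section Simplex

lemma sWeq_snd_simplex (n : ℕ) (A : SSet.{u}) : sWeq (snd Δ[n] A) := by
  have h := (isConed_stdSimplex.{u} (n := n) 0).anod
  have h₁ : sWeq (fst A Δ[n]) := by
    have : IsIso (toProdPt A) := ⟨fst _ _, toProdPt_fst _, fst_toProdPt _⟩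
    refine sWeq.of_precomp _ _ (sWeq.comp_mem _ _ (sWeq_of_isIso (toProdPt A))
      (anod.sWeq (h.whiskerLeft A))) ?_
    rw [Category.assoc, whiskerLeft_fst, toProdPt_fst]
    exact sWeq.id_mem A
  rw [← braiding_hom_fst]
  exact sWeq.comp_mem _ _ (sWeq_of_isIso _) h₁

lemma lift_whiskerRight_naturality {A A' B B' Z : SSet.{u}} {a : A ⟶ B} {b : A ⟶ Z} {a' : A' ⟶ B'}
    {b' : A' ⟶ Z} {g : A ⟶ A'} {f : B ⟶ B'} (h₁ : g ≫ a' = a ≫ f) (h₂ : g ≫ b' = b) :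
    g ≫ lift a' b' = lift a b ≫ f ▷ Z := by
  refine CartesianMonoidalCategory.hom_ext _ _ ?_ ?_
  · rw [Category.assoc, lift_fst, h₁, Category.assoc, whiskerRight_fst, lift_fst_assoc]
  · rw [Category.assoc, lift_snd, h₂, Category.assoc, whiskerRight_snd, lift_snd]

lemma mono_whiskerRight {A B : SSet.{u}} (f : A ⟶ B) [Mono f] (Z : SSet.{u}) : Mono (f ▷ Z) := by
  refine ⟨fun a b h => CartesianMonoidalCategory.hom_ext _ _ ?_ ?_⟩
  · rw [← cancel_mono f, Category.assoc, Category.assoc, ← whiskerRight_fst, reassoc_of% h]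
  · rw [← whiskerRight_snd f, reassoc_of% h]

variable {X : SSet.{u}} {Φ : Over X ⥤ SSet.{u}} [Φ.IsLeftAdjoint] (hΦ : Flat Φ)
  (ε : Φ ⟶ Over.forget X)
  (h : ∀ ⦃σ τ : Simplices X⦄ (φ : σ ⟶ τ), sWeq (Φ.map ((simplexOver X).map φ)))

/-- The comparison of the values over a simplex with a product. -/
def toProd (τ : Simplices X) : Over.map τ.hom ⋙ Φ ⟶
    Over.forget _ ⋙ tensorRight (Φ.obj ((simplexOver X).obj τ)) where
  app V := lift (ε.app _) (Φ.map (Over.homMk V.hom))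
  naturality V W f := by
    refine lift_whiskerRight_naturality (ε.naturality _)
      ((Φ.map_comp _ _).symm.trans (congrArg Φ.map ?_))
    ext : 1
    exact Over.w f

include hΦ h in
-- Both sides are flat and cocontinuous in `V`. On a simplex over `τ` each of them projects to
-- `Φ(τ)` by a weak equivalence, one because `h` holds and the other because a simplex is
-- contractible.
lemma sWeq_toProd (τ : Simplices X) (V : Over (simplexFunctor.obj τ.left)) :
    sWeq ((toProd ε τ).app V) := by
  have : (Over.map τ.hom).IsLeftAdjoint := (Over.mapPullbackAdj τ.hom).isLeftAdjoint
  have : (Over.forget (simplexFunctor.{u}.obj τ.left)).IsLeftAdjoint :=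
    (Over.forgetAdjStar _).isLeftAdjoint
  refine sWeq_app_of_flat (X := simplexFunctor.obj τ.left) (Φ := Over.map τ.hom ⋙ Φ)
    (Φ' := Over.forget _ ⋙ tensorRight (Φ.obj ((simplexOver X).obj τ)))
    (fun V W f hf => hΦ _ hf) (fun V W f hf => ?_) (toProd ε τ) (fun ρ => ?_) V
  · exact mono_whiskerRight f.left _
  · obtain ⟨α, hα⟩ := simplexFunctor.map_surjective ρ.hom
    let φ : CostructuredArrow.mk (ρ.hom ≫ τ.hom) ⟶ τ :=
      CostructuredArrow.homMk α (congrArg (· ≫ τ.hom) hα)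
    refine sWeq.of_postcomp _ (snd _ _) (sWeq_snd_simplex _ _) ?_
    have h₁ : (toProd ε τ).app ((simplexOver _).obj ρ) ≫ snd _ _ =
      Φ.map (Over.homMk ρ.hom) := lift_snd _ _
    rw [h₁]
    have h₂ : (Over.homMk ρ.hom : (Over.map τ.hom).obj ((simplexOver _).obj ρ) ⟶
        (simplexOver X).obj τ) = (simplexOver X).map φ := by
      ext : 1
      exact hα.symm
    rw [h₂]
    exact h φ

include hΦ ε h in
-- Over the simplex `x` the functor `Φ` is a product with `Φ(x)` up to weak equivalence, and the
-- product of a horn inclusion with any simplicial set is anodyne.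
lemma llp_kanFib_map_horn {n : ℕ} (k : Fin (n + 2)) (x : simplexFunctor.obj (SimplexCategory.mk (n + 1)) ⟶ X) :
    kanFib.llp (Φ.map (Over.homMk Λ[n + 1, k].ι : Over.mk (Λ[n + 1, k].ι ≫ x) ⟶ Over.mk x)) := by
  have := hΦ (Over.homMk Λ[n + 1, k].ι : Over.mk (Λ[n + 1, k].ι ≫ x) ⟶ Over.mk x)
    (show Mono Λ[n + 1, k].ι from inferInstance)
  refine llp_kanFib_of_mono_sWeq ?_
  let τ : Simplices X := CostructuredArrow.mk x
  let g : Over.mk (Λ[n + 1, k].ι : (Λ[n + 1, k] : SSet.{u}) ⟶ simplexFunctor.obj τ.left) ⟶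
    Over.mk (𝟙 (simplexFunctor.obj τ.left)) := Over.homMk (Λ[n + 1, k].ι)
  have h₀ : sWeq (Λ[n + 1, k].ι ▷ Φ.obj ((simplexOver X).obj τ)) :=
    anod.sWeq ((anodyneExtensions.horn_ι k).whiskerRight _)
  have h₁ := sWeq.comp_mem _ _ (sWeq_toProd hΦ ε h τ
    (Over.mk (Λ[n + 1, k].ι : (Λ[n + 1, k] : SSet.{u}) ⟶ simplexFunctor.obj τ.left))) h₀
  refine sWeq.of_postcomp _ _ (sWeq_toProd hΦ ε h τ (Over.mk (𝟙 _))) ?_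
  have h₂ := (toProd ε τ).naturality g
  exact h₂.symm ▸ h₁

include hΦ ε h in
lemma sWeq_map_of_anodyne {V V' : Over X} (f : V ⟶ V') (hf : ModFib.anod f.left) :
    sWeq (Φ.map f) := by
  refine sWeq_of_llp_kanFib (llp_map_of_isLeftAdjoint Φ (K := modelCategoryQuillen.J) ?_ f
    (anod.rlp_llp hf))
  intro A B i hi x
  simp only [modelCategoryQuillen.J, MorphismProperty.iSup_iff] at hi
  obtain ⟨n, ⟨k⟩⟩ := hi
  exact llp_kanFib_map_horn hΦ ε h k x

end Simplex

/-! ### Homotopy fibres of the realization -/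

section HomotopyFiber

variable {X : SSet.{u}}

/-- Applied to the augmentation of `Φ` at a simplex, this exhibits the map from `Φ(τ) ×_X P` to `(τ
×_X P) × Φ(τ)` as a pullback of a graph, to which right properness applies. -/
lemma isPullback_graph {A B E W : SSet.{u}} {w : E ⟶ W} {f : E ⟶ A} {r : W ⟶ B} {e : A ⟶ B}
    (pb : IsPullback w f r e) : IsPullback (lift w f) f (r ▷ A) (lift e (𝟙 A)) := by
  have hw : lift w f ≫ r ▷ A = f ≫ lift e (𝟙 A) := by
    refine CartesianMonoidalCategory.hom_ext _ _ ?_ ?_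
    · rw [Category.assoc, whiskerRight_fst, lift_fst_assoc, Category.assoc, lift_fst, pb.w]
    · rw [Category.assoc, whiskerRight_snd, lift_snd, Category.assoc, lift_snd, Category.comp_id]
  have h₁ (s : PullbackCone (r ▷ A) (lift e (𝟙 A))) : (s.fst ≫ fst _ _) ≫ r = s.snd ≫ e := by
    have := s.condition =≫ fst _ _
    rwa [Category.assoc, whiskerRight_fst, Category.assoc, lift_fst, ← Category.assoc] at this
  have h₂ (s : PullbackCone (r ▷ A) (lift e (𝟙 A))) : s.fst ≫ snd _ _ = s.snd := by
    have := s.condition =≫ snd _ _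
    rwa [Category.assoc, whiskerRight_snd, Category.assoc, lift_snd, Category.comp_id] at this
  refine ⟨⟨hw⟩, ⟨PullbackCone.IsLimit.mk _ (fun s => pb.lift (s.fst ≫ fst _ _) s.snd (h₁ s))
    (fun s => ?_) (fun s => pb.lift_snd _ _ _) (fun s m hm₁ hm₂ => pb.hom_ext ?_ ?_)⟩⟩
  · refine CartesianMonoidalCategory.hom_ext _ _ ?_ ?_
    · rw [Category.assoc, lift_fst, pb.lift_fst]
    · rw [Category.assoc, lift_snd, pb.lift_snd, h₂]
  · rw [pb.lift_fst, ← hm₁, Category.assoc, lift_fst]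
  · rw [pb.lift_snd, hm₂]

/-- The pullback along `p`, as a functor on simplicial sets over `X`. -/
def overBaseChange {P : SSet.{u}} (p : P ⟶ X) : Over X ⥤ Over X where
  obj V := Over.mk (baseChangeFst p V ≫ V.hom)
  map {V W} f := Over.homMk ((baseChange p).map f) (by
    change (baseChange p).map f ≫ baseChangeFst p W ≫ W.hom = _
    rw [baseChange_map_fst_assoc, Over.w]
    rfl)
  map_id V := by ext : 1; exact (baseChange p).map_id V
  map_comp f g := by ext : 1; exact (baseChange p).map_comp f g

instance {P : SSet.{u}} (p : P ⟶ X) : (overBaseChange p ⋙ Over.forget X).IsLeftAdjoint :=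
  inferInstanceAs (baseChange p).IsLeftAdjoint

/-- The projection of the pullback. -/
def overBaseChangeFst {P : SSet.{u}} (p : P ⟶ X) (V : Over X) : (overBaseChange p).obj V ⟶ V :=
  Over.homMk (baseChangeFst p V)

lemma overBaseChange_map_fst {P : SSet.{u}} (p : P ⟶ X) {V W : Over X} (f : V ⟶ W) :
    (overBaseChange p).map f ≫ overBaseChangeFst p W = overBaseChangeFst p V ≫ f := by
  ext : 1
  exact baseChange_map_fst p f

lemma mono_baseChange_map {P : SSet.{u}} (p : P ⟶ X) {V W : Over X} (f : V ⟶ W) [Mono f.left] :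
    Mono ((baseChange p).map f) :=
  mono_fst_of_isPullback (isPullback_baseChange_map p f)

variable {Φ : Over X ⥤ SSet.{u}} (ε : Φ ⟶ Over.forget X)

/-- The functor with values over `X` determined by an augmented functor. -/
def overOf : Over X ⥤ Over X where
  obj V := Over.mk (ε.app V ≫ V.hom)
  map {V W} f := Over.homMk (Φ.map f) (by
    refine (ε.naturality_assoc f _).trans ?_
    exact congrArg (ε.app V ≫ ·) (Over.w f))
  map_id V := by ext : 1; exact Φ.map_id V
  map_comp f g := by ext : 1; exact Φ.map_comp f g

/-- The augmentation. -/
def overOfAug (V : Over X) : (overOf ε).obj V ⟶ V := Over.homMk (ε.app V)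

instance [Φ.IsLeftAdjoint] : (overOf ε ⋙ Over.forget X).IsLeftAdjoint :=
  inferInstanceAs Φ.IsLeftAdjoint

variable {P : SSet.{u}} (p : P ⟶ X)

lemma toBaseChange_w (V : Over X) :
    Φ.map (overBaseChangeFst p V) ≫ ε.app V ≫ V.hom =
      (ε.app ((overBaseChange p).obj V) ≫ baseChangeSnd p V) ≫ p := by
  refine (ε.naturality_assoc _ _).trans ?_
  refine Eq.trans ?_ (Category.assoc _ _ _).symm
  exact congrArg (ε.app ((overBaseChange p).obj V) ≫ ·) (isPullback_baseChange p V).w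

/-- The comparison of the value at a pullback with the pullback of the value. -/
def toBaseChange (V : Over X) :
    Φ.obj ((overBaseChange p).obj V) ⟶ (baseChange p).obj ((overOf ε).obj V) :=
  (isPullback_baseChange p ((overOf ε).obj V)).lift (Φ.map (overBaseChangeFst p V))
    (ε.app ((overBaseChange p).obj V) ≫ baseChangeSnd p V) (toBaseChange_w ε p V)

lemma toBaseChange_fst (V : Over X) : toBaseChange ε p V ≫ baseChangeFst p _ =
    Φ.map (overBaseChangeFst p V) := (isPullback_baseChange p ((overOf ε).obj V)).lift_fst _ _ _

lemma toBaseChange_snd (V : Over X) : toBaseChange ε p V ≫ baseChangeSnd p _ =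
    ε.app ((overBaseChange p).obj V) ≫ baseChangeSnd p V :=
  (isPullback_baseChange p ((overOf ε).obj V)).lift_snd _ _ _

lemma toBaseChange_naturality {V W : Over X} (f : V ⟶ W) :
    Φ.map ((overBaseChange p).map f) ≫ toBaseChange ε p W =
      toBaseChange ε p V ≫ (baseChange p).map ((overOf ε).map f) := by
  refine (isPullback_baseChange p ((overOf ε).obj W)).hom_ext ?_ ?_
  · rw [Category.assoc, toBaseChange_fst, Category.assoc, baseChange_map_fst, ← Category.assoc,
      toBaseChange_fst]
    exact (Φ.map_comp _ _).symm.trans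
      ((congrArg Φ.map (overBaseChange_map_fst p f)).trans (Φ.map_comp _ _))
  · rw [Category.assoc, toBaseChange_snd, Category.assoc, baseChange_map_snd, toBaseChange_snd]
    refine (ε.naturality_assoc _ _).trans ?_
    exact congrArg (ε.app ((overBaseChange p).obj V) ≫ ·) (baseChange_map_snd p f)

variable [Φ.IsLeftAdjoint] (hΦ : Flat Φ)
  (h : ∀ ⦃σ τ : Simplices X⦄ (φ : σ ⟶ τ), sWeq (Φ.map ((simplexOver X).map φ)))

include hΦ h in
-- Both sides map to `(τ ×_X P) × Φ(τ)`. From `Φ(τ ×_X P)` this is the product comparison over `τ`.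
-- From `Φ(τ) ×_X P` it is the pullback, along a fibration, of the graph of `Φ(τ) → Δ[n]`, a weak
-- equivalence since `Δ[n]` is contractible.
lemma sWeq_toBaseChange_simplex (hp : kfib p) (τ : Simplices X) :
    sWeq (toBaseChange ε p ((simplexOver X).obj τ)) := by
  have pb := isPullback_baseChange_map p (overOfAug ε ((simplexOver X).obj τ))
  have hw : toBaseChange ε p ((simplexOver X).obj τ) ≫
      (baseChange p).map (overOfAug ε ((simplexOver X).obj τ)) = ε.app _ := by
    refine (isPullback_baseChange p ((simplexOver X).obj τ)).hom_ext ?_ ?_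
    · rw [Category.assoc, baseChange_map_fst, ← Category.assoc, toBaseChange_fst]
      exact ε.naturality (overBaseChangeFst p ((simplexOver X).obj τ))
    · rw [Category.assoc, baseChange_map_snd, toBaseChange_snd]
      rfl
  refine sWeq.of_postcomp _ _ (sWeq_of_isPullback (isPullback_graph pb) ?_ ?_) ?_
  · refine MorphismProperty.of_isPullback (P := kfib) (isPullback_whiskerRight_fst _ _).flip ?_
    exact MorphismProperty.of_isPullback (P := kfib)
      (isPullback_baseChange p ((simplexOver X).obj τ)).flip hp
  · refine sWeq.of_postcomp _ (snd _ _) (sWeq_snd_simplex _ _) ?_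
    rw [lift_snd]
    exact sWeq.id_mem _
  · rw [comp_lift, hw, toBaseChange_fst]
    exact sWeq_toProd hΦ ε h τ (Over.mk (baseChangeFst p ((simplexOver X).obj τ)))

include hΦ h in
-- Pullback along `p` is cocontinuous and preserves monomorphisms, so it is enough to know the
-- comparison on simplices.
lemma sWeq_toBaseChange (hp : kfib p) (V : Over X) : sWeq (toBaseChange ε p V) := by
  have := isLeftAdjoint_comp (overBaseChange p) Φ
  have := isLeftAdjoint_comp (overOf ε) (baseChange p)
  refine sWeq_app_of_flat (Φ := overBaseChange p ⋙ Φ) (Φ' := overOf ε ⋙ baseChange p)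
    (fun V W f hf => hΦ _ (mono_baseChange_map p f)) (fun V W f hf => ?_)
    { app := toBaseChange ε p, naturality := fun _ _ f => toBaseChange_naturality ε p f }
    (sWeq_toBaseChange_simplex ε p hΦ h hp) V
  have : Mono ((overOf ε).map f).left := hΦ f hf
  exact mono_baseChange_map p ((overOf ε).map f)

include hΦ h in
/-- Weak equivalences from the value at `X` to a fibration over `X` restrict to weak equivalences
over simplices. -/
theorem sWeq_to_pullback {Y : SSet.{u}} {q : Y ⟶ X} (hq : kfib q)
    {g : Φ.obj (Over.mk (𝟙 X)) ⟶ Y} (hg : sWeq g) (hgq : g ≫ q = ε.app (Over.mk (𝟙 X)))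
    (σ : Simplices X) {Z : SSet.{u}} {a : Z ⟶ simplexFunctor.obj σ.left} {b : Z ⟶ Y}
    (pb : IsPullback a b σ.hom q) {l : Φ.obj ((simplexOver X).obj σ) ⟶ Z}
    (hla : l ≫ a = ε.app ((simplexOver X).obj σ))
    (hlb : l ≫ b = Φ.map (Over.mkIdTerminal.from _) ≫ g) : sWeq l := by
  -- The simplex is replaced by a fibration `P → X`, along which strict pullback is homotopy
  -- pullback.
  obtain ⟨P, i, p, hi, hp, hip⟩ := exists_anod_kfib_factorization σ.hom
  have pb₁ := isPullback_baseChange p (Over.mk (𝟙 X))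
  have : IsIso (Over.mk (𝟙 X)).hom := inferInstanceAs (IsIso (𝟙 X))
  have : IsIso (baseChangeSnd p (Over.mk (𝟙 X))) := pb₁.isIso_snd_of_isIso
  let r := pb₁.lift σ.hom i ((Category.comp_id _).trans hip.symm)
  have hr : ModFib.anod r := by
    have : r = i ≫ inv (baseChangeSnd p (Over.mk (𝟙 X))) := by
      rw [IsIso.eq_comp_inv]
      exact pb₁.lift_snd _ _ _
    rw [this]
    exact (MorphismProperty.cancel_right_of_respectsIso ModFib.anod _ _).2 hi
  let f : (simplexOver X).obj σ ⟶ (overBaseChange p).obj (Over.mk (𝟙 X)) :=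
    Over.homMk r (((Category.assoc _ _ _).symm.trans (Category.comp_id _)).trans
      (pb₁.lift_fst _ _ _))
  let g' : (overOf ε).obj (Over.mk (𝟙 X)) ⟶ Over.mk q :=
    Over.homMk g (hgq.trans (Category.comp_id _).symm)
  have h₁ := sWeq_map_of_anodyne hΦ ε h f hr
  have h₂ := sWeq_toBaseChange ε p hΦ h hp (Over.mk (𝟙 X))
  have pb₂ := isPullback_baseChange p (Over.mk q)
  have h₃ : sWeq ((baseChange p).map g') :=
    sWeq_of_isPullback (isPullback_baseChange_map p g')
      (MorphismProperty.of_isPullback (P := kfib) pb₂.flip hp) hg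
  let m : Z ⟶ (baseChange p).obj (Over.mk q) := pb₂.lift b (a ≫ i) (by
    rw [Category.assoc, hip]
    exact pb.w.symm)
  have hm₁ : m ≫ baseChangeFst p (Over.mk q) = b := pb₂.lift_fst _ _ _
  have hm₂ : m ≫ baseChangeSnd p (Over.mk q) = a ≫ i := pb₂.lift_snd _ _ _
  have pb₃ : IsPullback m a (baseChangeSnd p (Over.mk q)) i := by
    refine IsPullback.of_right ?_ hm₂ pb₂
    rw [hm₁, hip]
    exact pb.flip
  refine sWeq.of_postcomp _ m (sWeq_of_isPullback_of_anod pb₃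
    (MorphismProperty.of_isPullback (P := kfib) pb₂ hq) hi) ?_
  -- The chain is `Φ(σ) → Φ(P) → Φ(X) ×_X P → Y ×_X P`. Its maps are weak equivalences because `i`
  -- is anodyne, by the base change comparison, and by right properness respectively.
  have e : l ≫ m = Φ.map f ≫ toBaseChange ε p _ ≫ (baseChange p).map g' := by
    refine pb₂.hom_ext ?_ ?_
    · rw [Category.assoc, hm₁, hlb, Category.assoc, Category.assoc, baseChange_map_fst,
        reassoc_of% (toBaseChange_fst ε p (Over.mk (𝟙 X)))]
      refine Eq.trans ?_ ((Category.assoc _ _ _))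
      exact congrArg (· ≫ g) ((congrArg Φ.map (Over.mkIdTerminal.hom_ext _ _)).trans
        (Φ.map_comp f (overBaseChangeFst p (Over.mk (𝟙 X)))))
    · rw [Category.assoc, hm₂, Category.assoc, Category.assoc, baseChange_map_snd,
        toBaseChange_snd, reassoc_of% hla]
      refine Eq.trans ?_ (ε.naturality_assoc f _).symm
      exact congrArg (ε.app ((simplexOver X).obj σ) ≫ ·) (pb₁.lift_snd _ _ _).symm
  rw [e]
  exact sWeq.comp_mem _ _ h₁ (sWeq.comp_mem _ _ h₂ h₃)

end HomotopyFiber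

/-! ### Evaluation of simplicial presheaves and its adjoints -/

section Evaluation

variable {C : Type u} [EnrichedCategory SSet.{u} C]

/-- Evaluation at an object. -/
def evalAt (c : C) : SPsh C ⥤ SSet.{u} where
  obj F := F.obj c
  map f := f.app c

instance (c : C) : PreservesColimitsOfSize.{u, u} (evalAt c) where
  preservesColimitsOfShape :=
    { preservesColimit := fun {K} =>
        preservesColimit_of_preserves_colimit_cocone (SPsh.colimitCoconeIsColimit K)
          (colimit.isColimit (SPsh.diag K c)) }

/-! ### The enriched category identities behind the free presheaf -/

section Free

variable (b c d e : C) {A : SSet.{u}}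

lemma comp_whiskerRight_assoc_comp :
    eComp SSet.{u} b d e ▷ ((e ⟶[SSet.{u}] c) ⊗ A) ≫ (α_ _ _ _).inv ≫ eComp SSet.{u} b e c ▷ A =
      (α_ _ _ _).hom ≫ (b ⟶[SSet.{u}] d) ◁ ((α_ _ _ _).inv ≫ eComp SSet.{u} d e c ▷ A) ≫
        (α_ _ _ _).inv ≫ eComp SSet.{u} b d c ▷ A := by
  have := congrArg (· ▷ A) (e_assoc SSet.{u} b d e c)
  simp only [comp_whiskerRight] at this
  rw [MonoidalCategory.whiskerLeft_comp, Category.assoc, associator_inv_naturality_middle_assoc,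
    ← this, associator_inv_naturality_left_assoc]
  simp

lemma id_whiskerRight_assoc_comp :
    (λ_ ((d ⟶[SSet.{u}] c) ⊗ A)).inv ≫ eId SSet.{u} d ▷ _ ≫ (α_ _ _ _).inv ≫
      eComp SSet.{u} d d c ▷ A = 𝟙 _ := by
  have := congrArg (· ▷ A) (e_id_comp SSet.{u} d c)
  simp only [comp_whiskerRight, id_whiskerRight] at this
  rw [associator_inv_naturality_left_assoc, ← this]
  simp

lemma assoc_comp_whiskerLeft_act {F : SPsh C} (g : A ⟶ F.obj c) :
    ((α_ _ _ _).inv ≫ eComp SSet.{u} b d c ▷ A) ≫ (b ⟶[SSet.{u}] c) ◁ g ≫ F.act b c =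
      (b ⟶[SSet.{u}] d) ◁ ((d ⟶[SSet.{u}] c) ◁ g ≫ F.act d c) ≫ F.act b d := by
  rw [Category.assoc, ← whisker_exchange_assoc, F.act_comp]
  simp

lemma whiskerLeft_id_comp_eq {G F : SSet.{u}} {k : (c ⟶[SSet.{u}] c) ⊗ A ⟶ G}
    {l : (d ⟶[SSet.{u}] c) ⊗ A ⟶ F} {a : (d ⟶[SSet.{u}] c) ⊗ G ⟶ F}
    (h : ((α_ _ _ _).inv ≫ eComp SSet.{u} d c c ▷ A) ≫ l = (d ⟶[SSet.{u}] c) ◁ k ≫ a) :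
    (d ⟶[SSet.{u}] c) ◁ ((λ_ A).inv ≫ eId SSet.{u} c ▷ A ≫ k) ≫ a = l := by
  have h₂ := congrArg (· ▷ A) (e_comp_id SSet.{u} d c)
  simp only [comp_whiskerRight, id_whiskerRight] at h₂
  rw [MonoidalCategory.whiskerLeft_comp, MonoidalCategory.whiskerLeft_comp, Category.assoc,
    Category.assoc, ← h, Category.assoc, associator_inv_naturality_middle_assoc]
  have h₃ := h₂ =≫ l
  rw [Category.id_comp] at h₃
  refine Eq.trans ?_ h₃
  simp

end Free

/-- The free simplicial presheaf on a simplicial set at an object. -/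
def freeObj (c : C) (A : SSet.{u}) : SPsh C where
  obj d := (d ⟶[SSet.{u}] c) ⊗ A
  act b d := (α_ _ _ _).inv ≫ eComp SSet.{u} b d c ▷ A
  act_id d := id_whiskerRight_assoc_comp c d
  act_comp b d e := comp_whiskerRight_assoc_comp b c d e

/-- Maps from the free simplicial presheaf. -/
def homEquivFree (c : C) (A : SSet.{u}) (F : SPsh C) : (freeObj c A ⟶ F) ≃ (A ⟶ F.obj c) where
  toFun f := (λ_ A).inv ≫ eId SSet.{u} c ▷ A ≫ f.app c
  invFun g :=
    { app := fun d => (d ⟶[SSet.{u}] c) ◁ g ≫ F.act d c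
      naturality := fun b d => assoc_comp_whiskerLeft_act b c d g }
  left_inv f := by
    ext d : 1
    exact whiskerLeft_id_comp_eq c d (f.naturality d c)
  right_inv g := by
    change (λ_ A).inv ≫ eId SSet.{u} c ▷ A ≫ (c ⟶[SSet.{u}] c) ◁ g ≫ F.act c c = g
    rw [← whisker_exchange_assoc, ← leftUnitor_inv_naturality_assoc, F.act_id, Category.comp_id]

/-- The left adjoint of the evaluation at an object. -/
def free (c : C) : SSet.{u} ⥤ SPsh C :=
  Adjunction.leftAdjointOfEquiv (G := evalAt c) (F_obj := freeObj c) (homEquivFree c)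
    fun A _ _ f g => (congrArg ((λ_ A).inv ≫ ·) (Category.assoc (eId SSet.{u} c ▷ A) (g.app c)
      (f.app c)).symm).trans (Category.assoc _ _ _).symm

/-- The adjunction of the free simplicial presheaf and evaluation. -/
def freeAdj (c : C) : free c ⊣ evalAt c := Adjunction.adjunctionOfEquivLeft _ _

/-- The action on the cofree simplicial presheaf. -/
def coindAct (c d e : C) (Z : SSet.{u}) : (d ⟶[SSet.{u}] e) ⊗ (ihom (c ⟶[SSet.{u}] e)).obj Z ⟶
    (ihom (c ⟶[SSet.{u}] d)).obj Z :=
  MonoidalClosed.curry ((α_ _ _ _).inv ≫ eComp SSet.{u} c d e ▷ _ ≫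
    (ihom.ev (c ⟶[SSet.{u}] e)).app Z)

lemma uncurry_comp_coindAct (c d e : C) {A Z : SSet.{u}}
    (k : A ⟶ (d ⟶[SSet.{u}] e) ⊗ (ihom (c ⟶[SSet.{u}] e)).obj Z) :
    MonoidalClosed.uncurry (k ≫ coindAct c d e Z) =
      (c ⟶[SSet.{u}] d) ◁ k ≫ (α_ _ _ _).inv ≫ eComp SSet.{u} c d e ▷ _ ≫
    (ihom.ev (c ⟶[SSet.{u}] e)).app Z := by
  rw [MonoidalClosed.uncurry_natural_left, coindAct, MonoidalClosed.uncurry_curry]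

lemma uncurry_whiskerLeft_coindAct (c d e : C) {A Z : SSet.{u}}
    (k : A ⟶ (ihom (c ⟶[SSet.{u}] e)).obj Z) :
    MonoidalClosed.uncurry ((d ⟶[SSet.{u}] e) ◁ k ≫ coindAct c d e Z) =
      (α_ _ _ _).inv ≫ eComp SSet.{u} c d e ▷ _ ≫ MonoidalClosed.uncurry k := by
  rw [uncurry_comp_coindAct, MonoidalClosed.uncurry_eq, associator_inv_naturality_right_assoc,
    whisker_exchange_assoc]

/-- The cofree simplicial presheaf on a simplicial set at an object. -/
def coindObj (c : C) (Z : SSet.{u}) : SPsh C where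
  obj d := (ihom (c ⟶[SSet.{u}] d)).obj Z
  act d e := coindAct c d e Z
  act_id d := by
    apply MonoidalClosed.uncurry_injective
    have h₂ := congrArg (· ▷ (ihom (c ⟶[SSet.{u}] d)).obj Z) (e_comp_id SSet.{u} c d)
    simp only [comp_whiskerRight, id_whiskerRight] at h₂
    have h₃ := h₂ =≫ (ihom.ev (c ⟶[SSet.{u}] d)).app Z
    rw [Category.id_comp] at h₃
    rw [← Category.assoc, uncurry_comp_coindAct, MonoidalClosed.uncurry_id_eq_ev,
      MonoidalCategory.whiskerLeft_comp, Category.assoc, associator_inv_naturality_middle_assoc]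
    refine Eq.trans ?_ h₃
    simp
  act_comp b d e := by
    apply MonoidalClosed.uncurry_injective
    have h := congrArg (· ▷ (ihom (c ⟶[SSet.{u}] e)).obj Z) (e_assoc SSet.{u} c b d e)
    simp only [comp_whiskerRight] at h
    have h' := h =≫ (ihom.ev (c ⟶[SSet.{u}] e)).app Z
    simp only [Category.assoc] at h'
    rw [uncurry_comp_coindAct, MonoidalClosed.uncurry_natural_left, uncurry_whiskerLeft_coindAct,
      coindAct, MonoidalClosed.uncurry_curry, associator_inv_naturality_middle_assoc, ← h',
      associator_inv_naturality_left_assoc]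
    simp

lemma comp_curry_act (F : SPsh C) (c d e : C) {Z : SSet.{u}} (g : F.obj c ⟶ Z) :
    F.act d e ≫ MonoidalClosed.curry (F.act c d ≫ g) =
      (d ⟶[SSet.{u}] e) ◁ MonoidalClosed.curry (F.act c e ≫ g) ≫ coindAct c d e Z := by
  apply MonoidalClosed.uncurry_injective
  rw [uncurry_whiskerLeft_coindAct, MonoidalClosed.uncurry_natural_left,
    MonoidalClosed.uncurry_curry, MonoidalClosed.uncurry_curry, reassoc_of% (F.act_comp c d e),
    Iso.inv_hom_id_assoc]

lemma act_comp_eq_uncurry (F : SPsh C) (c d : C) {Z : SSet.{u}}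
    {k : F.obj c ⟶ (ihom (c ⟶[SSet.{u}] c)).obj Z} {l : F.obj d ⟶ (ihom (c ⟶[SSet.{u}] d)).obj Z}
    (h : F.act c d ≫ k = (c ⟶[SSet.{u}] d) ◁ l ≫ coindAct c c d Z) :
    F.act c d ≫ (λ_ _).inv ≫ eId SSet.{u} c ▷ F.obj c ≫ MonoidalClosed.uncurry k =
      MonoidalClosed.uncurry l := by
  have h₂ := congrArg (· ▷ F.obj d) (e_id_comp SSet.{u} c d)
  simp only [comp_whiskerRight, id_whiskerRight] at h₂
  have h₃ := h₂ =≫ MonoidalClosed.uncurry l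
  rw [Category.id_comp] at h₃
  rw [leftUnitor_inv_naturality_assoc, whisker_exchange_assoc, ← MonoidalClosed.uncurry_natural_left,
    h, uncurry_whiskerLeft_coindAct, associator_inv_naturality_left_assoc]
  refine Eq.trans ?_ h₃
  simp

/-- Maps to the cofree simplicial presheaf. -/
def homEquivCoind (c : C) (F : SPsh C) (Z : SSet.{u}) : (F.obj c ⟶ Z) ≃ (F ⟶ coindObj c Z) where
  toFun g :=
    { app := fun d => MonoidalClosed.curry (F.act c d ≫ g)
      naturality := fun d e => comp_curry_act F c d e g }
  invFun f := (λ_ _).inv ≫ eId SSet.{u} c ▷ F.obj c ≫ MonoidalClosed.uncurry (f.app c)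
  left_inv g := by
    change (λ_ _).inv ≫ eId SSet.{u} c ▷ F.obj c ≫
      MonoidalClosed.uncurry (MonoidalClosed.curry (F.act c c ≫ g)) = g
    rw [MonoidalClosed.uncurry_curry, reassoc_of% (F.act_id c)]
  right_inv f := by
    ext d : 1
    apply MonoidalClosed.uncurry_injective
    refine (MonoidalClosed.uncurry_curry _).trans ?_
    exact act_comp_eq_uncurry F c d (f.naturality c d)

/-- The right adjoint of the evaluation at an object. -/
def coind (c : C) : SSet.{u} ⥤ SPsh C where
  obj Z := coindObj c Z
  map q :=
    { app := fun d => (ihom (c ⟶[SSet.{u}] d)).map q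
      naturality := fun d e => by
        apply MonoidalClosed.uncurry_injective
        refine Eq.trans ?_ (uncurry_whiskerLeft_coindAct c d e _).symm
        refine (MonoidalClosed.uncurry_natural_right _ _).trans ?_
        change MonoidalClosed.uncurry (coindAct c d e _) ≫ q = _
        rw [coindAct, MonoidalClosed.uncurry_curry, Category.assoc, Category.assoc]
        exact congrArg (fun t => (α_ _ _ _).inv ≫ eComp SSet.{u} c d e ▷ _ ≫ t)
          ((ihom.ev (c ⟶[SSet.{u}] e)).naturality q).symm }
  map_id Z := by ext d : 1; exact (ihom _).map_id Z
  map_comp f g := by ext d : 1; exact (ihom _).map_comp f g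

/-- The adjunction of evaluation and the cofree simplicial presheaf. -/
def coindAdj (c : C) : evalAt c ⊣ coind c :=
  Adjunction.mkOfHomEquiv
    { homEquiv := homEquivCoind c
      homEquiv_naturality_left_symm := fun {F G Z} f g => by
        change (λ_ _).inv ≫ eId SSet.{u} c ▷ F.obj c ≫ MonoidalClosed.uncurry (f.app c ≫ g.app c) =
          f.app c ≫ (λ_ _).inv ≫ eId SSet.{u} c ▷ G.obj c ≫ MonoidalClosed.uncurry (g.app c)
        rw [leftUnitor_inv_naturality_assoc, whisker_exchange_assoc]
        exact congrArg (fun t => (λ_ _).inv ≫ eId SSet.{u} c ▷ F.obj c ≫ t)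
          (MonoidalClosed.uncurry_natural_left _ _)
      homEquiv_naturality_right := fun {F Z Z'} f g => by
        ext d : 1
        change MonoidalClosed.curry (F.act c d ≫ f ≫ g) =
          MonoidalClosed.curry (F.act c d ≫ f) ≫ (ihom (c ⟶[SSet.{u}] d)).map g
        rw [← MonoidalClosed.curry_natural_right]
        exact congrArg MonoidalClosed.curry (Category.assoc _ _ _).symm }

end Evaluation

/-! ### Functorial factorizations -/

section SmallObject

open MorphismProperty

attribute [local instance] Cardinal.fact_isRegular_aleph0 Cardinal.orderBotAleph0OrdToType

/-- The small object argument for the maps obtained from `K` by a family of left adjoints. -/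
theorem nonempty_functorialFactorizationData {D : Type (u + 1)} [Category.{u} D]
    [HasColimitsOfSize.{u, u} D] {ι : Type u} {L : ι → SSet.{u} ⥤ D} {E : ι → D ⥤ SSet.{u}}
    (adj : ∀ i, L i ⊣ E i) [∀ i, PreservesColimitsOfSize.{u, u} (E i)]
    (K : MorphismProperty SSet.{u}) [MorphismProperty.IsSmall.{u} K]
    (hK : ∀ ⦃A B : SSet.{u}⦄ (f : A ⟶ B), K f → IsFinitelyPresentable.{u} A)
    (T : MorphismProperty D) (hT : ∀ ⦃A B : D⦄ (f : A ⟶ B), T f ↔ ∀ i, K.rlp ((E i).map f)) :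
    Nonempty (FunctorialFactorizationData T.llp T) := by
  let G : MorphismProperty D :=
    ofHoms fun p : ι × K.toSet => (L p.1).map p.2.1.hom
  have hG : G.rlp = T := by
    ext A B f
    rw [hT]
    refine ⟨fun h i X Y k hk => ?_, fun h X Y g hg => ?_⟩
    · rw [← (adj i).hasLiftingProperty_iff]
      exact h _ (ofHoms.mk (f := fun p : ι × K.toSet => (L p.1).map p.2.1.hom)
        (i, ⟨Arrow.mk k, hk⟩))
    · obtain ⟨i, k⟩ := hg
      rw [(adj i).hasLiftingProperty_iff]
      exact h i _ k.2
  have : MorphismProperty.IsSmall.{u} G := isSmall_ofHoms _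
  have : IsCardinalForSmallObjectArgument G Cardinal.aleph0.{u} :=
    { preservesColimit := fun {A B X Y} i hi f hf => by
        have : IsFinitelyPresentable.{u} A := by
          obtain ⟨i, k⟩ := hi
          have := hK _ k.2
          -- Since the right adjoint preserves filtered colimits, its left adjoint preserves
          -- finitely presentable objects.
          have : (E i).IsCardinalAccessible Cardinal.aleph0.{u} :=
            { preservesColimitOfShape := fun _ => inferInstance }
          exact (adj i).isCardinalPresentable_leftAdjoint_obj Cardinal.aleph0.{u} k.1.left
        infer_instance }
  have : HasSmallObjectArgument.{u} G := ⟨.aleph0, inferInstance, inferInstance, inferInstance⟩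
  rw [← hG]
  exact ⟨functorialFactorizationData G.rlp.llp G.rlp⟩

end SmallObject

section Factorizations

variable {C : Type u} [EnrichedCategory SSet.{u} C]

instance : HasColimitsOfSize.{u, u} (SPsh C) := ⟨fun _ => inferInstance⟩

/-- Evaluation has a right adjoint, the cofree presheaf, whose values are powers by hom objects.
Powers preserve Kan fibrations, so the adjoint takes Kan fibrations to objectwise ones. -/
lemma llp_kfib_app_of_llp_fib {F G : SPsh C} {f : F ⟶ G} (hf : (fib (C := C)).llp f) (c : C) :
    ModFib.anod (f.app c) := by
  intro E B q hq
  change HasLiftingProperty ((evalAt c).map f) q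
  rw [(coindAdj c).hasLiftingProperty_iff]
  refine hf _ fun d A X i hi => ?_
  change HasLiftingProperty i ((ihom (c ⟶[SSet.{u}] d)).map q)
  rw [← (ihom.adjunction _).hasLiftingProperty_iff]
  have h : ModFib.anod i := by
    rw [ModFib.anod, anodyneExtensions_eq_llp_rlp]
    exact MorphismProperty.le_llp_rlp _ _ hi
  exact (h.whiskerLeft (c ⟶[SSet.{u}] d)) q hq

instance nonempty_fibrantFactorization : Nonempty (FibrantFactorization C) := by
  obtain ⟨F⟩ := nonempty_functorialFactorizationData (D := SPsh C) freeAdj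
    modelCategoryQuillen.J.{u} (fun A B f hf => by
      simp only [modelCategoryQuillen.J, MorphismProperty.iSup_iff] at hf
      obtain ⟨n, ⟨k⟩⟩ := hf
      infer_instance) fib (fun A B f => Iff.rfl)
  exact ⟨F.ofLE (fun A B f hf => ⟨fun _ _ g hg => hf g hg.1,
    fun c => anod.sWeq (llp_kfib_app_of_llp_fib hf c)⟩) le_rfl⟩

lemma fib_inf_weq_iff {F G : SPsh C} (f : F ⟶ G) :
    (fib ⊓ weq : MorphismProperty (SPsh C)) f ↔ ∀ c, tfib (f.app c) :=
  ⟨fun h c => tfib_of_kfib_of_sWeq (h.1 c) (h.2 c),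
    fun h => ⟨fun c => (h c).kfib, fun c => (h c).sWeq⟩⟩

variable {J : Type u} [Category.{0} J]

/-- The adjunction for the evaluation of a diagram of simplicial presheaves. -/
def diagramAdj (i : J × C) : free i.2 ⋙ evaluationLeftAdjoint (SPsh C) i.1 ⊣
    (evaluation J (SPsh C)).obj i.1 ⋙ evalAt i.2 :=
  (freeAdj i.2).comp (evaluationAdjunctionRight (SPsh C) i.1)

lemma functorCategory_fib_inf_weq_iff {K L : J ⥤ SPsh C} (f : K ⟶ L) :
    (fib ⊓ weq : MorphismProperty (SPsh C)).functorCategory J f ↔ ∀ i : J × C,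
      tfib (((evaluation J (SPsh C)).obj i.1 ⋙ evalAt i.2).map f) :=
  ⟨fun h i => (fib_inf_weq_iff _).1 (h i.1) i.2,
    fun h j => (fib_inf_weq_iff _).2 fun c => h (j, c)⟩

instance nonempty_cofibrantReplacement : Nonempty (CofibrantReplacement C J) := by
  obtain ⟨F⟩ := nonempty_functorialFactorizationData (D := J ⥤ SPsh C) diagramAdj
    modelCategoryQuillen.I.{u} (fun A B f hf => by
      obtain ⟨n⟩ := hf
      infer_instance) ((fib ⊓ weq : MorphismProperty (SPsh C)).functorCategory J)
      (fun A B f => functorCategory_fib_inf_weq_iff f)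
  -- Factoring the map from the initial object, functorially in its target, gives the replacement.
  let a : (J ⥤ SPsh C) ⥤ Arrow (J ⥤ SPsh C) :=
    { obj := fun K => Arrow.mk (initial.to K)
      map := fun f => Arrow.homMk (𝟙 _) f (by simp) }
  exact ⟨{  Q := a ⋙ F.Z
            π := Functor.whiskerLeft a F.p
            cofibrant := fun K => by
              have e : F.i.app (a.obj K) = initial.to (F.Z.obj (a.obj K)) :=
                initialIsInitial.hom_ext _ _
              intro X Y g hg
              exact Eq.rec (motive := fun t _ => HasLiftingProperty t g)
                (F.hi (a.obj K) g hg) e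
            weq_app := fun K j => (F.hp (a.obj K) j).2 }⟩

end Factorizations

/-! ### Flatness of projectively cofibrant diagrams -/

section PowDiagram

variable {X : SSet.{u}}

/-- The diagram of powers of `S` cofreely generated by `V`. -/
def powDiagram (S : SSet.{u}) (V : Over X) : Simplices X ⥤ SSet.{u} where
  obj σ := ∏ᶜ fun _ : ((simplexOver X).obj σ ⟶ V) => S
  map φ := Pi.lift fun t => Pi.π _ ((simplexOver X).map φ ≫ t)
  map_id σ := by
    refine Pi.hom_ext _ _ fun t => ?_
    rw [Pi.lift_π, Category.id_comp]
    exact congrArg (Pi.π _) (by rw [CategoryTheory.Functor.map_id, Category.id_comp])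
  map_comp φ ψ := by
    refine Pi.hom_ext _ _ fun t => ?_
    rw [Pi.lift_π, Category.assoc, Pi.lift_π, Pi.lift_π]
    exact congrArg (Pi.π _) (by rw [Functor.map_comp, Category.assoc])

/-- The projections of the diagram of powers. -/
def powπ (S : SSet.{u}) (V : Over X) {σ : Simplices X} (t : (simplexOver X).obj σ ⟶ V) :
    (powDiagram S V).obj σ ⟶ S :=
  Pi.π _ t

lemma powDiagram_map_π (S : SSet.{u}) (V : Over X) {σ τ : Simplices X} (φ : σ ⟶ τ)
    (t : (simplexOver X).obj τ ⟶ V) :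
    (powDiagram S V).map φ ≫ powπ S V t = powπ S V ((simplexOver X).map φ ≫ t) :=
  Pi.lift_π _ _

lemma pow_hom_ext {S A : SSet.{u}} {V : Over X} {σ : Simplices X}
    {f g : A ⟶ (powDiagram S V).obj σ} (h : ∀ t, f ≫ powπ S V t = g ≫ powπ S V t) : f = g :=
  Pi.hom_ext _ _ h

lemma exists_pow_lift {S A : SSet.{u}} {V : Over X} {σ : Simplices X}
    (a : ((simplexOver X).obj σ ⟶ V) → (A ⟶ S)) :
    ∃ f : A ⟶ (powDiagram S V).obj σ, ∀ t, f ≫ powπ S V t = a t :=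
  ⟨Pi.lift a, fun t => Pi.lift_π _ t⟩

lemma exists_pow_natTrans {S : SSet.{u}} {V : Over X} {M : Simplices X ⥤ SSet.{u}}
    (a : ∀ ⦃σ : Simplices X⦄, ((simplexOver X).obj σ ⟶ V) → (M.obj σ ⟶ S))
    (ha : ∀ ⦃σ τ : Simplices X⦄ (φ : σ ⟶ τ) (t : (simplexOver X).obj τ ⟶ V),
      M.map φ ≫ a t = a ((simplexOver X).map φ ≫ t)) :
    ∃ f : M ⟶ powDiagram S V, ∀ ⦃σ : Simplices X⦄ (t : (simplexOver X).obj σ ⟶ V),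
      f.app σ ≫ powπ S V t = a t := by
  choose g hg using fun σ => exists_pow_lift (S := S) (fun t => a (σ := σ) t)
  refine ⟨{ app := g, naturality := fun σ τ φ => pow_hom_ext fun t => ?_ }, hg⟩
  rw [Category.assoc, hg, ha, Category.assoc, powDiagram_map_π, hg]

/-- Lifting `Φ(V) → Φ(V')` against `q : S → T` amounts to lifting `M` against the map of diagrams
from `S^Hom(σ, V')` to `S^Hom(σ, V) ×_{T^Hom(σ, V)} T^Hom(σ, V')`. As `Hom(σ, V)` injects into
`Hom(σ, V')`, that map is a product of copies of `q` and of identities, hence a trivial fibration.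
-/
lemma flat_realization {M : Simplices X ⥤ SSet.{u}}
    (hM : ∀ ⦃N N' : Simplices X ⥤ SSet.{u}⦄ (q : N ⟶ N'), (∀ σ, tfib (q.app σ)) →
      ∀ b : M ⟶ N', ∃ l, l ≫ q = b) : Flat (realization M) := by
  intro V V' f hf
  refine mono_of_llp_tfib fun S T q hq => ⟨fun {x y} sq => ?_⟩
  obtain ⟨α, hα⟩ := exists_pow_natTrans (S := T) (V := V) (M := powDiagram S V)
    (fun σ t => powπ S V t ≫ q) fun σ τ φ t => by
      rw [← Category.assoc, powDiagram_map_π]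
  obtain ⟨β, hβ⟩ := exists_pow_natTrans (S := T) (V := V) (M := powDiagram T V')
    (fun σ t => powπ T V' (t ≫ f)) fun σ τ φ t => by
      rw [powDiagram_map_π, Category.assoc]
  obtain ⟨α', hα'⟩ := exists_pow_natTrans (S := T) (V := V') (M := powDiagram S V')
    (fun σ t => powπ S V' t ≫ q) fun σ τ φ t => by
      rw [← Category.assoc, powDiagram_map_π]
  obtain ⟨β', hβ'⟩ := exists_pow_natTrans (S := S) (V := V) (M := powDiagram S V')
    (fun σ t => powπ S V' (t ≫ f)) fun σ τ φ t => by
      rw [powDiagram_map_π, Category.assoc]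
  obtain ⟨a, ha⟩ := exists_pow_natTrans (S := S) (V := V) (M := M)
    (fun σ t => (realizationUnit M).app σ ≫ (realization M).map t ≫ x) fun σ τ φ t => by
      rw [(realizationUnit M).naturality_assoc, Functor.comp_map, ← Functor.map_comp_assoc]
  obtain ⟨c, hc⟩ := exists_pow_natTrans (S := T) (V := V') (M := M)
    (fun σ t => (realizationUnit M).app σ ≫ (realization M).map t ≫ y) fun σ τ φ t => by
      rw [(realizationUnit M).naturality_assoc, Functor.comp_map, ← Functor.map_comp_assoc]
  let r : powDiagram S V' ⟶ pullback α β := pullback.lift β' α' (by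
    ext σ : 2
    refine pow_hom_ext fun t => ?_
    rw [NatTrans.comp_app, NatTrans.comp_app, Category.assoc, Category.assoc, hα, hβ,
      reassoc_of% hβ', hα'])
  have hr₁ : r ≫ pullback.fst α β = β' := pullback.lift_fst _ _ _
  have hr₂ : r ≫ pullback.snd α β = α' := pullback.lift_snd _ _ _
  have hr : ∀ σ, tfib (r.app σ) := by
    intro σ
    have pb := (IsPullback.of_hasPullback α β).map ((evaluation _ _).obj σ)
    refine tfib.of_lift fun A B i hi => ⟨fun {u v} sq => ?_⟩
    have w := sq.w
    have hu₁ : u ≫ β'.app σ = i ≫ v ≫ (pullback.fst α β).app σ := by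
      rw [← hr₁, NatTrans.comp_app, reassoc_of% w]
    have hu₂ : u ≫ α'.app σ = i ≫ v ≫ (pullback.snd α β).app σ := by
      rw [← hr₂, NatTrans.comp_app, reassoc_of% w]
    have key : ∀ t : (simplexOver X).obj σ ⟶ V', ∃ l : B ⟶ S,
        i ≫ l = u ≫ powπ S V' t ∧ l ≫ q = v ≫ (pullback.snd α β).app σ ≫ powπ T V' t ∧
        ∀ s, t = s ≫ f → l = v ≫ (pullback.fst α β).app σ ≫ powπ S V s := by
      intro t
      -- Coordinates indexed by simplices of `V` are dictated by the pullback, unambiguously since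
      -- `f` is a monomorphism; the others are chosen by lifting against `q`.
      by_cases ht : ∃ s, t = s ≫ f
      · obtain ⟨s, rfl⟩ := ht
        refine ⟨v ≫ (pullback.fst α β).app σ ≫ powπ S V s, ?_, ?_, fun s' hs' => ?_⟩
        · rw [← reassoc_of% hu₁, hβ']
        · have h := congrArg (fun g => v ≫ g.app σ ≫ powπ T V s) (pullback.condition (f := α) (g := β))
          simp only [NatTrans.comp_app, Category.assoc] at h
          rw [hα, hβ] at h
          simpa using h
        · have : Mono f := Over.mono_of_mono_left f
          rw [(cancel_mono f).1 hs']
      · obtain ⟨l, h₁, h₂⟩ := tfib.exists_lift hq i (u ≫ powπ S V' t)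
          (v ≫ (pullback.snd α β).app σ ≫ powπ T V' t) (by
            rw [← reassoc_of% hu₂, hα', Category.assoc])
        exact ⟨l, h₁, h₂, fun s hs => (ht ⟨s, hs⟩).elim⟩
    choose l hl₁ hl₂ hl₃ using key
    obtain ⟨g, hg⟩ := exists_pow_lift l
    refine ⟨⟨g, pow_hom_ext fun t => ?_, pb.hom_ext ?_ ?_⟩⟩
    · rw [Category.assoc, hg, hl₁]
    · refine pow_hom_ext fun s => ?_
      have h : g ≫ β'.app σ ≫ powπ S V s = v ≫ (pullback.fst α β).app σ ≫ powπ S V s := by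
        rw [hβ', hg, hl₃ _ s rfl]
      rw [← hr₁] at h
      simpa using h
    · refine pow_hom_ext fun t => ?_
      have h : g ≫ α'.app σ ≫ powπ T V' t = v ≫ (pullback.snd α β).app σ ≫ powπ T V' t := by
        rw [hα', ← hl₂, ← hg, Category.assoc]
      rw [← hr₂] at h
      simpa using h
  obtain ⟨l, hl⟩ := hM r hr (pullback.lift a c (by
    ext σ : 2
    refine pow_hom_ext fun t => ?_
    rw [NatTrans.comp_app, NatTrans.comp_app, Category.assoc, Category.assoc, hα, hβ,
      reassoc_of% ha, hc, Functor.map_comp, Category.assoc, sq.w]))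
  have hl₁ : l ≫ β' = a := by rw [← hr₁, reassoc_of% hl, pullback.lift_fst]
  have hl₂ : l ≫ α' = c := by rw [← hr₂, reassoc_of% hl, pullback.lift_snd]
  obtain ⟨g, hg, -⟩ := exists_realization_desc (M := M) (V := V') (S := S)
    (fun σ t => l.app σ ≫ powπ S V' t) fun σ τ φ t => by
      rw [l.naturality_assoc, powDiagram_map_π]
  refine ⟨⟨g, realization_hom_ext fun σ t => ?_, realization_hom_ext fun σ t => ?_⟩⟩
  · rw [← Functor.map_comp_assoc, hg, ← ha, ← hl₁, NatTrans.comp_app, Category.assoc, hβ']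
  · rw [reassoc_of% hg, ← hc, ← hl₂, NatTrans.comp_app, Category.assoc, hα']

end PowDiagram

/-! ### Evaluations of cofibrant diagrams of presheaves -/

section Cofibrant

variable {C : Type u} [EnrichedCategory SSet.{u} C] {J : Type u} [Category.{0} J]

/-- The value at `d` is the power of `q` by a hom object, and tensoring with that object preserves
monomorphisms. -/
lemma tfib_coind_map {S T : SSet.{u}} {q : S ⟶ T} (hq : tfib q) (c d : C) :
    tfib (((coind c).map q).app d) := by
  refine tfib.of_lift fun A B i hi => ?_
  change HasLiftingProperty i ((ihom (c ⟶[SSet.{u}] d)).map q)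
  rw [← (ihom.adjunction _).hasLiftingProperty_iff]
  have : Mono ((tensorLeft (c ⟶[SSet.{u}] d)).map i) := by
    refine ⟨fun a b h => CartesianMonoidalCategory.hom_ext _ _ ?_ ?_⟩
    · exact (congrArg (a ≫ ·) (whiskerLeft_fst _ i)).symm.trans
        (((Category.assoc _ _ _).symm.trans (h =≫ fst _ _)).trans ((Category.assoc _ _ _).trans
          (congrArg (b ≫ ·) (whiskerLeft_fst _ i))))
    · rw [← cancel_mono i]
      have := h =≫ snd _ _
      simpa using this
  exact tfib.lift hq _

/-- Evaluations of cofibrant diagrams lift through objectwise trivial fibrations. -/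
lemma exists_lift_of_cofibrant {K : J ⥤ SPsh C}
    (hK : (MorphismProperty.functorCategory (fib ⊓ weq : MorphismProperty (SPsh C)) J).llp
      (initial.to K)) (c : C) {N N' : J ⥤ SSet.{u}} (q : N ⟶ N') (hq : ∀ j, tfib (q.app j))
    (b : K ⋙ evalAt c ⟶ N') : ∃ l, l ≫ q = b := by
  let adj := (coindAdj c).whiskerRight J
  have h : HasLiftingProperty (initial.to K)
      (((Functor.whiskeringRight J _ _).obj (coind c)).map q) :=
    hK _ fun j => (fib_inf_weq_iff _).2 fun d => tfib_coind_map (hq j) c d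
  let sq : CommSq (initial.to _) (initial.to K)
    (((Functor.whiskeringRight J _ _).obj (coind c)).map q) (adj.homEquiv K N' b) :=
    ⟨initialIsInitial.hom_ext _ _⟩
  refine ⟨(adj.homEquiv K N).symm sq.lift, ?_⟩
  exact (adj.homEquiv_naturality_right_symm _ _).symm.trans
    ((congrArg _ sq.fac_right).trans ((adj.homEquiv K N').symm_apply_apply b))

variable {X : SSet.{u}} (Q : CofibrantReplacement C (Simplices X))

lemma flat_realization_of_cofibrantReplacement (K : Simplices X ⥤ SPsh C) (c : C) :
    Flat (realization (Q.Q.obj K ⋙ evalAt c)) :=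
  flat_realization fun _ _ q hq b => exists_lift_of_cofibrant (Q.cofibrant K) c q hq b

end Cofibrant

/-! ### Localisation of extensions -/

lemma sWeq_simplex {m n : ℕ} (f : (Δ[m] : SSet.{u}) ⟶ Δ[n]) : sWeq f := by
  let b : (Δ[0] : SSet.{u}) ⟶ Δ[m] := SSet.stdSimplex.map (SimplexCategory.const ⦋0⦌ ⦋m⦌ 0)
  exact sWeq.of_precomp b f (anod.sWeq (isConed_vertex b).anod)
    (anod.sWeq (isConed_vertex (b ≫ f)).anod)

/-! ### Homotopy invariance of pullbacks of presheaves -/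

section Presheaves

variable {C : Type u} [EnrichedCategory SSet.{u} C]

instance (c : C) : PreservesLimitsOfSize.{0, 0} (evalAt c) where
  preservesLimitsOfShape :=
    { preservesLimit := fun {K} =>
        preservesLimit_of_preserves_limit_cone (SPsh.limitConeIsLimit K)
          (limit.isLimit (SPsh.diag K c)) }

variable {V V' E E' B : SPsh C}

lemma isPullback_pullback_app (t : V ⟶ B) (p : E ⟶ B) (c : C) :
    IsPullback ((pullback.fst t p).app c) ((pullback.snd t p).app c) (t.app c) (p.app c) :=
  (IsPullback.of_hasPullback t p).map (evalAt c)

lemma pbMap_app_fst {t : V ⟶ B} {t' : V' ⟶ B} {p : E ⟶ B} {p' : E' ⟶ B} {v : V ⟶ V'} {f : E ⟶ E'}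
    (hv : v ≫ t' = t) (hf : f ≫ p' = p) (c : C) :
    (pbMap v f hv hf).app c ≫ (pullback.fst t' p').app c =
      (pullback.fst t p).app c ≫ v.app c :=
  congrArg (fun f => SPsh.Hom.app f c) (pbMap_fst v f hv hf)

lemma pbMap_app_snd {t : V ⟶ B} {t' : V' ⟶ B} {p : E ⟶ B} {p' : E' ⟶ B} {v : V ⟶ V'} {f : E ⟶ E'}
    (hv : v ≫ t' = t) (hf : f ≫ p' = p) (c : C) :
    (pbMap v f hv hf).app c ≫ (pullback.snd t' p').app c =
      (pullback.snd t p).app c ≫ f.app c :=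
  congrArg (fun f => SPsh.Hom.app f c) (pbMap_snd v f hv hf)

lemma weq_pbMap_left {t : V ⟶ B} {t' : V' ⟶ B} {v : V ⟶ V'} (hv : v ≫ t' = t) (h : weq v)
    {p : E ⟶ B} (hp : fib p) : weq (pbMap v (𝟙 E) hv (Category.id_comp p)) := by
  intro c
  have h₁ := isPullback_pullback_app t p c
  have h₂ := isPullback_pullback_app t' p c
  have e₁ := pbMap_app_fst hv (Category.id_comp p) c
  have e₂ : (pbMap v (𝟙 E) hv (Category.id_comp p)).app c ≫ (pullback.snd t' p).app c =
    (pullback.snd t p).app c := (pbMap_app_snd hv (Category.id_comp p) c).trans (Category.comp_id _)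
  refine sWeq_of_isPullback (IsPullback.of_right ?_ e₁ h₂.flip)
    (MorphismProperty.of_isPullback (P := kfib) h₂.flip (hp c)) (h c)
  have e₃ : v.app c ≫ t'.app c = t.app c := congrArg (fun f => SPsh.Hom.app f c) hv
  rw [e₂, e₃]
  exact h₁.flip

lemma weq_pbMap_right {p : E ⟶ B} {p' : E' ⟶ B} {f : E ⟶ E'} (hf : f ≫ p' = p) (h : weq f)
    (hp : fib p) (hp' : fib p') (t : V ⟶ B) : weq (pbMap (𝟙 V) f (Category.id_comp t) hf) := by
  intro c
  exact sWeq_of_isPullback_of_kfib (hp c) (hp' c) (h c) (congrArg (fun f => SPsh.Hom.app f c) hf)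
    (isPullback_pullback_app t p c).flip (isPullback_pullback_app t p' c).flip
    (pbMap_app_snd _ _ c) ((pbMap_app_fst _ _ c).trans (Category.comp_id _))

lemma Equivalent.of_weq {F G : SPsh C} {f : F ⟶ G} (h : weq f) : Equivalent F G :=
  Relation.EqvGen.rel _ _ ⟨f, h⟩

lemma Equivalent.symm {F G : SPsh C} (h : Equivalent F G) : Equivalent G F :=
  Relation.EqvGen.symm _ _ h

lemma Equivalent.trans {F G H : SPsh C} (h : Equivalent F G) (h' : Equivalent G H) :
    Equivalent F H :=
  Relation.EqvGen.trans _ _ _ h h'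

lemma weq_of_precomp {F G H : SPsh C} {f : F ⟶ G} {g : G ⟶ H} (hf : weq f) (hfg : weq (f ≫ g)) :
    weq g :=
  fun c => sWeq.of_precomp _ _ (hf c) (hfg c)

variable (R : FibrantFactorization C)

/-- The map to the fibrant replacement. -/
abbrev toFibRep (A : Over B) : A.left ⟶ ((fibRep R B).obj A).left := R.i.app (Arrow.mk A.hom)

lemma toFibRep_hom (A : Over B) : toFibRep R A ≫ ((fibRep R B).obj A).hom = A.hom :=
  congrArg (fun f => NatTrans.app f (Arrow.mk A.hom)) R.fac

lemma weq_toFibRep (A : Over B) : weq (toFibRep R A) := (R.hi _).2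

lemma fib_fibRep_hom (A : Over B) : fib ((fibRep R B).obj A).hom := R.hp _

lemma toFibRep_naturality {A A' : Over B} (f : A ⟶ A') :
    toFibRep R A ≫ ((fibRep R B).map f).left = f.left ≫ toFibRep R A' :=
  (R.i.naturality (Arrow.homMk f.left (𝟙 B) (by simp) : Arrow.mk A.hom ⟶ Arrow.mk A'.hom)).symm

lemma weq_fibRep_map {A A' : Over B} (f : A ⟶ A') (hf : weq f.left) :
    weq ((fibRep R B).map f).left :=
  weq_of_precomp (weq_toFibRep R A) (by
    rw [toFibRep_naturality]
    exact weq_comp hf (weq_toFibRep R A'))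

lemma weq_U_map {X : SSet.{u}} {σ τ : Simplices X} (φ : σ ⟶ τ) : weq ((U C X).map φ) :=
  fun _ => sWeq_simplex (m := σ.left.len) (n := τ.left.len) (simplexFunctor.map φ.left)

variable {X : SSet.{u}}

lemma exists_vertex (σ : Simplices X) :
    ∃ x : Δ[0] ⟶ X, Nonempty ((CostructuredArrow.mk x : Simplices X) ⟶ σ) :=
  ⟨simplexFunctor.map (SimplexCategory.const ⦋0⦌ σ.left 0) ≫ σ.hom,
    ⟨CostructuredArrow.homMk (SimplexCategory.const ⦋0⦌ σ.left 0)⟩⟩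

/-- The fibres of two fibrant replacements are equivalent. -/
lemma equivalent_pullback {E E' : SPsh C} {p : E ⟶ B} {q : E' ⟶ B} {i : E ⟶ E'} (hi : weq i)
    (hq : fib q) (hip : i ≫ q = p) (t : V ⟶ B) :
    Equivalent (pullback t ((fibRep R B).obj (Over.mk p)).hom) (pullback t q) :=
  let f : Over.mk p ⟶ Over.mk q := Over.homMk i hip
  (Equivalent.of_weq (weq_pbMap_right (Over.w ((fibRep R B).map f)) (weq_fibRep_map R f hi)
    (fib_fibRep_hom R _) (fib_fibRep_hom R _) t)).trans
    (Equivalent.of_weq (weq_pbMap_right (toFibRep_hom R (Over.mk q)) (weq_toFibRep R _) hq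
      (fib_fibRep_hom R _) t)).symm

lemma RLocOver_weq_map (A : Over ((SPsh.const C).obj X)) {σ τ : Simplices X} (φ : σ ⟶ τ) :
    weq (((RLocOver R X).obj A).left.map φ) :=
  weq_pbMap_left (U_map_toX φ) (weq_U_map φ) (fib_fibRep_hom R A)

/-- Every simplex has a vertex, and moving along a map of simplices changes the pullback of a
fibration by a weak equivalence. At a vertex, the fibre of `RE` is compared with that of the fibrant
replacement given with the extension. -/
theorem rLocRestricts (F : SPsh C) : RLocRestricts R F X where
  equiv A σ := by
    obtain ⟨x, ⟨φ⟩⟩ := exists_vertex σ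
    obtain ⟨E', i, q, hi, hq, hip, h⟩ := A.fiber x
    exact ((Equivalent.of_weq (RLocOver_weq_map R _ φ)).symm.trans
      (equivalent_pullback R hi hq hip _)).trans h
  weq_map A σ τ φ := RLocOver_weq_map R _ φ
  weq_app A B f σ := weq_pbMap_right (Over.w ((fibRep R _).map ((Ext.toOver F X).map f)))
    (weq_fibRep_map R _ f.2.1) (fib_fibRep_hom R _) (fib_fibRep_hom R _) (toX C σ)

end Presheaves

/-! ### Globalisation of local data -/

section Diagrams

lemma comp_comp_assoc {D : Type*} [Category* D] {A₀ A₁ A₂ A₃ A₄ A₅ : D} (a : A₀ ⟶ A₁) (b : A₁ ⟶ A₂)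
    (g : A₂ ⟶ A₃) (j : A₃ ⟶ A₄) (q : A₄ ⟶ A₅) :
    a ≫ b ≫ (g ≫ j) ≫ q = (a ≫ b ≫ g) ≫ j ≫ q := by
  simp only [Category.assoc]

lemma isIso_lift_of_isPullback {D : Type*} [Category* D] {P P' A B Z : D} {a : P ⟶ A} {b : P ⟶ B}
    {f : A ⟶ Z} {g : B ⟶ Z} {a' : P' ⟶ A} {b' : P' ⟶ B} (h : IsPullback a b f g)
    (h' : IsPullback a' b' f g) : IsIso (h'.lift a b h.w) :=
  ⟨h.lift a' b' h'.w, h.hom_ext (by simp) (by simp), h'.hom_ext (by simp) (by simp)⟩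

variable {X : SSet.{u}} {M : Simplices X ⥤ SSet.{u}}

/-- Weak equivalences from a homotopy colimit to a fibration over `X` restrict to weak equivalences
over simplices. -/
lemma sWeq_to_pullback_of_diagram (hM : Flat (realization M))
    (hM' : ∀ ⦃σ τ : Simplices X⦄ (φ : σ ⟶ τ), sWeq (M.map φ))
    (α : M ⟶ simplexOver X ⋙ Over.forget X) {Y : SSet.{u}} {q : Y ⟶ X} (hq : kfib q)
    {g : (realization M).obj (Over.mk (𝟙 X)) ⟶ Y} (hg : sWeq g)
    (hgq : ∀ τ : Simplices X, (realizationUnit M).app τ ≫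
      (realization M).map (Over.mkIdTerminal.from _) ≫ g ≫ q = α.app τ ≫ τ.hom)
    (σ : Simplices X) {Z : SSet.{u}} {a : Z ⟶ simplexFunctor.obj σ.left} {b : Z ⟶ Y}
    (pb : IsPullback a b σ.hom q) {l : M.obj σ ⟶ Z} (hla : l ≫ a = α.app σ)
    (hlb : l ≫ b = (realizationUnit M).app σ ≫
      (realization M).map (Over.mkIdTerminal.from _) ≫ g) : sWeq l := by
  obtain ⟨ε, hε⟩ := exists_realization_natTrans α
  have hmap : ∀ ⦃ρ τ : Simplices X⦄ (φ : ρ ⟶ τ),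
      sWeq ((realization M).map ((simplexOver X).map φ)) := by
    intro ρ τ φ
    refine sWeq.of_precomp ((realizationUnit M).app ρ) _ (sWeq_of_isIso _) ?_
    have e := sWeq.comp_mem _ _ (hM' φ) (sWeq_of_isIso ((realizationUnit M).app τ))
    rwa [(realizationUnit M).naturality φ] at e
  have hgq : g ≫ q = ε.app (Over.mk (𝟙 X)) := by
    refine realization_hom_ext fun τ t => ?_
    obtain rfl := Over.mkIdTerminal.hom_ext t (Over.mkIdTerminal.from _)
    have e₂ : ((Over.forget X).map (Over.mkIdTerminal.from ((simplexOver X).obj τ))) = τ.hom :=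
      (Category.comp_id _).symm.trans (Over.w (Over.mkIdTerminal.from ((simplexOver X).obj τ)))
    have e₃ := congrArg ((realizationUnit M).app τ ≫ ·)
      (ε.naturality (Over.mkIdTerminal.from ((simplexOver X).obj τ)))
    refine (hgq τ).trans (Eq.trans ?_ e₃.symm)
    exact (congrArg (· ≫ τ.hom) (hε τ)).symm.trans ((Category.assoc _ _ _).trans
      (congrArg (fun t => (realizationUnit M).app τ ≫ ε.app _ ≫ t) e₂.symm))
  refine sWeq.of_precomp (inv ((realizationUnit M).app σ)) _ (sWeq_of_isIso _) ?_
  refine sWeq_to_pullback ε hM hmap hq hg hgq σ pb ?_ ?_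
  · exact (Category.assoc _ _ _).trans ((congrArg (inv _ ≫ ·) hla).trans
      ((IsIso.inv_comp_eq _).2 (hε σ).symm))
  · rw [Category.assoc, hlb, IsIso.inv_hom_id_assoc]

end Diagrams

section Globalisation

variable {C : Type u} [EnrichedCategory SSet.{u} C] {X : SSet.{u}}

instance (c : C) : PreservesColimitsOfShape (Simplices X) (evalAt c) where
  preservesColimit := fun {K} =>
    preservesColimit_of_preserves_colimit_cocone (SPsh.colimitCoconeIsColimit K)
      (colimit.isColimit (SPsh.diag K c))

/-- The value of the colimit of a diagram is the realization of the diagram of values. -/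
lemma exists_realization_iso_colimit (K : Simplices X ⥤ SPsh C) (c : C) :
    ∃ g : (realization (K ⋙ evalAt c)).obj (Over.mk (𝟙 X)) ⟶ (colimit K).obj c, IsIso g ∧
      ∀ σ : Simplices X, (realizationUnit (K ⋙ evalAt c)).app σ ≫
        (realization (K ⋙ evalAt c)).map (Over.mkIdTerminal.from _) ≫ g =
          (colimit.ι K σ).app c := by
  obtain ⟨g, hg⟩ := exists_realization_desc_cocone ((evalAt c).mapCocone (colimit.cocone K))
  exact ⟨g, isIso_of_isColimit (isColimitOfPreserves (evalAt c) (colimit.isColimit K)) hg, hg⟩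

/-- The colimit of a weak equivalence of flat diagrams. -/
lemma weq_colimMap {K K' : Simplices X ⥤ SPsh C} (hK : ∀ c, Flat (realization (K ⋙ evalAt c)))
    (hK' : ∀ c, Flat (realization (K' ⋙ evalAt c))) (f : K ⟶ K') (hf : ∀ σ, weq (f.app σ)) :
    weq (colimMap f) := by
  intro c
  obtain ⟨g, hg, hg₁⟩ := exists_realization_iso_colimit K c
  obtain ⟨g', hg', hg₁'⟩ := exists_realization_iso_colimit K' c
  obtain ⟨θ, hθ⟩ := exists_realization_natTrans
    (Functor.whiskerRight f (evalAt c) ≫ realizationUnit (K' ⋙ evalAt c))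
  have h : sWeq (θ.app (Over.mk (𝟙 X))) := by
    refine sWeq_app_of_flat (hK c) (hK' c) θ (fun σ => ?_) _
    refine sWeq.of_precomp ((realizationUnit (K ⋙ evalAt c)).app σ) _ (sWeq_of_isIso _) ?_
    rw [hθ]
    exact sWeq.comp_mem _ _ (hf σ c) (sWeq_of_isIso _)
  refine sWeq.of_precomp g _ (sWeq_of_isIso g) ?_
  have e : g ≫ (colimMap f).app c = θ.app _ ≫ g' := by
    refine realization_hom_ext fun σ t => ?_
    obtain rfl := Over.mkIdTerminal.hom_ext t (Over.mkIdTerminal.from _)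
    rw [reassoc_of% hg₁, θ.naturality_assoc, reassoc_of% hθ, NatTrans.comp_app, Category.assoc,
      hg₁']
    exact congrArg (fun f => SPsh.Hom.app f c) (ι_colimMap f σ)
  rw [e]
  exact sWeq.comp_mem _ _ h (sWeq_of_isIso g')

variable (Q : CofibrantReplacement C (Simplices X))

lemma weq_Q_map {K K' : Simplices X ⥤ SPsh C} (f : K ⟶ K') (hf : ∀ σ, weq (f.app σ))
    (σ : Simplices X) : weq ((Q.Q.map f).app σ) := by
  have e : (Q.Q.map f).app σ ≫ (Q.π.app K').app σ = (Q.π.app K).app σ ≫ f.app σ :=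
    congrArg (fun t => NatTrans.app t σ) (Q.π.naturality f)
  intro c
  refine sWeq.of_postcomp _ _ (Q.weq_app K' σ c) ?_
  have := weq_comp (Q.weq_app K σ) (hf σ) c
  rw [← e] at this
  exact this

lemma weq_colimMap_Q_map {K K' : Simplices X ⥤ SPsh C} (f : K ⟶ K') (hf : ∀ σ, weq (f.app σ)) :
    weq (colimMap (Q.Q.map f)) :=
  weq_colimMap (flat_realization_of_cofibrantReplacement Q K)
    (flat_realization_of_cofibrantReplacement Q K') _ (weq_Q_map Q f hf)

lemma weq_Q_obj_map {K : Simplices X ⥤ SPsh C} (hK : ∀ ⦃σ τ : Simplices X⦄ (φ : σ ⟶ τ),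
    weq (K.map φ)) ⦃σ τ : Simplices X⦄ (φ : σ ⟶ τ) : weq ((Q.Q.obj K).map φ) := by
  intro c
  refine sWeq.of_postcomp _ _ (Q.weq_app K τ c) ?_
  have := weq_comp (Q.weq_app K σ) (hK φ) c
  have e : (Q.Q.obj K).map φ ≫ (Q.π.app K).app τ = (Q.π.app K).app σ ≫ K.map φ :=
    (Q.π.app K).naturality φ
  rw [← e] at this
  exact this

lemma ι_LGlobOver_hom (L : Over (U C X)) (σ : Simplices X) :
    colimit.ι (Q.Q.obj L.left) σ ≫ ((LGlobOver Q).obj L).hom =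
      (Q.π.app L.left).app σ ≫ L.hom.app σ ≫ toX C σ :=
  colimit.ι_desc _ _

/-- A diagram of weak equivalences is recovered from its homotopy colimit. -/
theorem weq_to_pullback (L : Over (U C X)) (hL : ∀ ⦃σ τ : Simplices X⦄ (φ : σ ⟶ τ),
    weq (L.left.map φ)) {E : SPsh C} {q : E ⟶ (SPsh.const C).obj X} (hq : fib q)
    {j : colimit (Q.Q.obj L.left) ⟶ E} (hj : weq j) (hjq : j ≫ q = ((LGlobOver Q).obj L).hom)
    {σ : Simplices X} {l : (Q.Q.obj L.left).obj σ ⟶ pullback (toX C σ) q}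
    (h₁ : l ≫ pullback.fst _ _ = (Q.π.app L.left).app σ ≫ L.hom.app σ)
    (h₂ : l ≫ pullback.snd _ _ = colimit.ι (Q.Q.obj L.left) σ ≫ j) : weq l := by
  intro c
  obtain ⟨g, hg, hg₁⟩ := exists_realization_iso_colimit (Q.Q.obj L.left) c
  refine sWeq_to_pullback_of_diagram (flat_realization_of_cofibrantReplacement Q L.left c)
    (fun ρ τ φ => weq_Q_obj_map Q hL φ c)
    (Functor.whiskerRight (Q.π.app L.left ≫ L.hom) (evalAt c)) (hq c)
    (sWeq.comp_mem _ _ (sWeq_of_isIso g) (hj c)) (fun τ => ?_) σ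
    (isPullback_pullback_app (toX C σ) q c) (congrArg (fun f => SPsh.Hom.app f c) h₁) ?_
  · have e₁ := congrArg (fun f => SPsh.Hom.app f c)
      ((congrArg (colimit.ι (Q.Q.obj L.left) τ ≫ ·) hjq).trans (ι_LGlobOver_hom Q L τ))
    exact (comp_comp_assoc _ _ _ _ _).trans ((congrArg (· ≫ (j.app c ≫ q.app c)) (hg₁ τ)).trans
      (e₁.trans (Category.assoc _ _ _).symm))
  · rw [reassoc_of% hg₁]
    exact congrArg (fun f => SPsh.Hom.app f c) h₂

/-- A presheaf over `X` is the homotopy colimit of its localisation. -/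
theorem weq_of_Loc (A : Over ((SPsh.const C).obj X))
    {j : colimit (Q.Q.obj ((Loc X).obj A).left) ⟶ A.left}
    (hj : ∀ σ, colimit.ι (Q.Q.obj ((Loc X).obj A).left) σ ≫ j =
      (Q.π.app ((Loc X).obj A).left).app σ ≫ pullback.snd (toX C σ) A.hom) : weq j := by
  intro c
  let L := ((Loc X).obj A).left
  obtain ⟨g, hg, hg₁⟩ := exists_realization_iso_colimit (Q.Q.obj L) c
  have hr := fun σ : Simplices X => isPullback_pullback_app (toX C σ) A.hom c
  let p : A.left.obj c ⟶ X := A.hom.app c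
  have hb := isPullback_baseChange p
  let s (σ : Simplices X) : (L.obj σ).obj c ⟶ (baseChange p).obj ((simplexOver X).obj σ) :=
    (hb _).lift ((pullback.fst (toX C σ) A.hom).app c) ((pullback.snd (toX C σ) A.hom).app c)
      (hr σ).w
  have hs₁ (σ : Simplices X) : s σ ≫ baseChangeFst p _ = (pullback.fst (toX C σ) A.hom).app c :=
    (hb _).lift_fst _ _ _
  have hs₂ (σ : Simplices X) : s σ ≫ baseChangeSnd p _ = (pullback.snd (toX C σ) A.hom).app c :=
    (hb _).lift_snd _ _ _
  have hs (σ : Simplices X) : IsIso (s σ) :=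
    isIso_lift_of_isPullback (hr σ) (hb _)
  -- At the object `c` the localised diagram is the base change of the simplices of `X` along `p`.
  -- Base change is flat and cocontinuous for every `p`, so no fibrancy is needed here.
  let β : L ⋙ evalAt c ⟶ simplexOver X ⋙ baseChange p :=
    { app := s
      naturality := fun σ τ φ => by
        refine (hb _).hom_ext ?_ ?_
        · exact (Category.assoc _ _ _).trans ((congrArg (_ ≫ ·) (hs₁ τ)).trans
            ((pbMap_app_fst (U_map_toX φ) (Category.id_comp A.hom) c).trans
              ((congrArg (· ≫ simplexFunctor.map φ.left) (hs₁ σ)).symm.trans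
                ((Category.assoc _ _ _).trans ((congrArg (s σ ≫ ·)
                  (baseChange_map_fst p ((simplexOver X).map φ)).symm).trans
                    (Category.assoc _ _ _).symm)))))
        · exact (Category.assoc _ _ _).trans ((congrArg (_ ≫ ·) (hs₂ τ)).trans
            ((pbMap_app_snd (U_map_toX φ) (Category.id_comp A.hom) c).trans
              ((Category.comp_id _).trans ((hs₂ σ).symm.trans ((congrArg (s σ ≫ ·)
                  (baseChange_map_snd p ((simplexOver X).map φ)).symm).trans
                    (Category.assoc _ _ _).symm))))) }
  obtain ⟨θ, hθ⟩ := exists_realization_natTrans (Functor.whiskerRight (Q.π.app L) (evalAt c) ≫ β)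
  have h : sWeq (θ.app (Over.mk (𝟙 X))) := by
    refine sWeq_app_of_flat (flat_realization_of_cofibrantReplacement Q L c)
      (fun V V' f hf => mono_baseChange_map p f) θ (fun σ => ?_) _
    refine sWeq.of_precomp ((realizationUnit (Q.Q.obj L ⋙ evalAt c)).app σ) _ (sWeq_of_isIso _) ?_
    rw [hθ]
    exact sWeq.comp_mem _ _ (Q.weq_app L σ c) (sWeq_of_isIso (s σ))
  have : IsIso (Over.mk (𝟙 X)).hom := inferInstanceAs (IsIso (𝟙 X))
  have : IsIso (baseChangeSnd p (Over.mk (𝟙 X))) := (hb _).isIso_snd_of_isIso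
  refine sWeq.of_precomp g _ (sWeq_of_isIso g) ?_
  have e : g ≫ j.app c = θ.app _ ≫ baseChangeSnd p (Over.mk (𝟙 X)) := by
    refine realization_hom_ext fun σ t => ?_
    obtain rfl := Over.mkIdTerminal.hom_ext t (Over.mkIdTerminal.from _)
    rw [reassoc_of% hg₁, θ.naturality_assoc, reassoc_of% hθ, NatTrans.comp_app, Category.assoc,
      baseChange_map_snd]
    refine (congrArg (fun f => SPsh.Hom.app f c) (hj σ)).trans ?_
    exact (congrArg (((Q.π.app L).app σ).app c ≫ ·) (hs₂ σ)).symm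
  rw [e]
  exact sWeq.comp_mem _ _ h (sWeq_of_isIso _)

lemma LocData.weq_toOver_map {F : SPsh C} (K : LocData F X) ⦃σ τ : Simplices X⦄ (φ : σ ⟶ τ) :
    weq (((LocData.toOver F X).obj K).left.map φ) :=
  (K.left.map φ).2

lemma exists_lift_pullback (L : Over (U C X)) {E : SPsh C} {q : E ⟶ (SPsh.const C).obj X}
    {j : colimit (Q.Q.obj L.left) ⟶ E} (hjq : j ≫ q = ((LGlobOver Q).obj L).hom)
    (σ : Simplices X) : ∃ l : (Q.Q.obj L.left).obj σ ⟶ pullback (toX C σ) q,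
      l ≫ pullback.fst _ _ = (Q.π.app L.left).app σ ≫ L.hom.app σ ∧
      l ≫ pullback.snd _ _ = colimit.ι (Q.Q.obj L.left) σ ≫ j :=
  ⟨pullback.lift ((Q.π.app L.left).app σ ≫ L.hom.app σ) (colimit.ι (Q.Q.obj L.left) σ ≫ j) (by
    rw [Category.assoc, Category.assoc, hjq, ι_LGlobOver_hom]), pullback.lift_fst _ _ _,
    pullback.lift_snd _ _ _⟩

/-- Over a vertex the comparison with the pullback is a weak equivalence from `QL(x)` to the
homotopy fibre, and `QL(x)` is equivalent to `L(x)`. -/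
lemma hasHomotopyFiber_of_fibration {F : SPsh C} (L : Over (U C X))
    (hL : ∀ ⦃σ τ : Simplices X⦄ (φ : σ ⟶ τ), weq (L.left.map φ)) (x : Δ[0] ⟶ X)
    (h : Equivalent (L.left.obj (CostructuredArrow.mk x)) F)
    {E : SPsh C} {q : E ⟶ (SPsh.const C).obj X} (hq : fib q)
    {j : colimit (Q.Q.obj L.left) ⟶ E} (hj : weq j) (hjq : j ≫ q = ((LGlobOver Q).obj L).hom) :
    HasHomotopyFiber F ((LGlobOver Q).obj L).hom x := by
  refine ⟨E, j, q, hj, hq, hjq, ?_⟩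
  obtain ⟨l, h₁, h₂⟩ := exists_lift_pullback Q L hjq (CostructuredArrow.mk x)
  have hl := weq_to_pullback Q L hL hq hj hjq h₁ h₂
  have e₁ : Equivalent (pullback ((SPsh.const C).map x)
      q) ((Q.Q.obj L.left).obj (CostructuredArrow.mk x)) :=
    (Equivalent.of_weq hl).symm
  exact (e₁.trans (Equivalent.of_weq (Q.weq_app L.left _))).trans h

lemma exists_fibrant_replacement {E B : SPsh C} (p : E ⟶ B) :
    ∃ (E' : SPsh C) (i : E ⟶ E') (q : E' ⟶ B), weq i ∧ fib q ∧ i ≫ q = p := by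
  obtain ⟨R⟩ := nonempty_fibrantFactorization (C := C)
  exact ⟨_, R.i.app (Arrow.mk p), R.p.app (Arrow.mk p), (R.hi _).2, R.hp _,
    toFibRep_hom R (Over.mk p)⟩

lemma hasHomotopyFiber_LGlobOver {F : SPsh C} (L : Over (U C X))
    (hL : ∀ ⦃σ τ : Simplices X⦄ (φ : σ ⟶ τ), weq (L.left.map φ)) (x : Δ[0] ⟶ X)
    (h : Equivalent (L.left.obj (CostructuredArrow.mk x)) F) :
    HasHomotopyFiber F ((LGlobOver Q).obj L).hom x := by
  obtain ⟨E, j, q, hj, hq, hjq⟩ := exists_fibrant_replacement ((LGlobOver Q).obj L).hom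
  exact hasHomotopyFiber_of_fibration Q L hL x h hq hj hjq

theorem lGlobRestricts (F : SPsh C) : LGlobRestricts Q F where
  fiber K x := hasHomotopyFiber_LGlobOver Q _ (LocData.weq_toOver_map K) x (K.left.obj _).equiv
  weq_map _ _ f := weq_colimMap_Q_map Q _ fun σ => (f.left.app σ).2

end Globalisation

/-! ### Comparison of extensions and local data -/

section Comparison

variable {C : Type u} [EnrichedCategory SSet.{u} C] {X : SSet.{u}}

/-- The cocone on the cofibrant replacement of the localisation of a presheaf over `X`. -/
def locCocone (Q : CofibrantReplacement C (Simplices X)) (A : Over ((SPsh.const C).obj X)) :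
    Cocone (Q.Q.obj ((Loc X).obj A).left) where
  pt := A.left
  ι :=
    { app := fun σ => (Q.π.app ((Loc X).obj A).left).app σ ≫ pullback.snd (toX C σ) A.hom
      naturality := fun σ τ φ => by
        have h₁ := (Q.π.app ((Loc X).obj A).left).naturality φ
        have h₂ : ((Loc X).obj A).left.map φ ≫ pullback.snd (toX C τ) A.hom =
          pullback.snd (toX C σ) A.hom :=
          (pbMap_snd _ _ (U_map_toX φ) (Category.id_comp A.hom)).trans (Category.comp_id _)
        refine ((Category.assoc _ _ _).symm.trans (congrArg (· ≫ _) h₁)).trans ?_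
        refine ((Category.assoc _ _ _).trans (congrArg (_ ≫ ·) h₂)).trans ?_
        exact (Category.comp_id _).symm }

/-- The map from the globalisation of the localisation of a presheaf over `X`. -/
def locDesc (Q : CofibrantReplacement C (Simplices X)) (A : Over ((SPsh.const C).obj X)) :
    colimit (Q.Q.obj ((Loc X).obj A).left) ⟶ A.left :=
  colimit.desc _ (locCocone Q A)

lemma ι_locDesc (Q : CofibrantReplacement C (Simplices X)) (A : Over ((SPsh.const C).obj X))
    (σ : Simplices X) : colimit.ι (Q.Q.obj ((Loc X).obj A).left) σ ≫ locDesc Q A =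
      (Q.π.app ((Loc X).obj A).left).app σ ≫ pullback.snd (toX C σ) A.hom :=
  colimit.ι_desc _ σ

lemma locDesc_hom (Q : CofibrantReplacement C (Simplices X)) (A : Over ((SPsh.const C).obj X)) :
    locDesc Q A ≫ A.hom = ((LGlobOver Q).obj ((Loc X).obj A)).hom := by
  refine colimit.hom_ext fun σ => ?_
  have h : pullback.snd (toX C σ) A.hom ≫ A.hom = ((Loc X).obj A).hom.app σ ≫ toX C σ :=
    pullback.condition.symm
  refine Eq.trans ?_ (ι_LGlobOver_hom Q ((Loc X).obj A) σ).symm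
  refine ((Category.assoc _ _ _).symm.trans (congrArg (· ≫ A.hom) (ι_locDesc Q A σ))).trans ?_
  exact (Category.assoc _ _ _).trans
    (congrArg ((Q.π.app ((Loc X).obj A).left).app σ ≫ ·) h)

lemma colimMap_locDesc (Q : CofibrantReplacement C (Simplices X))
    {A B : Over ((SPsh.const C).obj X)} (f : A ⟶ B) :
    colimMap (Q.Q.map ((Loc X).map f).left) ≫ locDesc Q B = locDesc Q A ≫ f.left := by
  refine colimit.hom_ext fun σ => ?_
  have h₁ := congrArg (fun t => NatTrans.app t σ) (Q.π.naturality ((Loc X).map f).left)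
  have h₂ : ((Loc X).map f).left.app σ ≫ pullback.snd (toX C σ) B.hom =
    pullback.snd (toX C σ) A.hom ≫ f.left := pbMap_snd _ _ (Category.id_comp _) (Over.w f)
  rw [ι_colimMap_assoc, ι_locDesc, ← Category.assoc _ (locDesc Q A), ι_locDesc]
  refine ((Category.assoc _ _ _).symm.trans (congrArg (· ≫ _) h₁)).trans ?_
  refine ((Category.assoc _ _ _).trans (congrArg (_ ≫ ·) h₂)).trans ?_
  exact (Category.assoc _ _ _).symm

/-- Every presheaf over `X` receives a map from the globalisation of its localisation. -/
def locCounit (Q : CofibrantReplacement C (Simplices X)) : Loc X ⋙ LGlobOver Q ⟶ 𝟭 _ where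
  app A := Over.homMk (locDesc Q A) (locDesc_hom Q A)
  naturality A B f := by
    ext : 1
    exact colimMap_locDesc Q f

lemma weq_locCounit_app (Q : CofibrantReplacement C (Simplices X))
    (A : Over ((SPsh.const C).obj X)) : weq ((locCounit Q).app A).left :=
  weq_of_Loc Q A (ι_locDesc Q A)

/-- The cofibrant replacement of a diagram over `U`. -/
def cofRep (Q : CofibrantReplacement C (Simplices X)) : Over (U C X) ⥤ Over (U C X) where
  obj L := Over.mk (Q.π.app L.left ≫ L.hom)
  map {L L'} f := Over.homMk (Q.Q.map f.left) (by
    have h := Q.π.naturality f.left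
    refine ((Category.assoc _ _ _).symm.trans (congrArg (· ≫ _) h)).trans ?_
    exact (Category.assoc _ _ _).trans (congrArg (_ ≫ ·) (Over.w f)))
  map_id L := by
    ext : 1
    exact Q.Q.map_id _
  map_comp f g := by
    ext : 1
    exact Q.Q.map_comp _ _

/-- The augmentation of the cofibrant replacement of a diagram over `U`. -/
def cofRepπ (Q : CofibrantReplacement C (Simplices X)) : cofRep Q ⟶ 𝟭 _ where
  app L := Over.homMk (Q.π.app L.left) rfl
  naturality L L' f := by
    ext : 1
    exact Q.π.naturality f.left

variable (R : FibrantFactorization C)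

/-- The components of the map to the localisation of the globalisation of a diagram over `U`. -/
def toLocGlobApp (Q : CofibrantReplacement C (Simplices X)) (L : Over (U C X)) (σ : Simplices X) :
    (Q.Q.obj L.left).obj σ ⟶ pullback (toX C σ) ((fibRep R _).obj ((LGlobOver Q).obj L)).hom :=
  pullback.lift ((Q.π.app L.left).app σ ≫ L.hom.app σ)
    (colimit.ι (Q.Q.obj L.left) σ ≫ toFibRep R ((LGlobOver Q).obj L))
    ((Category.assoc _ _ _).trans ((ι_LGlobOver_hom Q L σ).symm.trans
      ((congrArg (colimit.ι (Q.Q.obj L.left) σ ≫ ·)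
        (toFibRep_hom R ((LGlobOver Q).obj L))).symm.trans (Category.assoc _ _ _).symm)))

lemma toLocGlobApp_fst (Q : CofibrantReplacement C (Simplices X)) (L : Over (U C X))
    (σ : Simplices X) : toLocGlobApp R Q L σ ≫ pullback.fst _ _ =
      (Q.π.app L.left).app σ ≫ L.hom.app σ :=
  pullback.lift_fst _ _ _

lemma toLocGlobApp_snd (Q : CofibrantReplacement C (Simplices X)) (L : Over (U C X))
    (σ : Simplices X) : toLocGlobApp R Q L σ ≫ pullback.snd _ _ =
      colimit.ι (Q.Q.obj L.left) σ ≫ toFibRep R ((LGlobOver Q).obj L) :=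
  pullback.lift_snd _ _ _

lemma toLocGlobApp_pbMap (Q : CofibrantReplacement C (Simplices X)) (L : Over (U C X))
    {σ τ : Simplices X} (φ : σ ⟶ τ) : (Q.Q.obj L.left).map φ ≫ toLocGlobApp R Q L τ =
      toLocGlobApp R Q L σ ≫ pbMap ((U C X).map φ) (𝟙 _) (U_map_toX φ) (Category.id_comp _) := by
  refine pullback.hom_ext ?_ ?_
  · rw [Category.assoc, Category.assoc, toLocGlobApp_fst, pbMap_fst, ← Category.assoc _ _
      ((U C X).map φ), toLocGlobApp_fst]
    exact (Q.π.app L.left ≫ L.hom).naturality φ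
  · rw [Category.assoc, Category.assoc, toLocGlobApp_snd, pbMap_snd, Category.comp_id,
      toLocGlobApp_snd]
    exact (Category.assoc _ _ _).symm.trans
      (congrArg (· ≫ _) (colimit.w (Q.Q.obj L.left) φ))

lemma map_toLocGlobApp (Q : CofibrantReplacement C (Simplices X)) {L L' : Over (U C X)} (f : L ⟶ L')
    (σ : Simplices X) : (Q.Q.map f.left).app σ ≫ toLocGlobApp R Q L' σ =
      toLocGlobApp R Q L σ ≫ pbMap (𝟙 _) ((fibRep R _).map ((LGlobOver Q).map f)).left
        (Category.id_comp _) (Over.w ((fibRep R _).map ((LGlobOver Q).map f))) := by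
  refine pullback.hom_ext ?_ ?_
  · rw [Category.assoc, Category.assoc, toLocGlobApp_fst, pbMap_fst, Category.comp_id,
      toLocGlobApp_fst]
    exact congrArg (fun t => NatTrans.app t σ) (Over.w ((cofRep Q).map f))
  · have h : colimit.ι (Q.Q.obj L.left) σ ≫ ((LGlobOver Q).map f).left =
      (Q.Q.map f.left).app σ ≫ colimit.ι (Q.Q.obj L'.left) σ := ι_colimMap (Q.Q.map f.left) σ
    rw [Category.assoc, Category.assoc, toLocGlobApp_snd, pbMap_snd, ← Category.assoc _ _
      ((fibRep R _).map ((LGlobOver Q).map f)).left, toLocGlobApp_snd]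
    refine Eq.trans ?_ (Category.assoc _ _ _).symm
    refine Eq.trans ?_ (congrArg (_ ≫ ·) (toFibRep_naturality R ((LGlobOver Q).map f))).symm
    exact (Category.assoc _ _ _).symm.trans ((congrArg (· ≫ _) h.symm).trans (Category.assoc _ _ _))

/-- The cofibrant replacement of a diagram over `U` maps to the localisation of its
globalisation. -/
def toLocGlob (Q : CofibrantReplacement C (Simplices X)) :
    cofRep Q ⟶ LGlobOver Q ⋙ RLocOver R X where
  app L := Over.homMk
    { app := toLocGlobApp R Q L
      naturality := fun _ _ φ => toLocGlobApp_pbMap R Q L φ }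
    (by
      ext σ : 2
      exact toLocGlobApp_fst R Q L σ)
  naturality L L' f := by
    ext σ : 3
    exact map_toLocGlobApp R Q f σ

lemma weq_toLocGlob_app (Q : CofibrantReplacement C (Simplices X)) (L : Over (U C X))
    (hL : ∀ ⦃σ τ : Simplices X⦄ (φ : σ ⟶ τ), weq (L.left.map φ)) (σ : Simplices X) :
    weq (((toLocGlob R Q).app L).left.app σ) :=
  weq_to_pullback Q L hL (fib_fibRep_hom R ((LGlobOver Q).obj L))
    (weq_toFibRep R ((LGlobOver Q).obj L))
    (toFibRep_hom R ((LGlobOver Q).obj L)) (toLocGlobApp_fst R Q L σ) (toLocGlobApp_snd R Q L σ)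

end Comparison

section Comparison

variable {C : Type u} [EnrichedCategory SSet.{u} C] {X : SSet.{u}} (R : FibrantFactorization C)

/-! ### Functors of extensions and of local data -/

variable (F : SPsh C) {D : Type*} [Category* D]

variable {F} in
/-- Natural transformations of functors to extensions. -/
def Ext.natTrans {G G' : D ⥤ Ext F X} (θ : G ⋙ Ext.toOver F X ⟶ G' ⋙ Ext.toOver F X)
    (h : ∀ d, weq (θ.app d).left) : G ⟶ G' where
  app d := ⟨(θ.app d).left, h d, Over.w (θ.app d)⟩
  naturality _ _ f := Subtype.ext (congrArg CommaMorphism.left (θ.naturality f))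

variable {F} in
/-- Natural transformations of functors to local data. -/
def LocData.natTrans {G G' : D ⥤ LocData F X}
    (θ : G ⋙ LocData.toOver F X ⟶ G' ⋙ LocData.toOver F X)
    (h : ∀ d σ, weq ((θ.app d).left.app σ)) : G ⟶ G' where
  app d := CostructuredArrow.homMk
    { app := fun σ => ⟨(θ.app d).left.app σ, h d σ⟩
      naturality := fun _ _ φ => Subtype.ext ((θ.app d).left.naturality φ) }
    (by
      ext σ : 2
      exact congrArg (fun t => NatTrans.app t σ) (Over.w (θ.app d)))
  naturality _ _ f := by
    ext σ : 3
    refine Subtype.ext ?_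
    exact congrArg (fun t => NatTrans.app (CommaMorphism.left t) σ) (θ.naturality f)

variable {F} in
lemma hasHomotopyFiber_of_fib {E : SPsh C} {q : E ⟶ (SPsh.const C).obj X} (hq : fib q)
    {x : Δ[0] ⟶ X} (h : Equivalent (pullback ((SPsh.const C).map x) q) F) :
    HasHomotopyFiber F q x :=
  ⟨E, 𝟙 E, q, weq_id E, hq, Category.id_comp q, h⟩

/-- The fibrant replacement of extensions. -/
def Ext.fibRep : Ext F X ⥤ Ext F X where
  obj A := ⟨_, ((ModFib.fibRep R _).obj ((Ext.toOver F X).obj A)).hom, fun x =>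
    hasHomotopyFiber_of_fib (fib_fibRep_hom R ((Ext.toOver F X).obj A))
      ((rLocRestricts R F).equiv A (CostructuredArrow.mk x))⟩
  map f := ⟨_, weq_fibRep_map R ((Ext.toOver F X).map f) f.2.1, Over.w ((ModFib.fibRep R _).map ((Ext.toOver F X).map f))⟩
  map_id A := Subtype.ext
    (congrArg CommaMorphism.left ((Ext.toOver F X ⋙ ModFib.fibRep R _).map_id A))
  map_comp f g := Subtype.ext
    (congrArg CommaMorphism.left ((Ext.toOver F X ⋙ ModFib.fibRep R _).map_comp f g))

/-- Extensions map to their fibrant replacement. -/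
def Ext.toFibRep : 𝟭 (Ext F X) ⟶ Ext.fibRep R F where
  app A := ⟨ModFib.toFibRep R ((Ext.toOver F X).obj A), weq_toFibRep R ((Ext.toOver F X).obj A),
    toFibRep_hom R ((Ext.toOver F X).obj A)⟩
  naturality _ _ f := Subtype.ext (toFibRep_naturality R ((Ext.toOver F X).map f)).symm

/-- The cofibrant replacement of local data. -/
def LocData.cofRep (Q : CofibrantReplacement C (Simplices X)) : LocData F X ⥤ LocData F X where
  obj K := CostructuredArrow.mk
    (Y := ({ obj := fun σ => ⟨(Q.Q.obj ((LocData.toOver F X).obj K).left).obj σ,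
                (Equivalent.of_weq (Q.weq_app _ σ)).trans (K.left.obj σ).equiv⟩
             map := fun φ => ⟨_, weq_Q_obj_map Q (LocData.weq_toOver_map K) φ⟩
             map_id := fun σ => Subtype.ext ((Q.Q.obj _).map_id σ)
             map_comp := fun φ ψ => Subtype.ext ((Q.Q.obj _).map_comp φ ψ) } :
            Simplices X ⥤ WeCat F))
    { app := fun σ => ((ModFib.cofRep Q).obj ((LocData.toOver F X).obj K)).hom.app σ
      naturality := ((ModFib.cofRep Q).obj ((LocData.toOver F X).obj K)).hom.naturality }
  map f := CostructuredArrow.homMk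
    { app := fun σ => ⟨_, weq_Q_map Q ((LocData.toOver F X).map f).left (fun σ => (f.left.app σ).2) σ⟩
      naturality := fun _ _ φ => Subtype.ext
        (((ModFib.cofRep Q).map ((LocData.toOver F X).map f)).left.naturality φ) }
    (by
      ext σ : 2
      exact congrArg (fun t => NatTrans.app t σ)
        (Over.w ((ModFib.cofRep Q).map ((LocData.toOver F X).map f))))
  map_id K := by
    ext σ : 3
    refine Subtype.ext ?_
    exact congrArg (fun t => NatTrans.app (CommaMorphism.left t) σ)
      ((LocData.toOver F X ⋙ ModFib.cofRep Q).map_id K)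
  map_comp f g := by
    ext σ : 3
    refine Subtype.ext ?_
    exact congrArg (fun t => NatTrans.app (CommaMorphism.left t) σ)
      ((LocData.toOver F X ⋙ ModFib.cofRep Q).map_comp f g)

variable (Q : CofibrantReplacement C (Simplices X)) (hR : RLocRestricts R F X)
  (hL : LGlobRestricts Q F)

/-- Globalising the localisation of an extension gives its fibrant replacement. -/
def globLocTo : RLoc R F X hR ⋙ LGlob Q F hL ⟶ Ext.fibRep R F :=
  Ext.natTrans (Functor.whiskerLeft (Ext.toOver F X ⋙ fibRep R _) (locCounit Q))
    fun _ => weq_locCounit_app Q _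

/-- The augmentation of the cofibrant replacement of local data. -/
def LocData.cofRepπ : LocData.cofRep F Q ⟶ 𝟭 (LocData F X) :=
  LocData.natTrans (Functor.whiskerLeft (LocData.toOver F X) (ModFib.cofRepπ Q))
    fun K σ => Q.weq_app ((LocData.toOver F X).obj K).left σ

/-- Localising the globalisation of local data gives its cofibrant replacement. -/
def toLocGlobOfLocData : LocData.cofRep F Q ⟶ LGlob Q F hL ⋙ RLoc R F X hR :=
  LocData.natTrans (Functor.whiskerLeft (LocData.toOver F X) (toLocGlob R Q))
    fun K σ => weq_toLocGlob_app R Q _ (LocData.weq_toOver_map K) σ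

end Comparison

/-! ### Nerves and natural transformations -/

section Nerve

universe v w

variable {A B : Type w} [Category.{v} A] [Category.{v} B] {F G : A ⥤ B} (α : F ⟶ G)

/-- Composable arrows in the target of a family of functors. -/
def whiskerArrows (T : Fin 2 ⥤ A ⥤ B) {n : ℕ} (x : ComposableArrows A n)
    (f : Fin (n + 1) ⥤ Fin 2) : ComposableArrows B n where
  obj i := (T.obj (f.obj i)).obj (x.obj i)
  map {i j} φ := (T.map (f.map φ)).app (x.obj i) ≫ (T.obj (f.obj j)).map (x.map φ)

lemma whiskerArrows_const (T : Fin 2 ⥤ A ⥤ B) {n : ℕ} (x : ComposableArrows A n)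
    {f : Fin (n + 1) ⥤ Fin 2} {k : Fin 2} (hf : ∀ i, f.obj i = k) :
    whiskerArrows T x f = x ⋙ T.obj k := by
  obtain rfl : f = (Functor.const _).obj k :=
    CategoryTheory.Functor.ext hf fun _ _ _ => Subsingleton.elim _ _
  exact CategoryTheory.Functor.ext (fun i => rfl) fun i j φ => by
    have h : (T.map (((Functor.const (Fin (n + 1))).obj k).map φ)).app (x.obj i) ≫
        (T.obj k).map (x.map φ) = (T.obj k).map (x.map φ) := by simp
    exact h.trans ((Category.id_comp _).trans (Category.comp_id _)).symm

/-- The homotopy of maps of nerves defined by a natural transformation. -/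
def nerveHomotopy : nerve A ⊗ (Δ[1] : SSet.{max v w}) ⟶ nerve B where
  app _ := ↾fun p => whiskerArrows (ComposableArrows.mk₁ α) p.1
    (stdSimplex.objEquiv p.2).toOrderHom.monotone.functor
  naturality _ _ _ := rfl

lemma ι₀_nerveHomotopy : ι₀ ≫ nerveHomotopy α = nerveMap F := by
  ext m x
  exact whiskerArrows_const (ComposableArrows.mk₁ α) x (k := 0) fun _ => rfl

lemma ι₁_nerveHomotopy : ι₁ ≫ nerveHomotopy α = nerveMap G := by
  ext m x
  exact whiskerArrows_const (ComposableArrows.mk₁ α) x (k := 1) fun _ => rfl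

include α in
-- The two ends of the cylinder are sections of the same projection, which is inverted, so they
-- agree in the localisation.
lemma Q_map_nerveMap_eq : sWeq.{max v w}.Q.map (nerveMap F) = sWeq.{max v w}.Q.map (nerveMap G) := by
  have : IsIso (sWeq.{max v w}.Q.map (fst (nerve A) Δ[1])) :=
    Localization.inverts _ _ _ (sWeq_fst _)
  have h : sWeq.{max v w}.Q.map (ι₀ : nerve A ⟶ nerve A ⊗ Δ[1]) = sWeq.Q.map ι₁ := by
    rw [← cancel_mono (sWeq.{max v w}.Q.map (fst (nerve A) Δ[1])), ← Functor.map_comp,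
      ← Functor.map_comp, ι₀_fst, ι₁_fst]
  rw [← ι₀_nerveHomotopy α, ← ι₁_nerveHomotopy α, Functor.map_comp, Functor.map_comp, h]

end Nerve

/-! ### Saturation of weak equivalences -/

section Saturation

/-- Homotopy classes of maps to a simplicial set. -/
def homotopyClasses (K : SSet.{u}) : SSet.{u} ⥤ (Type u)ᵒᵖ where
  obj A := op (π₀ ((ihom A).obj K))
  map f := (↾(mapπ₀ ((MonoidalClosed.pre f).app K))).op
  map_id A := by
    refine Quiver.Hom.unop_inj ?_
    ext x
    change mapπ₀ ((MonoidalClosed.pre (𝟙 A)).app K) x = x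
    rw [MonoidalClosed.pre_id]
    exact mapπ₀_id_apply x
  map_comp f g := by
    refine Quiver.Hom.unop_inj ?_
    ext x
    exact congrFun (mapπ₀_pre_comp f g K) x

/-- The functors of homotopy classes of maps to Kan complexes invert `sWeq`, so they factor through
the localisation; together they detect `sWeq` by its very definition. -/
lemma sWeq_of_isIso_Q_map {A B : SSet.{u}} {f : A ⟶ B} (h : IsIso (sWeq.{u}.Q.map f)) :
    sWeq f := by
  intro K _
  have hK : sWeq.{u}.IsInvertedBy (homotopyClasses K) := fun X Y g hg => by
    have : IsIso (↾(mapπ₀ ((MonoidalClosed.pre g).app K))) := (isIso_iff_bijective _).2 (hg K)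
    exact inferInstanceAs (IsIso (↾(mapπ₀ ((MonoidalClosed.pre g).app K))).op)
  have h₁ : IsIso ((homotopyClasses K).map f) :=
    ((NatIso.isIso_map_iff (Localization.fac (homotopyClasses K) hK sWeq.Q) f).1
      (inferInstanceAs (IsIso ((Localization.lift (homotopyClasses K) hK sWeq.Q).map
        (sWeq.Q.map f)))))
  have h₂ : IsIso (↾(mapπ₀ ((MonoidalClosed.pre f).app K))) := (isIso_op_iff _).1 h₁
  exact (isIso_iff_bijective _).1 h₂

end Saturation

/-! ### The equivalence of extensions and local data -/

section Main

variable {C : Type u} [EnrichedCategory SSet.{u} C] (F : SPsh C) {X : SSet.{u}}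
  (R : FibrantFactorization C) (Q : CofibrantReplacement C (Simplices X))
  (hR : RLocRestricts R F X) (hL : LGlobRestricts Q F)

/-- The zigzag is `LGlob (RLoc E) → RE ← E`. -/
lemma Q_map_nerveMap_RLoc_LGlob : sWeq.{u + 1}.Q.map
    (nerveMap (RLoc R F X hR) ≫ nerveMap (LGlob Q F hL)) = 𝟙 _ := by
  have h₁ := Q_map_nerveMap_eq (globLocTo R F Q hR hL)
  have h₂ := Q_map_nerveMap_eq (Ext.toFibRep (X := X) R F)
  exact (h₁.trans h₂.symm).trans (sWeq.{u + 1}.Q.map_id _)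

/-- The zigzag is `RLoc (LGlob K) ← QK → K`. -/
lemma Q_map_nerveMap_LGlob_RLoc : sWeq.{u + 1}.Q.map
    (nerveMap (LGlob Q F hL) ≫ nerveMap (RLoc R F X hR)) = 𝟙 _ := by
  have h₁ := Q_map_nerveMap_eq (toLocGlobOfLocData R F Q hR hL)
  have h₂ := Q_map_nerveMap_eq (LocData.cofRepπ F Q)
  exact (h₁.symm.trans h₂).trans (sWeq.{u + 1}.Q.map_id _)

include Q hL in
lemma sWeq_nerveMap_RLoc : sWeq.{u + 1} (nerveMap (RLoc R F X hR)) :=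
  sWeq_of_isIso_Q_map ⟨sWeq.{u + 1}.Q.map (nerveMap (LGlob Q F hL)),
    (sWeq.{u + 1}.Q.map_comp _ _).symm.trans (Q_map_nerveMap_RLoc_LGlob F R Q hR hL),
    (sWeq.{u + 1}.Q.map_comp _ _).symm.trans (Q_map_nerveMap_LGlob_RLoc F R Q hR hL)⟩

end Main

end ModFib

end

theorem mainTheorem2 {C : Type u} [EnrichedCategory SSet.{u} C] (F : ModFib.SPsh C)
    (X : SSet.{u}) :
    Nonempty (ModFib.FibrantFactorization C) ∧
    Nonempty (ModFib.CofibrantReplacement C (ModFib.Simplices X)) ∧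
    ∀ (R : ModFib.FibrantFactorization C)
      (Q : ModFib.CofibrantReplacement C (ModFib.Simplices X)),
      ∃ (hR : ModFib.RLocRestricts R F X) (hL : ModFib.LGlobRestricts Q F),
        ModFib.sWeq.{u + 1} (nerveMap (ModFib.RLoc R F X hR)) ∧
        ModFib.sWeq.{u + 1}.Q.map
            (nerveMap (ModFib.RLoc R F X hR) ≫ nerveMap (ModFib.LGlob Q F hL)) = 𝟙 _ ∧
        ModFib.sWeq.{u + 1}.Q.map
            (nerveMap (ModFib.LGlob Q F hL) ≫ nerveMap (ModFib.RLoc R F X hR)) = 𝟙 _ := by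
  exact ⟨ModFib.nonempty_fibrantFactorization, ModFib.nonempty_cofibrantReplacement, fun R Q =>
    ⟨ModFib.rLocRestricts R F, ModFib.lGlobRestricts Q F,
      ModFib.sWeq_nerveMap_RLoc F R Q _ (ModFib.lGlobRestricts Q F),
      ModFib.Q_map_nerveMap_RLoc_LGlob F R Q _ _, ModFib.Q_map_nerveMap_LGlob_RLoc F R Q _ _⟩⟩
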